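/- Consider the real Gaussian ISI channel $y_k=\sum_{i=0}^{L-1}h_ix_{k-i}+n_k$, where the inputs $x_k$ are i.i.d. real, zero-mean, with power $P_x=E x_0^2\in(0,\infty)$, and the noise $n_k$ is i.i.d. $\mathcal N(0,N_0)$, $N_0>0$, independent of the inputs. Let $s_x=E x_0^3/P_x^{3/2}$ and $\kappa_x=E x_0^4/P_x^2-3$ be the skewness and the excess kurtosis of the input. For a square-summable filter $(a_l)_{l\in\mathbb Z}$ with $c=\sum_l a_lh_{-l}\neq0$ (where $h_i=0$ for $i\notin\{0,\dots,L-1\}$) put $\alpha_k=\frac1c\sum_l a_lh_{-l-k}$ for $k\ge1$, and let $m\sim\mathcal N\bigl(0,N_0\sum_la_l^2/c^2\bigr)$ be independent of the inputs. Let $\hat\alpha_k,\hat m$ be the quantities obtained from a filter that minimizes $E\bigl(\sum_{k\ge1}\alpha_kx_k+m\bigr)^2$ (the unbiased MMSE-DFE); such a filter exists if $h\ne0$ and is unique up to a scalar factor. Define $$I_{\mathrm{MMSE}}=I\Bigl(x_0;\,x_0+\sum_{k\ge1}\hat\alpha_kx_k+\hat m\Bigr),\qquad I_{\mathrm{SL}}=I_x(\mathsf{SNR}),\qquad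 \mathsf{SNR}=\frac{E x_0^2}{E\bigl(\sum_{k\ge1}\hat\alpha_kx_k+\hat m\bigr)^2},$$ where $I_x(\gamma)=I\bigl(x_0;\sqrt{\gamma N_0/P_x}\,x_0+n_0\bigr)$. Fix the law of the input up to a positive scale factor. (a) If $E x_0^8<\infty$, $s_x=0$ and $\kappa_x\neq0$, then for every channel $h_0,\dots,h_{L-1}$ with at least two nonzero coefficients, $I_{\mathrm{MMSE}}<I_{\mathrm{SL}}$ whenever $P_x/N_0$ is sufficiently small (below a threshold that depends only on the channel and on the law of $x_0/\sqrt{P_x}$). (b) If $E x_0^6<\infty$ and $s_x\neq0$, then there exist channels for which $I_{\mathrm{MMSE}}<I_{\mathrm{SL}}$ whenever $P_x/N_0$ is sufficiently small; namely, this holds for every two-tap channel $h_0=\sqrt{1-q^2}$, $h_1=q$ with $0<q<1$. In particular, the Shamai–Laroia conjecture $I_{\mathrm{MMSE}}\ge I_{\mathrm{SL}}$ is false. -/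

import Mathlib

open MeasureTheory ProbabilityTheory Filter Topology
open scoped ENNReal

/-! ### Input statistics (of the law `ν` of a single zero-mean channel input) -/

/-- Average power `P_x = E x²`. -/
noncomputable def inputPower (ν : Measure ℝ) : ℝ := ∫ x, x ^ 2 ∂ν

/-- Skewness `E x³ / (E x²)^{3/2}`. -/
noncomputable def skewness (ν : Measure ℝ) : ℝ :=
  (∫ x, x ^ 3 ∂ν) / inputPower ν ^ (3 / 2 : ℝ)

/-- Excess kurtosis `E x⁴ / (E x²)² - 3`. -/
noncomputable def excessKurtosis (ν : Measure ℝ) : ℝ :=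
  (∫ x, x ^ 4 ∂ν) / inputPower ν ^ 2 - 3

/-! ### Mutual information -/

/-- Mutual information `I(X ; Y)` in nats: the Kullback-Leibler divergence of the joint law from
the product of the marginal laws. -/
noncomputable def mutualInfo {Ω α β : Type*} [MeasurableSpace Ω] [MeasurableSpace α]
    [MeasurableSpace β] (μ : Measure Ω) (X : Ω → α) (Y : Ω → β) : ℝ≥0∞ :=
  InformationTheory.klDiv (μ.map fun ω => (X ω, Y ω)) ((μ.map X).prod (μ.map Y))

/-- `I_x(γ) = I(x₀ ; √(γ N₀ / P_x) x₀ + n₀)`, where `x₀` has law `ν`, and `n₀ ∼ 𝒩(0, N₀)` is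
independent of `x₀`. -/
noncomputable def scalarInfo (ν : Measure ℝ) (N₀ γ : ℝ) : ℝ≥0∞ :=
  mutualInfo (ν.prod (gaussianReal 0 N₀.toNNReal)) (fun ω => ω.1)
    (fun ω => √(γ * N₀ / inputPower ν) * ω.1 + ω.2)

/-! ### Front-end filters

The channel is `y_k = ∑_{i < L} h_i x_{k-i} + n_k`.  A square-summable filter `a : ℤ → ℝ` is
applied to the output, giving `∑_l a_l y_{-l}`; the past inputs `x_k`, `k < 0`, are known. -/

/-- The coefficient `∑_l a_l h_{-l-k}` of the input `x_k` in `∑_l a_l y_{-l}`. -/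
noncomputable def inputCoeff {L : ℕ} (h : Fin L → ℝ) (a : ℤ → ℝ) (k : ℕ) : ℝ :=
  ∑ i : Fin L, h i * a (-(i : ℤ) - (k : ℤ))

/-- Residual interference coefficient `α_k` of the filter, normalized so that `x₀` has
coefficient one. -/
noncomputable def residualCoeff {L : ℕ} (h : Fin L → ℝ) (a : ℤ → ℝ) (k : ℕ) : ℝ :=
  inputCoeff h a k / inputCoeff h a 0

/-- Variance `E m² = N₀ ∑_l a_l² / c²` of the Gaussian noise term `m` after the filter. -/
noncomputable def filteredNoiseVar {L : ℕ} (h : Fin L → ℝ) (N₀ : ℝ) (a : ℤ → ℝ) : ℝ :=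
  N₀ * (∑' l : ℤ, a l ^ 2) / inputCoeff h a 0 ^ 2

/-- Variance of the total disturbance `∑_{k ≥ 1} α_k x_k + m`, for i.i.d. zero-mean inputs of
power `P`. -/
noncomputable def disturbanceVar {L : ℕ} (h : Fin L → ℝ) (P N₀ : ℝ) (a : ℤ → ℝ) : ℝ :=
  P * (∑' k : ℕ, residualCoeff h a (k + 1) ^ 2) + filteredNoiseVar h N₀ a

/-- Filters for which the normalized output makes sense. -/
def AdmissibleFilter {L : ℕ} (h : Fin L → ℝ) (a : ℤ → ℝ) : Prop :=
  (Summable fun l : ℤ => a l ^ 2) ∧ inputCoeff h a 0 ≠ 0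

/-- `a` is an MMSE-DFE front-end filter (mean-squared whitened matched filter): it minimizes the
variance of the disturbance among all admissible filters. -/
def IsMMSEFilter {L : ℕ} (h : Fin L → ℝ) (P N₀ : ℝ) (a : ℤ → ℝ) : Prop :=
  AdmissibleFilter h a ∧
    ∀ b : ℤ → ℝ, AdmissibleFilter h b → disturbanceVar h P N₀ a ≤ disturbanceVar h P N₀ b

/-! ### The two information expressions -/

/-- The random series `∑_{k ≥ 1} α_k x_k`, as the limit of its partial sums. -/
noncomputable def interference (α : ℕ → ℝ) (x : ℕ → ℝ) : ℝ :=
  limUnder atTop fun n : ℕ => ∑ k ∈ Finset.range n, α (k + 1) * x (k + 1)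

/-- The law of `((x_k)_{k ≥ 0}, m)` with `x_k` i.i.d. of law `ν` and `m ∼ 𝒩(0, v)` independent of
them. -/
noncomputable def inputNoiseLaw (ν : Measure ℝ) (v : ℝ) : Measure ((ℕ → ℝ) × ℝ) :=
  (Measure.infinitePi fun _ : ℕ => ν).prod (gaussianReal 0 v.toNNReal)

/-- `I(x₀ ; x₀ + ∑_{k ≥ 1} α_k x_k + m)` for the coefficients `α_k` and the noise `m` that the
filter `a` produces.  For an MMSE-DFE filter this is `I_MMSE`. -/
noncomputable def infoMMSE {L : ℕ} (ν : Measure ℝ) (h : Fin L → ℝ) (N₀ : ℝ) (a : ℤ → ℝ) :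
    ℝ≥0∞ :=
  mutualInfo (inputNoiseLaw ν (filteredNoiseVar h N₀ a)) (fun ω => ω.1 0)
    (fun ω => ω.1 0 + interference (residualCoeff h a) ω.1 + ω.2)

/-- The output SNR `E x₀² / E (∑_{k ≥ 1} α_k x_k + m)²` of the unbiased decision feedback equalizer
with front-end filter `a`. -/
noncomputable def snrDFEU {L : ℕ} (ν : Measure ℝ) (h : Fin L → ℝ) (N₀ : ℝ) (a : ℤ → ℝ) : ℝ :=
  inputPower ν / disturbanceVar h (inputPower ν) N₀ a

/-- The Shamai-Laroia expression `I_SL = I_x(SNR_DFE-U)`. -/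
noncomputable def infoSL {L : ℕ} (ν : Measure ℝ) (h : Fin L → ℝ) (N₀ : ℝ) (a : ℤ → ℝ) : ℝ≥0∞ :=
  scalarInfo ν N₀ (snrDFEU ν h N₀ a)

/-- The law of `c x`, where `x` has law `ν`. -/
noncomputable def scaledLaw (ν : Measure ℝ) (c : ℝ) : Measure ℝ := ν.map fun x => c * x

/-- `I_MMSE < I_SL` whenever `P_x / N₀` is sufficiently small: there is a threshold, depending only
on the channel and on the shape `ν` of the input law, below which the inequality holds for every
scaling of the input and every noise level.  The MMSE-DFE filter is unique up to a scalar factor,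
which affects neither side; its existence is part of the claim. -/
def InfoMMSEltSLAtLowSNR {L : ℕ} (ν : Measure ℝ) (h : Fin L → ℝ) : Prop :=
  ∃ ε : ℝ, 0 < ε ∧ ∀ c N₀ : ℝ, 0 < c → 0 < N₀ → inputPower (scaledLaw ν c) / N₀ < ε →
    (∃ a : ℤ → ℝ, IsMMSEFilter h (inputPower (scaledLaw ν c)) N₀ a) ∧
    ∀ a : ℤ → ℝ, IsMMSEFilter h (inputPower (scaledLaw ν c)) N₀ a →
      infoMMSE (scaledLaw ν c) h N₀ a < infoSL (scaledLaw ν c) h N₀ a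

/-! Write `D(μ)` for `nonGaussianness μ`, the relative entropy of `μ ∗ 𝒩(0, 1)` to the Gaussian with
the same second moment. For a channel `X + U + m` with independent interference `U` and Gaussian
noise `m`, normalized to unit noise variance, the mutual information is `½ log (1 + SNR) - (D(X + U)
- D(U))`. The two expressions being compared have the same SNR, so their logarithms cancel. The
inequality to be proved becomes `D(x₀ + W) - D(W) > D(x₀)`, with `W = ∑ α_k x_k`, where the right
side is taken at a slightly smaller scale because all of the disturbance is counted there as noise.

At small scale `c`, if the input moments below order `j` are Gaussian, then `D(c μ) ≈ (a / 2) c^(2j)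
gap²`. Here `a > 0` depends only on `j`, and `gap` is the excess of the `j`-th moment over the
Gaussian one. Like a cumulant, the gap is additive over independent sums and homogeneous of degree
`j`. If `κ` is the gap of `x₀` and `A = ∑ α_k^j`, then the gaps of `W` and `x₀ + W` are `κ A` and `κ
(1 + A)`. Since `(1 + A)² - A² = 1 + 2 A`, the interference makes the loss strictly larger than that
of the input alone as soon as `A > 0`.

As the SNR tends to zero the MMSE filter tends to the matched filter, so `A` tends to a power sum of
the normalized autocorrelation of the channel. For `s_x = 0` and `κ_x ≠ 0` one takes `j = 4`; an
even power sum is positive once some lag is nonzero. For `s_x ≠ 0` one takes `j = 3`; with two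
positive taps the only lag is positive. The filter moves with the SNR, so the expansion of `D` must
be uniform. Geometric decay of the filters provides a single summable majorant of `α`, and then a
single random variable dominating all the interference series.

The argument rests on `exists_abs_nonGaussianness_sub_gap_le` (the expansion), `MatchesGauss.conv`
(additivity), `eventually_abs_nonGaussianness_map_mul_sub_le` (uniformity), `mutualInfo_self_add_eq`
(the information formula) and `exists_residualCoeff_bounds` (the filters). -/

/-! ### Elementary inequalities -/

/-- With `t = log u ≥ 0` this is `t ≤ sinh t`. -/
theorem two_mul_log_le_sub_inv {u : ℝ} (hu : 1 ≤ u) : 2 * Real.log u ≤ u - u⁻¹ := by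
  have h := Real.self_le_sinh_iff.2 (Real.log_nonneg hu)
  rw [Real.sinh_log (by linarith)] at h
  linarith

/-- Second-order expansion of `u log u` at `u = 1`. -/
theorem abs_mul_log_one_add_sub_le {w : ℝ} (hw : -1 < w) :
    |(1 + w) * Real.log (1 + w) - w - w ^ 2 / 2| ≤ |w| ^ 3 := by
  have hu : 0 < 1 + w := by linarith
  rcases le_total 0 w with h | h
  · have h1 := two_mul_log_le_sub_inv (u := 1 + w) (by linarith)
    have h2 := Real.le_log_one_add_of_nonneg h
    have h1' : (1 + w) * Real.log (1 + w) ≤ w + w ^ 2 / 2 := by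
      have := mul_le_mul_of_nonneg_left h1 hu.le
      have e : (1 + w) * (1 + w - (1 + w)⁻¹) = 2 * (w + w ^ 2 / 2) := by field_simp; ring
      linarith
    have h2' : w + w ^ 2 / 2 - w ^ 3 ≤ (1 + w) * Real.log (1 + w) := by
      refine le_trans ?_ (mul_le_mul_of_nonneg_left h2 hu.le)
      rw [← mul_div_assoc, le_div_iff₀ (by linarith)]
      nlinarith [pow_nonneg h 3, pow_nonneg h 4]
    rw [abs_of_nonneg h, abs_le]
    constructor <;> nlinarith [pow_nonneg h 3]
  -- The same two logarithm bounds are applied at `(1 + w)⁻¹ ≥ 1`; the inversion exchanges their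
  -- roles as upper and lower bound.
  · have hinv : 1 ≤ (1 + w)⁻¹ := (one_le_inv₀ hu).2 (by linarith)
    have h1 := two_mul_log_le_sub_inv hinv
    rw [Real.log_inv, inv_inv] at h1
    have h2 := Real.le_log_one_add_of_nonneg (x := (1 + w)⁻¹ - 1) (by linarith)
    rw [add_sub_cancel, Real.log_inv] at h2
    have h1' : w + w ^ 2 / 2 ≤ (1 + w) * Real.log (1 + w) := by
      have := mul_le_mul_of_nonneg_left h1 hu.le
      have e : (1 + w) * ((1 + w)⁻¹ - (1 + w)) = -2 * (w + w ^ 2 / 2) := by field_simp; ring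
      linarith
    have h2' : (1 + w) * Real.log (1 + w) ≤ w + w ^ 2 / 2 - w ^ 3 := by
      have e : 2 * ((1 + w)⁻¹ - 1) / ((1 + w)⁻¹ - 1 + 2) = - (2 * w / (2 + w)) := by
        have : (2 + w) ≠ 0 := by linarith
        have h3 : (1 + w)⁻¹ - 1 + 2 = (2 + w) / (1 + w) := by field_simp; ring
        rw [h3]; field_simp; ring
      rw [e] at h2
      have h4 : Real.log (1 + w) ≤ 2 * w / (2 + w) := by linarith
      refine le_trans (mul_le_mul_of_nonneg_left h4 hu.le) ?_
      rw [← mul_div_assoc, div_le_iff₀ (by linarith)]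
      nlinarith [mul_nonneg (sq_nonneg w) (neg_nonneg.2 h), mul_nonneg (mul_nonneg (sq_nonneg w) (neg_nonneg.2 h)) hu.le]
    rw [abs_of_nonpos h, abs_le]
    have : (-w) ^ 3 = - w ^ 3 := by ring
    have h5 : 0 ≤ (-w) ^ 3 := pow_nonneg (by linarith) 3
    constructor <;> linarith

/-- Used to absorb Hermite polynomials into an arbitrarily small loss in the Gaussian exponent. -/
theorem exists_abs_aeval_le_exp (p : Polynomial ℤ) {δ : ℝ} (hδ : 0 < δ) :
    ∃ C : ℝ, 0 < C ∧ ∀ x : ℝ, |Polynomial.aeval x p| ≤ C * Real.exp (δ * x ^ 2) := by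
  induction p using Polynomial.induction_on' with
  | add p q hp hq =>
    obtain ⟨C, hC, h⟩ := hp
    obtain ⟨C', hC', h'⟩ := hq
    refine ⟨C + C', by positivity, fun x => ?_⟩
    rw [map_add, add_mul]
    exact (abs_add_le _ _).trans (add_le_add (h x) (h' x))
  | monomial n a =>
    refine ⟨(|(a : ℝ)| + 1) * (1 + n.factorial / δ ^ n), by positivity, fun x => ?_⟩
    have h1 : |x| ^ n ≤ 1 + (x ^ 2) ^ n := by
      rw [← sq_abs x]
      rcases le_total |x| 1 with h | h
      · exact (pow_le_one₀ (abs_nonneg _) h).trans (by linarith [pow_nonneg (sq_nonneg |x|) n])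
      · have : |x| ^ n ≤ (|x| ^ 2) ^ n := pow_le_pow_left₀ (abs_nonneg _) (by nlinarith) n
        linarith
    have h2 := Real.pow_div_factorial_le_exp (δ * x ^ 2) (by positivity) n
    have h3 : (x ^ 2) ^ n ≤ n.factorial / δ ^ n * Real.exp (δ * x ^ 2) := by
      rw [mul_pow] at h2
      rw [div_mul_eq_mul_div, le_div_iff₀ (by positivity)]
      rw [div_le_iff₀ (by positivity)] at h2
      linarith
    have h4 : (1 : ℝ) ≤ Real.exp (δ * x ^ 2) := Real.one_le_exp (by positivity)
    have h5 : |x| ^ n ≤ (1 + n.factorial / δ ^ n) * Real.exp (δ * x ^ 2) := by linarith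
    rw [Polynomial.aeval_monomial, abs_mul, abs_pow, mul_assoc]
    refine mul_le_mul ?_ h5 (by positivity) (by positivity)
    simp

/-! ### The standard Gaussian density and its Taylor expansion -/

/-- The density of `𝒩(0, 1)`. -/
noncomputable def stdPdf (x : ℝ) : ℝ := (√(2 * Real.pi))⁻¹ * Real.exp (-(x ^ 2 / 2))

theorem gaussianPDFReal_zero_one : gaussianPDFReal 0 1 = stdPdf := by
  ext x
  simp [gaussianPDFReal, stdPdf, neg_div]

theorem stdPdf_pos (x : ℝ) : 0 < stdPdf x := by unfold stdPdf; positivity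

theorem stdPdf_le_one (x : ℝ) : stdPdf x ≤ 1 := by
  unfold stdPdf
  refine mul_le_one₀ (inv_le_one_of_one_le₀ (Real.one_le_sqrt.2 ?_)) (by positivity)
    (Real.exp_le_one_iff.2 (by linarith [sq_nonneg x]))
  linarith [Real.pi_gt_three]

theorem contDiff_stdPdf {n : WithTop ℕ∞} : ContDiff ℝ n stdPdf := by unfold stdPdf; fun_prop

@[fun_prop]
theorem continuous_stdPdf : Continuous stdPdf := contDiff_stdPdf (n := 0).continuous

@[fun_prop]
theorem measurable_stdPdf : Measurable stdPdf := continuous_stdPdf.measurable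

theorem iteratedDeriv_stdPdf (n : ℕ) (x : ℝ) :
    iteratedDeriv n stdPdf x = (√(2 * Real.pi))⁻¹ *
      ((-1) ^ n * Polynomial.aeval x (Polynomial.hermite n) * Real.exp (-(x ^ 2 / 2))) := by
  rw [← Polynomial.deriv_gaussian_eq_hermite_mul_gaussian, ← iteratedDeriv_eq_iterate]
  unfold stdPdf
  rw [iteratedDeriv_const_mul_field]

theorem exists_abs_iteratedDeriv_stdPdf_le (n : ℕ) {δ : ℝ} (hδ : 0 < δ) :
    ∃ C : ℝ, 0 < C ∧ ∀ x : ℝ,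
      |iteratedDeriv n stdPdf x| ≤ C * Real.exp (-(1 / 2 - δ) * x ^ 2) := by
  obtain ⟨C, hC, h⟩ := exists_abs_aeval_le_exp (Polynomial.hermite n) hδ
  refine ⟨(√(2 * Real.pi))⁻¹ * C, by positivity, fun x => ?_⟩
  rw [iteratedDeriv_stdPdf, abs_mul, abs_mul, abs_mul, abs_pow, abs_neg, abs_one, one_pow, one_mul, Real.abs_exp,
    abs_of_pos (by positivity), mul_assoc]
  refine mul_le_mul_of_nonneg_left ?_ (by positivity)
  refine (mul_le_mul_of_nonneg_right (h x) (by positivity)).trans (le_of_eq ?_)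
  rw [mul_assoc, ← Real.exp_add]
  congr 2; ring

/-- Lagrange remainder, with the derivative at the intermediate point compared to a Gaussian at `y`
at the price of a factor `exp (12 z²)`. The rate `11/24` is below `1/2` but well above `1/3`, which
is what cubes divided by the square of a Gaussian density will require. -/
theorem exists_abs_stdPdf_sub_taylor_le (n : ℕ) :
    ∃ C : ℝ, 0 < C ∧ ∀ y z : ℝ,
      |stdPdf (y - z) - ∑ i ∈ Finset.range (n + 1),
          iteratedDeriv i stdPdf y / i.factorial * (-z) ^ i| ≤
        C * (|z| ^ (n + 1) * Real.exp (12 * z ^ 2)) * Real.exp (-(11 / 24) * y ^ 2) := by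
  -- The loss `1/2 - 11/24 = 1/24` is shared equally: `1/48` for the Hermite factor and `1/48` for
  -- moving from `ξ` to `y`.
  obtain ⟨C, hC, h⟩ := exists_abs_iteratedDeriv_stdPdf_le (n + 1) (δ := 1 / 48) (by norm_num)
  refine ⟨C, hC, fun y z => ?_⟩
  rcases eq_or_ne z 0 with rfl | hz
  · simp [Finset.sum_range_succ']
  have hne : y ≠ y - z := by intro h'; apply hz; linarith
  obtain ⟨ξ, hξ, e⟩ := taylor_mean_remainder_lagrange_iteratedDeriv (n := n) hne
    (contDiff_stdPdf (n := (n : WithTop ℕ∞) + 1)).contDiffOn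
  have e2 : taylorWithinEval stdPdf n (Set.uIcc y (y - z)) y (y - z) =
      ∑ i ∈ Finset.range (n + 1), iteratedDeriv i stdPdf y / i.factorial * (-z) ^ i := by
    rw [taylor_within_apply]
    refine Finset.sum_congr rfl fun i _ => ?_
    rw [iteratedDerivWithin_eq_iteratedDeriv (uniqueDiffOn_uIcc hne)
      (contDiff_stdPdf).contDiffAt Set.left_mem_uIcc, smul_eq_mul]
    have : y - z - y = -z := by ring
    rw [this]; field_simp
  rw [e2] at e
  rw [e, sub_sub_cancel_left, abs_div, abs_mul, abs_pow, abs_neg, Nat.abs_cast]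
  have hf : (1 : ℝ) ≤ (n + 1).factorial := by exact_mod_cast Nat.one_le_iff_ne_zero.2 (Nat.factorial_ne_zero _)
  refine (div_le_self (by positivity) hf).trans ?_
  have hs : |ξ - y| ≤ |z| := by
    have := Set.abs_sub_left_of_mem_uIcc ((Set.Ioo_subset_Icc_self hξ))
    simpa using this
  have hexp : Real.exp (-(1 / 2 - 1 / 48) * ξ ^ 2) ≤
      Real.exp (12 * z ^ 2) * Real.exp (-(11 / 24) * y ^ 2) := by
    rw [← Real.exp_add, Real.exp_le_exp]
    have h1 : ξ ^ 2 ≥ y ^ 2 - 2 * (|y| * |z|) := by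
      have h2 : -(|y| * |z|) ≤ y * (ξ - y) := by
        have := neg_abs_le (y * (ξ - y))
        rw [abs_mul] at this
        nlinarith [abs_nonneg y]
      nlinarith [sq_nonneg (ξ - y)]
    have h3 : |y| * |z| ≤ 1 / 48 * y ^ 2 + 12 * z ^ 2 := by
      rw [← sq_abs y, ← sq_abs z]
      nlinarith [sq_nonneg (|y| - 24 * |z|)]
    nlinarith [mul_nonneg (abs_nonneg y) (abs_nonneg z)]
  calc |iteratedDeriv (n + 1) stdPdf ξ| * |z| ^ (n + 1)
      ≤ (C * (Real.exp (12 * z ^ 2) * Real.exp (-(11 / 24) * y ^ 2))) * |z| ^ (n + 1) := by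
        gcongr
        exact (h ξ).trans (by gcongr)
    _ = _ := by ring

/-! ### Densities smoothed by standard Gaussian noise -/

/-- The density of `μ ∗ 𝒩(0, 1)`. -/
noncomputable def dens (μ : Measure ℝ) (y : ℝ) : ℝ := ∫ z, stdPdf (y - z) ∂μ

theorem integrable_stdPdf_sub (μ : Measure ℝ) [IsFiniteMeasure μ] (y : ℝ) :
    Integrable (fun z => stdPdf (y - z)) μ :=
  Integrable.of_bound (continuous_stdPdf.comp (continuous_const.sub continuous_id)).aestronglyMeasurable 1
    (ae_of_all _ fun z => by
      rw [Real.norm_eq_abs, abs_of_pos (stdPdf_pos _)]; exact stdPdf_le_one _)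

theorem dens_nonneg (μ : Measure ℝ) (y : ℝ) : 0 ≤ dens μ y :=
  integral_nonneg fun _ => (stdPdf_pos _).le

@[fun_prop]
theorem continuous_dens (μ : Measure ℝ) [IsFiniteMeasure μ] : Continuous (dens μ) := by
  refine continuous_of_dominated (bound := fun _ => 1) (fun y => ?_) (fun y => ?_)
    (integrable_const _) ?_
  · exact (integrable_stdPdf_sub μ y).aestronglyMeasurable
  · refine ae_of_all _ fun z => ?_
    rw [Real.norm_eq_abs, abs_of_pos (stdPdf_pos _)]; exact stdPdf_le_one _
  · exact ae_of_all _ fun z => continuous_stdPdf.comp (continuous_id.sub continuous_const)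

@[fun_prop]
theorem measurable_dens (μ : Measure ℝ) [IsFiniteMeasure μ] : Measurable (dens μ) :=
  (continuous_dens μ).measurable

theorem dens_le_one (μ : Measure ℝ) [IsProbabilityMeasure μ] (y : ℝ) : dens μ y ≤ 1 := by
  have := integral_mono (integrable_stdPdf_sub μ y) (integrable_const (1 : ℝ))
    (fun z => stdPdf_le_one (y - z))
  simpa [dens] using this

theorem dens_restrict_add_dens_restrict_compl (μ : Measure ℝ) [IsFiniteMeasure μ] {A : Set ℝ}
    (hA : MeasurableSet A) (y : ℝ) :
    dens (μ.restrict A) y + dens (μ.restrict Aᶜ) y = dens μ y :=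
  integral_add_compl hA (integrable_stdPdf_sub μ y)

theorem gaussianReal_zero_one :
    gaussianReal 0 1 = volume.withDensity fun x => ENNReal.ofReal (stdPdf x) := by
  rw [gaussianReal_of_var_ne_zero 0 one_ne_zero]
  simp [gaussianPDF_def, gaussianPDFReal_zero_one]


theorem conv_std (μ : Measure ℝ) [IsFiniteMeasure μ] :
    μ.conv (gaussianReal 0 1) = volume.withDensity fun y => ENNReal.ofReal (dens μ y) := by
  ext s hs
  rw [← lintegral_indicator_one hs, Measure.lintegral_conv (measurable_one.indicator hs),
    withDensity_apply _ hs, ← lintegral_indicator hs]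
  have h1 : ∀ z : ℝ, ∫⁻ n, s.indicator 1 (z + n) ∂(gaussianReal 0 1) =
      ∫⁻ y, s.indicator 1 y * ENNReal.ofReal (stdPdf (y - z)) := by
    intro z
    rw [gaussianReal_zero_one, lintegral_withDensity_eq_lintegral_mul _
      continuous_stdPdf.measurable.ennreal_ofReal (by fun_prop (disch := exact hs))]
    rw [← lintegral_add_left_eq_self
      (fun y => s.indicator 1 y * ENNReal.ofReal (stdPdf (y - z))) z]
    refine lintegral_congr fun n => ?_
    simp [mul_comm]
  simp_rw [h1]
  rw [lintegral_lintegral_swap]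
  · refine lintegral_congr fun y => ?_
    rw [lintegral_const_mul _ (by fun_prop)]
    by_cases hy : y ∈ s
    · simp only [Set.indicator_of_mem hy, Pi.one_apply, one_mul]
      rw [dens, ofReal_integral_eq_lintegral_ofReal (integrable_stdPdf_sub μ y)
        (ae_of_all _ fun _ => (stdPdf_pos _).le)]
    · simp [hy]
  · refine Measurable.aemeasurable ?_
    exact ((measurable_one.indicator hs).comp measurable_snd).mul (by fun_prop)

theorem integrable_mul_dens {μ : Measure ℝ} [IsFiniteMeasure μ] {F : ℝ → ℝ}
    (h : Integrable F (μ.conv (gaussianReal 0 1))) : Integrable fun y => dens μ y * F y := by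
  have hm : Measurable fun y => ENNReal.ofReal (dens μ y) :=
    (continuous_dens μ).measurable.ennreal_ofReal
  rw [conv_std, integrable_withDensity_iff_integrable_smul' hm
    (ae_of_all _ fun _ => ENNReal.ofReal_lt_top)] at h
  refine h.congr (ae_of_all _ fun y => ?_)
  simp only [ENNReal.toReal_ofReal (dens_nonneg μ _), smul_eq_mul]

theorem integral_mul_dens (μ : Measure ℝ) [IsFiniteMeasure μ] (F : ℝ → ℝ) :
    ∫ y, dens μ y * F y = ∫ y, F y ∂(μ.conv (gaussianReal 0 1)) := by
  have hm : Measurable fun y => ENNReal.ofReal (dens μ y) :=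
    (continuous_dens μ).measurable.ennreal_ofReal
  rw [conv_std, integral_withDensity_eq_integral_toReal_smul hm
    (ae_of_all _ fun _ => ENNReal.ofReal_lt_top)]
  refine integral_congr_ae (ae_of_all _ fun y => ?_)
  simp only [ENNReal.toReal_ofReal (dens_nonneg μ _), smul_eq_mul]

theorem integrable_dens (μ : Measure ℝ) [IsFiniteMeasure μ] : Integrable (dens μ) := by
  simpa using integrable_mul_dens (μ := μ) (F := fun _ => 1) (integrable_const _)

theorem integral_dens (μ : Measure ℝ) [IsFiniteMeasure μ] : ∫ y, dens μ y = μ.real Set.univ := by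
  have := integral_mul_dens μ (fun _ => 1)
  simp only [mul_one] at this
  rw [this, integral_const, smul_eq_mul, mul_one, Measure.real, Measure.conv,
    Measure.map_apply (by fun_prop) MeasurableSet.univ,
    Set.preimage_univ, ← Set.univ_prod_univ, Measure.prod_prod]
  simp [Measure.real]

/-! ### Second moments under Gaussian smoothing. -/

theorem integral_gaussianReal_sq (v : NNReal) : ∫ x, x ^ 2 ∂(gaussianReal 0 v) = v := by
  have := variance_fun_id_gaussianReal (μ := 0) (v := v)
  rwa [variance_of_integral_eq_zero (by fun_prop) (by simp)] at this

theorem integrable_gaussianReal_pow (v : NNReal) (n : ℕ) :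
    Integrable (fun x : ℝ => x ^ n) (gaussianReal 0 v) := by
  have := (memLp_id_gaussianReal' (μ := 0) (v := v) n (by simp)).integrable_norm_pow'
  exact this.mono (by fun_prop) (ae_of_all _ fun x => by simp)

theorem integrable_sq_conv {μ : Measure ℝ} [IsFiniteMeasure μ] (h : Integrable (fun z => z ^ 2) μ) :
    Integrable (fun y => y ^ 2) (μ.conv (gaussianReal 0 1)) := by
  rw [Measure.conv, integrable_map_measure (by fun_prop) (by fun_prop)]
  have h1 : Integrable (fun p : ℝ × ℝ => 2 * (p.1 ^ 2 + p.2 ^ 2)) (μ.prod (gaussianReal 0 1)) :=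
    ((h.comp_fst _).add ((integrable_gaussianReal_pow 1 2).comp_snd _)).const_mul 2
  refine h1.mono (by fun_prop) (ae_of_all _ fun p => ?_)
  simp only [Function.comp, Real.norm_eq_abs]
  rw [abs_of_nonneg (by positivity), abs_of_nonneg (by positivity)]
  nlinarith [sq_nonneg (p.1 - p.2)]

theorem integral_sq_conv {μ : Measure ℝ} [IsFiniteMeasure μ] (h : Integrable (fun z => z ^ 2) μ) :
    ∫ y, y ^ 2 ∂(μ.conv (gaussianReal 0 1)) = ∫ z, z ^ 2 ∂μ + μ.real Set.univ := by
  have h0 : Integrable (fun z : ℝ => z) μ := by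
    have : MemLp (fun z : ℝ => z) 2 μ := (memLp_two_iff_integrable_sq (by fun_prop)).2 h
    exact this.integrable (by norm_num)
  have hg : Integrable (fun z : ℝ => z) (gaussianReal 0 1) := by
    simpa using integrable_gaussianReal_pow 1 1
  rw [Measure.conv, integral_map (by fun_prop) (by fun_prop)]
  have e : ∀ p : ℝ × ℝ, (p.1 + p.2) ^ 2 = p.1 ^ 2 + 2 * (p.1 * p.2) + p.2 ^ 2 := fun p => by ring
  simp_rw [e]
  rw [integral_add, integral_add, integral_const_mul, integral_prod_mul (fun x : ℝ => x) (fun x : ℝ => x),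
    integral_fun_fst (f := fun x : ℝ => x ^ 2),
    integral_fun_snd (f := fun x : ℝ => x ^ 2), integral_gaussianReal_sq]
  · simp
  · exact h.comp_fst _
  · exact (h0.mul_prod hg).const_mul 2
  · exact (h.comp_fst _).add ((h0.mul_prod hg).const_mul 2)
  · exact (integrable_gaussianReal_pow 1 2).comp_snd _

theorem integrable_sq_mul_dens {μ : Measure ℝ} [IsFiniteMeasure μ]
    (h : Integrable (fun z => z ^ 2) μ) : Integrable fun y => dens μ y * y ^ 2 :=
  integrable_mul_dens (integrable_sq_conv h)

theorem integral_sq_mul_dens {μ : Measure ℝ} [IsFiniteMeasure μ]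
    (h : Integrable (fun z => z ^ 2) μ) :
    ∫ y, dens μ y * y ^ 2 = ∫ z, z ^ 2 ∂μ + μ.real Set.univ := by
  rw [integral_mul_dens, integral_sq_conv h]

/-- The density of `𝒩(0, s)`. -/
noncomputable def varPdf (s y : ℝ) : ℝ := (√(2 * Real.pi * s))⁻¹ * Real.exp (-(y ^ 2 / (2 * s)))

theorem varPdf_pos {s : ℝ} (hs : 0 < s) (y : ℝ) : 0 < varPdf s y := by
  unfold varPdf; have := Real.pi_pos; positivity

@[fun_prop]
theorem continuous_varPdf (s : ℝ) : Continuous (varPdf s) := by unfold varPdf; fun_prop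

/-- No integral is computed: both sides are continuous densities of `𝒩(0, v) ∗ 𝒩(0, 1) = 𝒩(0, 1 +
v)`, so they agree almost everywhere and hence everywhere. The degenerate case `v = 0` is included.
-/
theorem dens_gaussianReal {v : ℝ} (hv : 0 ≤ v) : dens (gaussianReal 0 v.toNNReal) = varPdf (1 + v) := by
  have e : gaussianPDFReal 0 (v.toNNReal + 1) = varPdf (1 + v) := by
    ext y
    simp [gaussianPDFReal, varPdf, hv, neg_div, add_comm]
  refine (Continuous.ae_eq_iff_eq volume (continuous_dens _) (continuous_varPdf _)).1 ?_
  have h1 := conv_std (gaussianReal 0 v.toNNReal)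
  rw [gaussianReal_conv_gaussianReal, gaussianReal_of_var_ne_zero _ (by positivity), add_zero] at h1
  have h2 := (withDensity_eq_iff (by fun_prop)
    ((continuous_dens _).measurable.ennreal_ofReal.aemeasurable) (by
      rw [lintegral_gaussianPDF_eq_one _ (by positivity)]; simp)).1 h1
  filter_upwards [h2] with y hy
  rw [gaussianPDF_def, e] at hy
  have := congrArg ENNReal.toReal hy
  rw [ENNReal.toReal_ofReal (varPdf_pos (by linarith) _).le, ENNReal.toReal_ofReal (dens_nonneg _ _)] at this
  exact this.symm

/-! ### Moments matching those of a Gaussian -/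

/-- The `i`-th moment of `𝒩(0, v)`. -/
noncomputable def gaussMoment (v : ℝ) (i : ℕ) : ℝ := ∫ z, z ^ i ∂(gaussianReal 0 v.toNNReal)

/-- The moments of `μ` of order less than `j` are those of the centred Gaussian with the same
second moment. -/
def MatchesGauss (j : ℕ) (μ : Measure ℝ) : Prop :=
  ∀ i < j, ∫ z, z ^ i ∂μ = gaussMoment (∫ z, z ^ 2 ∂μ) i

/-- The difference between the `j`-th moment of `μ` and that of the centred Gaussian with the same
second moment. -/
noncomputable def gaussGap (j : ℕ) (μ : Measure ℝ) : ℝ :=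
  ∫ z, z ^ j ∂μ - gaussMoment (∫ z, z ^ 2 ∂μ) j

theorem gaussianReal_toNNReal_eq_map {v : ℝ} (hv : 0 ≤ v) :
    gaussianReal 0 v.toNNReal = (gaussianReal 0 1).map (fun x => √v * x) := by
  rw [gaussianReal_map_const_mul]
  congr 1
  · simp
  · ext; simp [hv]

theorem gaussMoment_eq {v : ℝ} (hv : 0 ≤ v) (i : ℕ) :
    gaussMoment v i = √v ^ i * gaussMoment 1 i := by
  unfold gaussMoment
  rw [gaussianReal_toNNReal_eq_map hv, integral_map (by fun_prop) (by fun_prop)]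
  simp_rw [mul_pow]
  rw [integral_const_mul, Real.toNNReal_one]

theorem integrable_abs_pow_mul_exp_gaussianReal (n : ℕ) :
    Integrable (fun x : ℝ => |x| ^ n * Real.exp (x ^ 2 / 4)) (gaussianReal 0 1) := by
  obtain ⟨C, hC, h⟩ := exists_abs_aeval_le_exp (Polynomial.X ^ n) (δ := 1 / 8) (by norm_num)
  rw [gaussianReal_zero_one, integrable_withDensity_iff_integrable_smul' (by fun_prop)
    (ae_of_all _ fun _ => ENNReal.ofReal_lt_top)]
  refine ((integrable_exp_neg_mul_sq (b := 1 / 8) (by norm_num)).const_mul C).mono'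
    (by fun_prop) (ae_of_all _ fun x => ?_)
  have hx := h x
  rw [map_pow, Polynomial.aeval_X, abs_pow] at hx
  rw [ENNReal.toReal_ofReal (stdPdf_pos x).le, smul_eq_mul, Real.norm_eq_abs,
    abs_of_nonneg (mul_nonneg (stdPdf_pos x).le (by positivity))]
  have h1 : stdPdf x ≤ Real.exp (-(x ^ 2 / 2)) := by
    unfold stdPdf
    refine mul_le_of_le_one_left (by positivity) (inv_le_one_of_one_le₀ (Real.one_le_sqrt.2 ?_))
    linarith [Real.pi_gt_three]
  calc stdPdf x * (|x| ^ n * Real.exp (x ^ 2 / 4))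
      ≤ Real.exp (-(x ^ 2 / 2)) * (C * Real.exp (1 / 8 * x ^ 2) * Real.exp (x ^ 2 / 4)) := by gcongr
    _ = C * (Real.exp (-(x ^ 2 / 2)) * (Real.exp (1 / 8 * x ^ 2) * Real.exp (x ^ 2 / 4))) := by ring
    _ = C * Real.exp (-(1 / 8) * x ^ 2) := by
      rw [← Real.exp_add, ← Real.exp_add]; congr 2; ring

/-- Rescale to variance one: `v ≤ 1/48` turns `exp (12 v x²)` into at most `exp (x² / 4)`, which
`𝒩(0, 1)` integrates. This is the origin of the bound `1/48` on second moments below. -/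
theorem exists_integral_abs_pow_mul_exp_gaussianReal_le (n : ℕ) :
    ∃ C : ℝ, 0 < C ∧ ∀ v : ℝ, 0 ≤ v → v ≤ 1 / 48 →
      Integrable (fun x : ℝ => |x| ^ n * Real.exp (12 * x ^ 2)) (gaussianReal 0 v.toNNReal) ∧
      ∫ x, |x| ^ n * Real.exp (12 * x ^ 2) ∂(gaussianReal 0 v.toNNReal) ≤ C * √v ^ n := by
  refine ⟨∫ x, |x| ^ n * Real.exp (x ^ 2 / 4) ∂(gaussianReal 0 1) + 1, ?_, fun v hv hv' => ?_⟩
  · have : 0 ≤ ∫ x, |x| ^ n * Real.exp (x ^ 2 / 4) ∂(gaussianReal 0 1) :=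
      integral_nonneg fun x => by positivity
    linarith
  · have hI := integrable_abs_pow_mul_exp_gaussianReal n
    have hb : ∀ x : ℝ, |√v * x| ^ n * Real.exp (12 * (√v * x) ^ 2) ≤
        √v ^ n * (|x| ^ n * Real.exp (x ^ 2 / 4)) := by
      intro x
      rw [abs_mul, mul_pow, mul_pow, Real.sq_sqrt hv, abs_of_nonneg (Real.sqrt_nonneg v), mul_assoc]
      gcongr
      nlinarith [sq_nonneg x]
    have hI' : Integrable (fun x => |√v * x| ^ n * Real.exp (12 * (√v * x) ^ 2))
        (gaussianReal 0 1) :=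
      (hI.const_mul (√v ^ n)).mono' (by fun_prop) (ae_of_all _ fun x => by
        rw [Real.norm_eq_abs, abs_of_nonneg (by positivity)]; exact hb x)
    rw [gaussianReal_toNNReal_eq_map hv]
    refine ⟨(integrable_map_measure (by fun_prop) (by fun_prop)).2 hI', ?_⟩
    rw [integral_map (by fun_prop) (by fun_prop)]
    refine (integral_mono hI' (hI.const_mul _) hb).trans ?_
    rw [integral_const_mul, mul_comm]
    gcongr
    linarith

/-- The Taylor bound integrated over the shift. It needs a Gaussian exponential moment, which the
input law may lack; it is applied only to the law truncated to `[-1, 1]` and to Gaussians of small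
variance. -/
theorem exists_abs_dens_sub_taylor_le (n : ℕ) :
    ∃ C : ℝ, 0 < C ∧ ∀ ρ : Measure ℝ, IsFiniteMeasure ρ →
      (∀ i ≤ n, Integrable (fun z : ℝ => z ^ i) ρ) →
      Integrable (fun z : ℝ => |z| ^ (n + 1) * Real.exp (12 * z ^ 2)) ρ → ∀ y : ℝ,
      |dens ρ y - ∑ i ∈ Finset.range (n + 1),
        iteratedDeriv i stdPdf y / i.factorial * (-1) ^ i * ∫ z, z ^ i ∂ρ| ≤
        C * (∫ z, |z| ^ (n + 1) * Real.exp (12 * z ^ 2) ∂ρ) * Real.exp (-(11 / 24) * y ^ 2) := by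
  obtain ⟨C, hC, h⟩ := exists_abs_stdPdf_sub_taylor_le n
  refine ⟨C, hC, fun ρ _ hρ hI y => ?_⟩
  have hsum : ∀ z : ℝ, ∑ i ∈ Finset.range (n + 1),
        iteratedDeriv i stdPdf y / i.factorial * (-z) ^ i = ∑ i ∈ Finset.range (n + 1),
        iteratedDeriv i stdPdf y / i.factorial * (-1) ^ i * z ^ i := fun z =>
    Finset.sum_congr rfl fun i _ => by rw [neg_pow z]; ring
  have hInt : ∀ i ∈ Finset.range (n + 1), Integrable (fun z : ℝ =>
      iteratedDeriv i stdPdf y / i.factorial * (-1) ^ i * z ^ i) ρ := fun i hi =>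
    (hρ i (Nat.lt_succ_iff.1 (Finset.mem_range.1 hi))).const_mul _
  have e : dens ρ y - ∑ i ∈ Finset.range (n + 1),
        iteratedDeriv i stdPdf y / i.factorial * (-1) ^ i * ∫ z, z ^ i ∂ρ =
      ∫ z, (stdPdf (y - z) - ∑ i ∈ Finset.range (n + 1),
        iteratedDeriv i stdPdf y / i.factorial * (-1) ^ i * z ^ i) ∂ρ := by
    rw [integral_sub (integrable_stdPdf_sub ρ y) (integrable_finsetSum _ hInt),
      integral_finsetSum _ hInt]
    simp_rw [integral_const_mul]
    rfl
  rw [e, ← Real.norm_eq_abs]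
  refine (norm_integral_le_integral_norm _).trans ?_
  refine (integral_mono (((integrable_stdPdf_sub ρ y).sub (integrable_finsetSum _ hInt)).norm)
    ((hI.const_mul C).mul_const (Real.exp (-(11 / 24) * y ^ 2))) fun z => ?_).trans ?_
  · have := h y z
    rw [hsum z] at this
    simpa using this
  · rw [integral_mul_const, integral_const_mul]

/-- The part of the `m`-th absolute moment that comes from outside `[-1, 1]`. -/
noncomputable def tailMoment (m : ℕ) (μ : Measure ℝ) : ℝ := ∫ z in {z | |z| ≤ 1}ᶜ, |z| ^ m ∂μ

theorem measurableSet_abs_le_one : MeasurableSet {z : ℝ | |z| ≤ 1} :=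
  measurableSet_le (by fun_prop) (by fun_prop)

theorem tailMoment_nonneg (m : ℕ) (μ : Measure ℝ) : 0 ≤ tailMoment m μ :=
  integral_nonneg fun z => by positivity

theorem integrable_pow_of_le {μ : Measure ℝ} [IsFiniteMeasure μ] {m i : ℕ} (hi : i ≤ m)
    (h : Integrable (fun z : ℝ => |z| ^ m) μ) : Integrable (fun z : ℝ => z ^ i) μ := by
  refine (h.add (integrable_const 1)).mono' (by fun_prop) (ae_of_all _ fun z => ?_)
  simp only [Real.norm_eq_abs, abs_pow, Pi.add_apply]
  rcases le_total |z| 1 with h1 | h1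
  · exact (pow_le_one₀ (abs_nonneg _) h1).trans (by linarith [pow_nonneg (abs_nonneg z) m])
  · exact (pow_le_pow_right₀ h1 hi).trans (by linarith)

theorem abs_setIntegral_compl_pow_le {μ : Measure ℝ} [IsFiniteMeasure μ] {m i : ℕ} (hi : i ≤ m)
    (h : Integrable (fun z : ℝ => |z| ^ m) μ) :
    |∫ z in {z | |z| ≤ 1}ᶜ, z ^ i ∂μ| ≤ tailMoment m μ := by
  rw [← Real.norm_eq_abs]
  refine (norm_integral_le_integral_norm _).trans ?_
  refine setIntegral_mono_on (integrable_pow_of_le hi h).norm.integrableOn h.integrableOn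
    measurableSet_abs_le_one.compl fun z hz => ?_
  simp only [Set.mem_compl_iff, Set.mem_ofPred_eq, not_le] at hz
  simp only [Real.norm_eq_abs, abs_pow]
  exact pow_le_pow_right₀ hz.le hi

/-- If the moments of `μ` of order less than `j` are Gaussian, then its smoothed density differs
from a Gaussian density by a multiple of the `j`-th derivative of the latter, up to higher-order
terms. -/
theorem exists_abs_dens_sub_varPdf_sub_le (j : ℕ) :
    ∃ C : ℝ, 0 < C ∧ ∀ μ : Measure ℝ, IsProbabilityMeasure μ →
      Integrable (fun z : ℝ => |z| ^ (2 * j)) μ → 1 ≤ j → MatchesGauss j μ →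
      ∫ z, z ^ 2 ∂μ ≤ 1 / 48 → ∀ y : ℝ,
      |dens (μ.restrict {z | |z| ≤ 1}) y - varPdf (1 + ∫ z, z ^ 2 ∂μ) y -
          gaussGap j μ * (iteratedDeriv j stdPdf y / j.factorial * (-1) ^ j)| ≤
        C * (∫ z, |z| ^ (j + 1) ∂μ + √(∫ z, z ^ 2 ∂μ) ^ (j + 1) + tailMoment (2 * j) μ) *
          Real.exp (-(11 / 24) * y ^ 2) := by
  obtain ⟨C₁, hC₁, h₁⟩ := exists_abs_dens_sub_taylor_le j
  obtain ⟨C₂, hC₂, h₂⟩ := exists_integral_abs_pow_mul_exp_gaussianReal_le (j + 1)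
  choose c hc hd using fun i => exists_abs_iteratedDeriv_stdPdf_le i (δ := 1 / 24) (by norm_num)
  set c' := ∑ i ∈ Finset.range (j + 1), c i with hc'
  have hc'0 : 0 ≤ c' := Finset.sum_nonneg fun i _ => (hc i).le
  refine ⟨C₁ * Real.exp 12 + C₁ * C₂ + c', by positivity, fun μ _ hm hj hM hv y => ?_⟩
  set A : Set ℝ := {z | |z| ≤ 1} with hA
  have hAm : MeasurableSet A := measurableSet_abs_le_one
  set v := ∫ z, z ^ 2 ∂μ with hvdef
  have hv0 : 0 ≤ v := integral_nonneg fun z => sq_nonneg z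
  have hpow : ∀ i ≤ 2 * j, Integrable (fun z : ℝ => z ^ i) μ := fun i hi =>
    integrable_pow_of_le hi hm
  set E := Real.exp (-(11 / 24) * y ^ 2) with hE
  set d : ℕ → ℝ := fun i => iteratedDeriv i stdPdf y / i.factorial * (-1) ^ i with hddef
  have hdb : ∀ i, |d i| ≤ c i * E := by
    intro i
    simp only [hddef, abs_mul, abs_div, abs_pow, abs_neg, abs_one, one_pow, mul_one, Nat.abs_cast]
    have hf : (1 : ℝ) ≤ i.factorial := by
      exact_mod_cast Nat.one_le_iff_ne_zero.2 (Nat.factorial_ne_zero _)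
    refine (div_le_self (abs_nonneg _) hf).trans ((hd i y).trans (le_of_eq ?_))
    rw [hE]; congr 2; norm_num
  have hexpA : Integrable (fun z : ℝ => |z| ^ (j + 1) * Real.exp (12 * z ^ 2)) (μ.restrict A) := by
    refine Integrable.of_bound (by fun_prop) (Real.exp 12) ?_
    refine (ae_restrict_iff' hAm).2 (ae_of_all _ fun z hz => ?_)
    rw [Real.norm_eq_abs, abs_of_nonneg (by positivity)]
    have hz' : z ^ 2 ≤ 1 := by rw [← sq_abs]; exact pow_le_one₀ (abs_nonneg _) hz
    calc |z| ^ (j + 1) * Real.exp (12 * z ^ 2) ≤ 1 * Real.exp 12 := by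
          gcongr
          · exact pow_le_one₀ (abs_nonneg _) hz
          · linarith
      _ = _ := one_mul _
  have habs : Integrable (fun z : ℝ => |z| ^ (j + 1)) μ := by
    simpa only [Real.norm_eq_abs, abs_pow] using (hpow (j + 1) (by omega)).norm
  have hexpAle : ∫ z in A, |z| ^ (j + 1) * Real.exp (12 * z ^ 2) ∂μ ≤
      Real.exp 12 * ∫ z, |z| ^ (j + 1) ∂μ := by
    rw [← integral_const_mul]
    refine (setIntegral_mono_on hexpA (habs.const_mul _).integrableOn hAm fun z hz => ?_).trans
      (setIntegral_le_integral (habs.const_mul _) (ae_of_all _ fun z => by positivity))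
    have hz' : z ^ 2 ≤ 1 := by rw [← sq_abs]; exact pow_le_one₀ (abs_nonneg _) hz
    rw [mul_comm]
    gcongr
    linarith
  have hT := tailMoment_nonneg (2 * j) μ
  have hf1 := h₁ (μ.restrict A) inferInstance (fun i hi => (hpow i (by omega)).integrableOn)
    hexpA y
  have hg1 := h₁ (gaussianReal 0 v.toNNReal) inferInstance
    (fun i _ => integrable_gaussianReal_pow _ i) (h₂ v hv0 hv).1 y
  rw [dens_gaussianReal hv0] at hg1
  have hmom : ∀ i ≤ j, |∫ z in A, z ^ i ∂μ - ∫ z, z ^ i ∂μ| ≤ tailMoment (2 * j) μ := by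
    intro i hi
    have := integral_add_compl hAm (hpow i (by omega))
    have h3 := abs_setIntegral_compl_pow_le (i := i) (by omega) hm
    rw [← this]
    rwa [sub_add_cancel_left, abs_neg]
  -- Three errors: the Taylor remainders of the truncated law and of the Gaussian, and the moments
  -- lost by truncation. In the difference of the two Taylor sums the terms below order `j` cancel,
  -- leaving the gap.
  have hsplit : dens (μ.restrict A) y - varPdf (1 + v) y - gaussGap j μ * d j =
      (dens (μ.restrict A) y - ∑ i ∈ Finset.range (j + 1), d i * ∫ z in A, z ^ i ∂μ) -
      (varPdf (1 + v) y - ∑ i ∈ Finset.range (j + 1), d i * gaussMoment v i) +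
      ∑ i ∈ Finset.range (j + 1), d i * (∫ z in A, z ^ i ∂μ - ∫ z, z ^ i ∂μ) := by
    have h4 : ∑ i ∈ Finset.range (j + 1), d i * ∫ z, z ^ i ∂μ =
        ∑ i ∈ Finset.range (j + 1), d i * gaussMoment v i + gaussGap j μ * d j := by
      rw [Finset.sum_range_succ, Finset.sum_range_succ, Finset.sum_congr rfl fun i hi => by
        rw [hM i (Finset.mem_range.1 hi)]]
      rw [gaussGap, ← hvdef]; ring
    simp_rw [mul_sub, Finset.sum_sub_distrib]
    rw [h4]; ring
  have hlast : |∑ i ∈ Finset.range (j + 1), d i * (∫ z in A, z ^ i ∂μ - ∫ z, z ^ i ∂μ)| ≤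
      c' * tailMoment (2 * j) μ * E := by
    refine (Finset.abs_sum_le_sum_abs _ _).trans ?_
    rw [hc', Finset.sum_mul, Finset.sum_mul]
    refine Finset.sum_le_sum fun i hi => ?_
    rw [abs_mul]
    calc _ ≤ c i * E * tailMoment (2 * j) μ :=
          mul_le_mul (hdb i) (hmom i (Nat.lt_succ_iff.1 (Finset.mem_range.1 hi))) (abs_nonneg _)
            (mul_nonneg (hc i).le (Real.exp_pos _).le)
      _ = _ := by ring
  have hE0 : 0 < E := Real.exp_pos _
  have hM0 : 0 ≤ ∫ z, |z| ^ (j + 1) ∂μ := integral_nonneg fun z => by positivity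
  have hs0 : 0 ≤ √v ^ (j + 1) := by positivity
  have hf2 : C₁ * (∫ z in A, |z| ^ (j + 1) * Real.exp (12 * z ^ 2) ∂μ) * E ≤
      C₁ * (Real.exp 12 * ∫ z, |z| ^ (j + 1) ∂μ) * E := by gcongr
  have hg2 : C₁ * (∫ z, |z| ^ (j + 1) * Real.exp (12 * z ^ 2) ∂(gaussianReal 0 v.toNNReal)) * E ≤
      C₁ * (C₂ * √v ^ (j + 1)) * E := by
    gcongr
    exact (h₂ v hv0 hv).2
  rw [hsplit]
  refine (abs_add_le _ _).trans ((add_le_add ((abs_sub _ _).trans (add_le_add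
    (hf1.trans hf2) (hg1.trans hg2))) hlast).trans ?_)
  have e12 := Real.exp_pos 12
  have key : 0 ≤ E * (C₁ * Real.exp 12 * (√v ^ (j + 1) + tailMoment (2 * j) μ) +
      C₁ * C₂ * (∫ z, |z| ^ (j + 1) ∂μ + tailMoment (2 * j) μ) +
      c' * (∫ z, |z| ^ (j + 1) ∂μ + √v ^ (j + 1))) := by positivity
  nlinarith [key]

/-! ### Relative entropy to the Gaussian law -/

/-- The relative entropy of `μ ∗ 𝒩(0, 1)` with respect to `𝒩(0, 1 + ∫ z²)`. -/
noncomputable def nonGaussianness (μ : Measure ℝ) : ℝ :=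
  ∫ y, dens μ y * (Real.log (dens μ y) - Real.log (varPdf (1 + ∫ z, z ^ 2 ∂μ) y))

/-- The coefficient of the squared moment gap in the expansion of `nonGaussianness`. -/
noncomputable def gapCoeff (j : ℕ) (v : ℝ) : ℝ :=
  ∫ y, (iteratedDeriv j stdPdf y / j.factorial * (-1) ^ j) ^ 2 / varPdf (1 + v) y

/-- Pointwise form of the expansion: `p` is the density of the truncated part, `b` that of the tail,
`g` the Gaussian. The expansion of `u log u` handles `p / g`. Adding `b` changes the integrand by `b
(log (p + b) - log g) + p (log (p + b) - log p)`, where the first logarithm lies in `[-r, r]` and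
the last product in `[0, b]`. -/
theorem abs_entropy_sub_le {g p b r : ℝ} (hg : 0 < g) (hp : 0 < p) (hb : 0 ≤ b)
    (h1 : g * Real.exp (-r) ≤ p) (h2 : p + b ≤ g * Real.exp r) :
    |(p + b) * (Real.log (p + b) - Real.log g) - (p - g) - (p - g) ^ 2 / g / 2| ≤
      |p - g| ^ 3 / g ^ 2 + b * (1 + r) := by
  have hpb : 0 < p + b := by linarith
  have hl1 : -r ≤ Real.log p - Real.log g := by
    have := Real.log_le_log (by positivity) h1
    rw [Real.log_mul hg.ne' (Real.exp_pos _).ne', Real.log_exp] at this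
    linarith
  have hl2 : Real.log (p + b) - Real.log g ≤ r := by
    have := Real.log_le_log hpb h2
    rw [Real.log_mul hg.ne' (Real.exp_pos _).ne', Real.log_exp] at this
    linarith
  have hl3 : p * (Real.log (p + b) - Real.log p) ≤ b := by
    rw [← Real.log_div hpb.ne' hp.ne']
    have := Real.log_le_sub_one_of_pos (x := (p + b) / p) (by positivity)
    have h3 := mul_le_mul_of_nonneg_left this hp.le
    have h4 : p * ((p + b) / p - 1) = b := by field_simp; ring
    linarith
  have hl4 : Real.log p ≤ Real.log (p + b) := Real.log_le_log hp (by linarith)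
  have hmain : |p * (Real.log p - Real.log g) - (p - g) - (p - g) ^ 2 / g / 2| ≤
      |p - g| ^ 3 / g ^ 2 := by
    have hw : -1 < (p - g) / g := by rw [lt_div_iff₀ hg]; linarith
    have h5 := abs_mul_log_one_add_sub_le hw
    have e1 : 1 + (p - g) / g = p / g := by field_simp; ring
    rw [e1, Real.log_div hp.ne' hg.ne'] at h5
    have h6 := mul_le_mul_of_nonneg_left h5 hg.le
    rw [← abs_of_pos hg, ← abs_mul, abs_of_pos hg, abs_div, abs_of_pos hg] at h6
    have e2 : g * (p / g * (Real.log p - Real.log g) - (p - g) / g - ((p - g) / g) ^ 2 / 2) =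
        p * (Real.log p - Real.log g) - (p - g) - (p - g) ^ 2 / g / 2 := by field_simp
    have e3 : g * (|p - g| / g) ^ 3 = |p - g| ^ 3 / g ^ 2 := by field_simp
    rwa [e2, e3] at h6
  rw [abs_le] at hmain ⊢
  constructor
  · nlinarith [mul_nonneg hb (sub_nonneg.2 hl1), mul_nonneg hpb.le (sub_nonneg.2 hl4)]
  · nlinarith [mul_nonneg hb (sub_nonneg.2 hl2)]

theorem inv_varPdf_le {s : ℝ} (hs : 1 ≤ s) (hs' : s ≤ 2) (y : ℝ) :
    (varPdf s y)⁻¹ ≤ 4 * Real.exp (y ^ 2 / 2) := by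
  unfold varPdf
  rw [mul_inv, inv_inv, ← Real.exp_neg, neg_neg]
  refine mul_le_mul ?_ (Real.exp_le_exp.2 ?_) (Real.exp_pos _).le (by norm_num)
  · rw [Real.sqrt_le_left (by norm_num)]
    nlinarith [Real.pi_lt_d2]
  · exact div_le_div_of_nonneg_left (sq_nonneg y) (by norm_num) (by linarith)

theorem varPdf_le {s : ℝ} (hs : 1 ≤ s) (y : ℝ) : varPdf s y ≤ (√(2 * Real.pi))⁻¹ := by
  unfold varPdf
  have h1 : √(2 * Real.pi) ≤ √(2 * Real.pi * s) :=
    Real.sqrt_le_sqrt (le_mul_of_one_le_right (by positivity) hs)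
  have h2 : Real.exp (-(y ^ 2 / (2 * s))) ≤ 1 := Real.exp_le_one_iff.2 (by
    rw [neg_nonpos]; positivity)
  calc _ ≤ (√(2 * Real.pi * s))⁻¹ * 1 := by gcongr
    _ ≤ _ := by rw [mul_one]; gcongr

/-- From `(y - z)² ≤ 2 (y² + z²)`. It keeps logarithms of smoothed densities of at most quadratic
growth. -/
theorem measureReal_mul_le_dens_restrict (μ : Measure ℝ) [IsFiniteMeasure μ] (y R : ℝ) :
    μ.real {z | |z| ≤ R} * ((√(2 * Real.pi))⁻¹ * Real.exp (-(R ^ 2 + y ^ 2))) ≤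
      dens (μ.restrict {z | |z| ≤ R}) y := by
  have hA : MeasurableSet {z : ℝ | |z| ≤ R} := measurableSet_le (by fun_prop) (by fun_prop)
  have := setIntegral_mono_on (s := {z : ℝ | |z| ≤ R}) (μ := μ)
    (f := fun _ => (√(2 * Real.pi))⁻¹ * Real.exp (-(R ^ 2 + y ^ 2)))
    (integrable_const _).integrableOn (integrable_stdPdf_sub μ y).integrableOn hA fun z hz => by
      unfold stdPdf
      have hz2 : z ^ 2 ≤ R ^ 2 := sq_le_sq' (abs_le.1 hz).1 (abs_le.1 hz).2
      gcongr
      nlinarith [sq_nonneg (y + z)]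
  simpa [dens] using this

theorem integral_varPdf {s : ℝ} (hs : 0 < s) : Integrable (varPdf s) ∧ ∫ y, varPdf s y = 1 := by
  have e : gaussianPDFReal 0 s.toNNReal = varPdf s := by
    ext y; simp [gaussianPDFReal, varPdf, hs.le, neg_div]
  rw [← e]
  exact ⟨integrable_gaussianPDFReal _ _, integral_gaussianPDFReal_eq_one _ (by simpa using hs)⟩

theorem le_tailMoment_of_le {μ : Measure ℝ} [IsFiniteMeasure μ] {m i : ℕ} (hi : i ≤ m)
    (h : Integrable (fun z : ℝ => |z| ^ m) μ) :
    ∫ z in {z | |z| ≤ 1}ᶜ, |z| ^ i ∂μ ≤ tailMoment m μ := by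
  refine setIntegral_mono_on ?_ h.integrableOn measurableSet_abs_le_one.compl fun z hz => ?_
  · simpa only [Real.norm_eq_abs, abs_pow] using (integrable_pow_of_le hi h).norm.integrableOn
  · simp only [Set.mem_compl_iff, Set.mem_ofPred_eq, not_le] at hz
    exact pow_le_pow_right₀ hz.le hi

/-- Reduction of the relative entropy to a `χ²`-type integral over the truncated law. -/
theorem abs_nonGaussianness_sub_le {μ : Measure ℝ} [IsProbabilityMeasure μ] {m : ℕ} (hm : 2 ≤ m)
    (hμ : Integrable (fun z : ℝ => |z| ^ m) μ) (hv : ∫ z, z ^ 2 ∂μ ≤ 1)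
    (hT : tailMoment m μ ≤ 1 / 2)
    (h2 : Integrable fun y => (dens (μ.restrict {z | |z| ≤ 1}) y -
      varPdf (1 + ∫ z, z ^ 2 ∂μ) y) ^ 2 / varPdf (1 + ∫ z, z ^ 2 ∂μ) y)
    (h3 : Integrable fun y => |dens (μ.restrict {z | |z| ≤ 1}) y -
      varPdf (1 + ∫ z, z ^ 2 ∂μ) y| ^ 3 / varPdf (1 + ∫ z, z ^ 2 ∂μ) y ^ 2) :
    |nonGaussianness μ - (∫ y, (dens (μ.restrict {z | |z| ≤ 1}) y -
      varPdf (1 + ∫ z, z ^ 2 ∂μ) y) ^ 2 / varPdf (1 + ∫ z, z ^ 2 ∂μ) y) / 2| ≤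
      (∫ y, |dens (μ.restrict {z | |z| ≤ 1}) y -
        varPdf (1 + ∫ z, z ^ 2 ∂μ) y| ^ 3 / varPdf (1 + ∫ z, z ^ 2 ∂μ) y ^ 2) +
      6 * tailMoment m μ := by
  set A : Set ℝ := {z | |z| ≤ 1} with hA
  have hAm : MeasurableSet A := measurableSet_abs_le_one
  set v := ∫ z, z ^ 2 ∂μ with hvdef
  have hv0 : 0 ≤ v := integral_nonneg fun z => sq_nonneg z
  set g := varPdf (1 + v) with hgdef
  have hg : ∀ y, 0 < g y := varPdf_pos (by linarith)
  set T := tailMoment m μ with hTdef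
  have hmass : μ.real Aᶜ ≤ T := by
    have := le_tailMoment_of_le (i := 0) (by omega) hμ
    simpa using this
  have hmassA : 1 / 2 ≤ μ.real A := by
    have := probReal_compl_eq_one_sub (μ := μ) hAm
    linarith
  have hsq : ∫ z in Aᶜ, z ^ 2 ∂μ ≤ T := by
    have := le_tailMoment_of_le (i := 2) hm hμ
    simpa using this
  have hI2 : Integrable (fun z : ℝ => z ^ 2) (μ.restrict Aᶜ) :=
    (integrable_pow_of_le hm hμ).integrableOn
  -- The pointwise bound with `r = 2 + y²`. Below, the truncated law has mass at least `1/2 ≥ exp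
  -- (-1)`; above, `dens μ ≤ 1` and `1 / g ≤ 4 exp (y² / 2) ≤ exp (2 + y²)`.
  have hpt : ∀ y, |dens μ y * (Real.log (dens μ y) - Real.log (g y)) -
      (dens (μ.restrict A) y - g y) - (dens (μ.restrict A) y - g y) ^ 2 / g y / 2| ≤
      |dens (μ.restrict A) y - g y| ^ 3 / g y ^ 2 + dens (μ.restrict Aᶜ) y * (1 + (2 + y ^ 2)) := by
    intro y
    rw [← dens_restrict_add_dens_restrict_compl μ hAm y]
    have hlow : g y * Real.exp (-(2 + y ^ 2)) ≤ dens (μ.restrict A) y := by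
      refine le_trans ?_ (measureReal_mul_le_dens_restrict μ y 1)
      have h4 : Real.exp (-(2 + y ^ 2)) ≤ 1 / 2 * Real.exp (-(1 ^ 2 + y ^ 2)) := by
        have e : -(2 + y ^ 2) = -1 + -(1 ^ 2 + y ^ 2) := by ring
        rw [e, Real.exp_add]
        gcongr
        rw [Real.exp_neg, one_div]
        gcongr
        linarith [Real.add_one_le_exp (1 : ℝ)]
      calc g y * Real.exp (-(2 + y ^ 2))
          ≤ (√(2 * Real.pi))⁻¹ * (1 / 2 * Real.exp (-(1 ^ 2 + y ^ 2))) := by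
            gcongr
            exact varPdf_le (by linarith) y
        _ = 1 / 2 * ((√(2 * Real.pi))⁻¹ * Real.exp (-(1 ^ 2 + y ^ 2))) := by ring
        _ ≤ _ := by gcongr
    refine abs_entropy_sub_le (hg y) ?_ (dens_nonneg _ _) hlow ?_
    · exact lt_of_lt_of_le (mul_pos (hg y) (Real.exp_pos _)) hlow
    · rw [dens_restrict_add_dens_restrict_compl μ hAm y]
      refine (dens_le_one μ y).trans ?_
      have h5 := inv_varPdf_le (s := 1 + v) (by linarith) (by linarith) y
      rw [← inv_mul_le_iff₀ (hg y), mul_one]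
      refine h5.trans ?_
      rw [Real.exp_add]
      gcongr
      · have : Real.exp 2 = Real.exp 1 * Real.exp 1 := by rw [← Real.exp_add]; norm_num
        rw [this]
        nlinarith [Real.add_one_le_exp (1 : ℝ)]
      · nlinarith [sq_nonneg y]
  have hIb : Integrable fun y => dens (μ.restrict Aᶜ) y * (1 + (2 + y ^ 2)) := by
    have := ((integrable_dens (μ.restrict Aᶜ)).const_mul 3).add (integrable_sq_mul_dens hI2)
    refine this.congr (ae_of_all _ fun y => ?_)
    simp only [Pi.add_apply]; ring
  -- The tail has mass and second moment at most `T`, and smoothing adds its mass to its second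
  -- moment: `3 T + (T + T)`.
  have hvalb : ∫ y, dens (μ.restrict Aᶜ) y * (1 + (2 + y ^ 2)) ≤ 5 * T := by
    have e : ∀ y, dens (μ.restrict Aᶜ) y * (1 + (2 + y ^ 2)) =
      3 * dens (μ.restrict Aᶜ) y + dens (μ.restrict Aᶜ) y * y ^ 2 := fun y => by ring
    simp_rw [e]
    rw [integral_add ((integrable_dens _).const_mul 3) (integrable_sq_mul_dens hI2),
      integral_const_mul, integral_dens, integral_sq_mul_dens hI2]
    simp only [measureReal_restrict_apply MeasurableSet.univ, Set.univ_inter]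
    linarith
  have hIg := integral_varPdf (s := 1 + v) (by linarith)
  have hId : Integrable fun y => dens (μ.restrict A) y - g y := (integrable_dens _).sub hIg.1
  -- The first-order term integrates to minus the lost mass; this is the sixth `T`.
  have hvald : |∫ y, (dens (μ.restrict A) y - g y)| ≤ T := by
    rw [integral_sub (integrable_dens _) hIg.1, hIg.2, integral_dens]
    simp only [measureReal_restrict_apply MeasurableSet.univ, Set.univ_inter]
    have := probReal_compl_eq_one_sub (μ := μ) hAm
    have h6 : 0 ≤ μ.real Aᶜ := measureReal_nonneg
    rw [abs_le]; constructor <;> linarith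
  have hmeas : AEStronglyMeasurable (fun y => dens μ y * (Real.log (dens μ y) - Real.log (g y)))
      volume := by
    have : Measurable g := (continuous_varPdf _).measurable
    fun_prop
  have hItot : Integrable fun y => dens μ y * (Real.log (dens μ y) - Real.log (g y)) -
      (dens (μ.restrict A) y - g y) - (dens (μ.restrict A) y - g y) ^ 2 / g y / 2 :=
    (h3.add hIb).mono' ((hmeas.sub hId.aestronglyMeasurable).sub
      (h2.div_const 2).aestronglyMeasurable) (ae_of_all _ hpt)
  have hImain : Integrable fun y => dens μ y * (Real.log (dens μ y) - Real.log (g y)) := by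
    refine ((hItot.add (h2.div_const 2)).add hId).congr (ae_of_all _ fun y => ?_)
    simp only [Pi.add_apply]; ring
  have h7 := (norm_integral_le_integral_norm (μ := volume) fun y =>
    dens μ y * (Real.log (dens μ y) - Real.log (g y)) -
      (dens (μ.restrict A) y - g y) - (dens (μ.restrict A) y - g y) ^ 2 / g y / 2).trans
    (integral_mono hItot.norm (h3.add hIb) hpt)
  simp only [Pi.add_apply] at h7
  have hs1 := integral_sub (hImain.sub hId) (h2.div_const 2)
  simp only [Pi.sub_apply] at hs1
  rw [integral_add h3 hIb, hs1, integral_sub hImain hId, Real.norm_eq_abs, integral_div] at h7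
  have e : nonGaussianness μ = ∫ y, dens μ y * (Real.log (dens μ y) - Real.log (g y)) := rfl
  rw [← e] at h7
  rw [abs_le] at h7 hvald ⊢
  constructor <;> linarith

/-- **Expansion of the relative entropy.** If the moments of `μ` of order less than `j` are
Gaussian, the relative entropy of `μ ∗ 𝒩(0, 1)` to the Gaussian law is proportional to the square
of the gap in the `j`-th moment, up to explicit errors. -/
theorem exists_abs_nonGaussianness_sub_gap_le (j : ℕ) (hj : 1 ≤ j) :
    ∃ C : ℝ, 0 < C ∧ ∀ μ : Measure ℝ, IsProbabilityMeasure μ →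
      Integrable (fun z : ℝ => |z| ^ (2 * j)) μ → MatchesGauss j μ →
      ∫ z, z ^ 2 ∂μ ≤ 1 / 48 → tailMoment (2 * j) μ ≤ 1 / 2 → ∀ m,
      m = ∫ z, |z| ^ (j + 1) ∂μ + √(∫ z, z ^ 2 ∂μ) ^ (j + 1) + tailMoment (2 * j) μ →
      |nonGaussianness μ - gapCoeff j (∫ z, z ^ 2 ∂μ) * gaussGap j μ ^ 2 / 2| ≤
        C * (m * (|gaussGap j μ| + m) + (|gaussGap j μ| + m) ^ 3) + 6 * tailMoment (2 * j) μ := by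
  obtain ⟨C₁, hC₁, h₁⟩ := exists_abs_dens_sub_varPdf_sub_le j
  obtain ⟨c, hc, hd⟩ := exists_abs_iteratedDeriv_stdPdf_le j (δ := 1 / 24) (by norm_num)
  set K := C₁ + c with hK
  have hK0 : 0 < K := by positivity
  set I₁ := ∫ y : ℝ, Real.exp (-(5 / 12) * y ^ 2)
  set I₂ := ∫ y : ℝ, Real.exp (-(3 / 8) * y ^ 2)
  have hi₁ : Integrable fun y : ℝ => Real.exp (-(5 / 12) * y ^ 2) :=
    integrable_exp_neg_mul_sq (by norm_num)
  have hi₂ : Integrable fun y : ℝ => Real.exp (-(3 / 8) * y ^ 2) :=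
    integrable_exp_neg_mul_sq (by norm_num)
  have hI₁ : 0 ≤ I₁ := integral_nonneg fun y => (Real.exp_pos _).le
  have hI₂ : 0 ≤ I₂ := integral_nonneg fun y => (Real.exp_pos _).le
  refine ⟨4 * K ^ 2 * I₁ + 16 * K ^ 3 * I₂ + 1, by positivity,
    fun μ _ hm hM hv hT m hmdef => ?_⟩
  set A : Set ℝ := {z | |z| ≤ 1} with hA
  set v := ∫ z, z ^ 2 ∂μ with hvdef
  have hv0 : 0 ≤ v := integral_nonneg fun z => sq_nonneg z
  set g := varPdf (1 + v) with hgdef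
  have hg : ∀ y, 0 < g y := varPdf_pos (by linarith)
  have hginv : ∀ y, (g y)⁻¹ ≤ 4 * Real.exp (y ^ 2 / 2) :=
    inv_varPdf_le (by linarith) (by linarith)
  have hgm : Measurable g := (continuous_varPdf _).measurable
  set H : ℝ → ℝ := fun y => iteratedDeriv j stdPdf y / j.factorial * (-1) ^ j with hH
  have hHm : Measurable H := by
    have : Continuous (iteratedDeriv j stdPdf) :=
      (contDiff_stdPdf (n := j)).continuous_iteratedDeriv j le_rfl
    have := this.measurable
    fun_prop
  set κ := gaussGap j μ with hκ
  set D : ℝ → ℝ := fun y => dens (μ.restrict A) y - g y with hD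
  have hDm : Measurable D := (measurable_dens _).sub hgm
  have hT0 := tailMoment_nonneg (2 * j) μ
  have hm0 : 0 ≤ m := by
    have : 0 ≤ ∫ z, |z| ^ (j + 1) ∂μ := integral_nonneg fun z => by positivity
    rw [hmdef]; positivity
  set E : ℝ → ℝ := fun y => Real.exp (-(11 / 24) * y ^ 2) with hE
  have hE0 : ∀ y, 0 < E y := fun y => Real.exp_pos _
  have hHb : ∀ y, |H y| ≤ K * E y := by
    intro y
    simp only [hH, abs_mul, abs_div, abs_pow, abs_neg, abs_one, one_pow, mul_one, Nat.abs_cast]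
    have hf : (1 : ℝ) ≤ j.factorial := by
      exact_mod_cast Nat.one_le_iff_ne_zero.2 (Nat.factorial_ne_zero _)
    refine (div_le_self (abs_nonneg _) hf).trans ((hd y).trans ?_)
    have e : -(1 / 2 - 1 / 24 : ℝ) = -(11 / 24) := by norm_num
    rw [e]
    exact mul_le_mul_of_nonneg_right (by linarith) (hE0 y).le
  have hDH : ∀ y, |D y - κ * H y| ≤ K * m * E y := by
    intro y
    have := h₁ μ inferInstance hm hj hM hv y
    rw [← hvdef, ← hmdef] at this
    refine this.trans ?_
    gcongr
    linarith
  set q := |κ| + m with hq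
  have hq0 : 0 ≤ q := by positivity
  have hDb : ∀ y, |D y| ≤ K * q * E y := by
    intro y
    have e : D y = (D y - κ * H y) + κ * H y := by ring
    rw [e]
    have h9 : |κ * H y| ≤ |κ| * (K * E y) := by
      rw [abs_mul]; exact mul_le_mul_of_nonneg_left (hHb y) (abs_nonneg _)
    refine (abs_add_le _ _).trans ((add_le_add (hDH y) h9).trans (le_of_eq ?_))
    rw [hq]; ring
  -- The exponents that remain are `2 · 11/24 - 1/2 = 5/12` here and `3 · 11/24 - 2 · 1/2 = 3/8` for
  -- the cubic term.
  have hEE : ∀ y, E y ^ 2 * (g y)⁻¹ ≤ 4 * Real.exp (-(5 / 12) * y ^ 2) := by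
    intro y
    refine (mul_le_mul_of_nonneg_left (hginv y) (by positivity)).trans (le_of_eq ?_)
    rw [hE, mul_left_comm, ← Real.exp_nat_mul, ← Real.exp_add]
    congr 2; push_cast; ring
  have hEEE : ∀ y, E y ^ 3 * ((g y)⁻¹) ^ 2 ≤ 16 * Real.exp (-(3 / 8) * y ^ 2) := by
    intro y
    have h0 : 0 ≤ (g y)⁻¹ := (inv_pos.2 (hg y)).le
    refine (mul_le_mul_of_nonneg_left (pow_le_pow_left₀ h0 (hginv y) 2) (by positivity)).trans
      (le_of_eq ?_)
    rw [hE, mul_pow, mul_left_comm, ← Real.exp_nat_mul, ← Real.exp_nat_mul, ← Real.exp_add]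
    norm_num
    ring
  have b2 : ∀ y, D y ^ 2 / g y ≤ 4 * K ^ 2 * q ^ 2 * Real.exp (-(5 / 12) * y ^ 2) := by
    intro y
    rw [div_eq_mul_inv, ← sq_abs]
    have h0 : 0 ≤ (g y)⁻¹ := (inv_pos.2 (hg y)).le
    calc |D y| ^ 2 * (g y)⁻¹ ≤ (K * q * E y) ^ 2 * (g y)⁻¹ := by gcongr; exact hDb y
      _ = K ^ 2 * q ^ 2 * (E y ^ 2 * (g y)⁻¹) := by ring
      _ ≤ K ^ 2 * q ^ 2 * (4 * Real.exp (-(5 / 12) * y ^ 2)) := by 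
          exact mul_le_mul_of_nonneg_left (hEE y) (by positivity)
      _ = _ := by ring
  have b3 : ∀ y, |D y| ^ 3 / g y ^ 2 ≤ 16 * K ^ 3 * q ^ 3 * Real.exp (-(3 / 8) * y ^ 2) := by
    intro y
    rw [div_eq_mul_inv, ← inv_pow]
    have h0 : 0 ≤ (g y)⁻¹ := (inv_pos.2 (hg y)).le
    calc |D y| ^ 3 * ((g y)⁻¹) ^ 2 ≤ (K * q * E y) ^ 3 * ((g y)⁻¹) ^ 2 := by gcongr; exact hDb y
      _ = K ^ 3 * q ^ 3 * (E y ^ 3 * ((g y)⁻¹) ^ 2) := by ring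
      _ ≤ K ^ 3 * q ^ 3 * (16 * Real.exp (-(3 / 8) * y ^ 2)) := by exact mul_le_mul_of_nonneg_left (hEEE y) (by positivity)
      _ = _ := by ring
  have bH : ∀ y, H y ^ 2 / g y ≤ 4 * K ^ 2 * Real.exp (-(5 / 12) * y ^ 2) := by
    intro y
    rw [div_eq_mul_inv, ← sq_abs]
    have h0 : 0 ≤ (g y)⁻¹ := (inv_pos.2 (hg y)).le
    calc |H y| ^ 2 * (g y)⁻¹ ≤ (K * E y) ^ 2 * (g y)⁻¹ := by gcongr; exact hHb y
      _ = K ^ 2 * (E y ^ 2 * (g y)⁻¹) := by ring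
      _ ≤ K ^ 2 * (4 * Real.exp (-(5 / 12) * y ^ 2)) := by 
          exact mul_le_mul_of_nonneg_left (hEE y) (by positivity)
      _ = _ := by ring
  -- Difference of squares: `D - κ H` is of size `m` and `D + κ H` of size `q`, so the error is
  -- linear in the remainder `m`.
  have bdiff : ∀ y, |D y ^ 2 / g y - κ ^ 2 * (H y ^ 2 / g y)| ≤
      8 * K ^ 2 * (m * q) * Real.exp (-(5 / 12) * y ^ 2) := by
    intro y
    have h0 : 0 ≤ (g y)⁻¹ := (inv_pos.2 (hg y)).le
    have e : D y ^ 2 / g y - κ ^ 2 * (H y ^ 2 / g y) =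
        (D y - κ * H y) * (D y + κ * H y) * (g y)⁻¹ := by
      rw [div_eq_mul_inv, div_eq_mul_inv]; ring
    rw [e, abs_mul, abs_mul, abs_of_nonneg h0]
    have h8 : |D y + κ * H y| ≤ 2 * K * q * E y := by
      refine (abs_add_le _ _).trans ?_
      have h9 : |κ * H y| ≤ K * q * E y := by
        rw [abs_mul]
        calc |κ| * |H y| ≤ q * (K * E y) := by
              gcongr
              · linarith
              · exact hHb y
          _ = _ := by ring
      linarith [hDb y]
    calc |D y - κ * H y| * |D y + κ * H y| * (g y)⁻¹
        ≤ (K * m * E y) * (2 * K * q * E y) * (g y)⁻¹ :=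
          mul_le_mul_of_nonneg_right (mul_le_mul (hDH y) h8 (abs_nonneg _)
            (mul_nonneg (by positivity) (hE0 y).le)) h0
      _ = 2 * K ^ 2 * (m * q) * (E y ^ 2 * (g y)⁻¹) := by ring
      _ ≤ 2 * K ^ 2 * (m * q) * (4 * Real.exp (-(5 / 12) * y ^ 2)) := by 
          exact mul_le_mul_of_nonneg_left (hEE y) (by positivity)
      _ = _ := by ring
  have i2 : Integrable fun y => D y ^ 2 / g y :=
    (hi₁.const_mul (4 * K ^ 2 * q ^ 2)).mono' ((hDm.pow_const 2).div hgm).aestronglyMeasurable (ae_of_all _ fun y => by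
      rw [Real.norm_eq_abs, abs_of_nonneg (div_nonneg (sq_nonneg _) (hg y).le)]; exact b2 y)
  have i3 : Integrable fun y => |D y| ^ 3 / g y ^ 2 :=
    (hi₂.const_mul (16 * K ^ 3 * q ^ 3)).mono'
      (((hDm.abs).pow_const 3).div (hgm.pow_const 2)).aestronglyMeasurable (ae_of_all _ fun y => by
      rw [Real.norm_eq_abs, abs_of_nonneg (by have := hg y; positivity)]; exact b3 y)
  have iH : Integrable fun y => H y ^ 2 / g y :=
    (hi₁.const_mul (4 * K ^ 2)).mono' ((hHm.pow_const 2).div hgm).aestronglyMeasurable (ae_of_all _ fun y => by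
      rw [Real.norm_eq_abs, abs_of_nonneg (div_nonneg (sq_nonneg _) (hg y).le)]; exact bH y)
  have hmain := abs_nonGaussianness_sub_le (by omega) hm (by linarith) hT i2 i3
  have hb3 : ∫ y, |D y| ^ 3 / g y ^ 2 ≤ 16 * K ^ 3 * q ^ 3 * I₂ := by
    rw [← integral_const_mul]
    exact integral_mono i3 (hi₂.const_mul _) b3
  have hb2 : |(∫ y, D y ^ 2 / g y) - gapCoeff j v * κ ^ 2| ≤ 8 * K ^ 2 * (m * q) * I₁ := by
    have e : (∫ y, D y ^ 2 / g y) - gapCoeff j v * κ ^ 2 =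
        ∫ y, (D y ^ 2 / g y - κ ^ 2 * (H y ^ 2 / g y)) := by
      rw [integral_sub i2 (iH.const_mul _), integral_const_mul, mul_comm]; rfl
    rw [e, ← integral_const_mul, ← Real.norm_eq_abs]
    refine (norm_integral_le_integral_norm _).trans ?_
    exact integral_mono (i2.sub (iH.const_mul _)).norm (hi₁.const_mul _) bdiff
  have hmain' : |nonGaussianness μ - (∫ y, D y ^ 2 / g y) / 2| ≤
      (∫ y, |D y| ^ 3 / g y ^ 2) + 6 * tailMoment (2 * j) μ := hmain
  have key : 0 ≤ 4 * K ^ 2 * I₁ * q ^ 3 + 16 * K ^ 3 * I₂ * (m * q) + (m * q + q ^ 3) := by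
    positivity
  rw [abs_le] at hmain' hb2 ⊢
  constructor <;> nlinarith

/-! ### The coefficient of the squared gap. -/

theorem continuous_iteratedDeriv_stdPdf (j : ℕ) : Continuous (iteratedDeriv j stdPdf) :=
  (contDiff_stdPdf (n := j)).continuous_iteratedDeriv j le_rfl

theorem exists_gapCoeff_integrand_le (j : ℕ) : ∃ C : ℝ, ∀ v : ℝ, 0 ≤ v → v ≤ 1 → ∀ y : ℝ,
    ‖(iteratedDeriv j stdPdf y / j.factorial * (-1) ^ j) ^ 2 / varPdf (1 + v) y‖ ≤
      C * Real.exp (-(5 / 12) * y ^ 2) := by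
  obtain ⟨c, hc, hd⟩ := exists_abs_iteratedDeriv_stdPdf_le j (δ := 1 / 24) (by norm_num)
  refine ⟨c ^ 2 * 4, fun v hv0 hv1 y => ?_⟩
  have hg := varPdf_pos (s := 1 + v) (by linarith) y
  rw [Real.norm_eq_abs, abs_of_nonneg (by positivity), ← sq_abs, div_eq_mul_inv]
  have h1 : |iteratedDeriv j stdPdf y / j.factorial * (-1) ^ j| ≤
      c * Real.exp (-(11 / 24) * y ^ 2) := by
    simp only [abs_mul, abs_div, abs_pow, abs_neg, abs_one, one_pow, mul_one, Nat.abs_cast]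
    have hf : (1 : ℝ) ≤ j.factorial := by
      exact_mod_cast Nat.one_le_iff_ne_zero.2 (Nat.factorial_ne_zero _)
    refine (div_le_self (abs_nonneg _) hf).trans ((hd y).trans (le_of_eq ?_))
    norm_num
  refine (mul_le_mul (pow_le_pow_left₀ (abs_nonneg _) h1 2)
    (inv_varPdf_le (by linarith) (by linarith) y) (inv_pos.2 hg).le
    (by positivity)).trans (le_of_eq ?_)
  rw [mul_pow, ← Real.exp_nat_mul, mul_assoc, mul_left_comm (Real.exp _), ← Real.exp_add, mul_assoc]
  congr 3; push_cast; ring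

theorem tendsto_gapCoeff (j : ℕ) : Tendsto (gapCoeff j) (𝓝[≥] 0) (𝓝 (gapCoeff j 0)) := by
  obtain ⟨C, hC⟩ := exists_gapCoeff_integrand_le j
  have hmem : Set.Icc (0 : ℝ) 1 ∈ 𝓝[≥] (0 : ℝ) := Icc_mem_nhdsGE (by norm_num)
  unfold gapCoeff
  refine tendsto_integral_filter_of_dominated_convergence
    (fun y => C * Real.exp (-(5 / 12) * y ^ 2)) ?_ ?_ ?_ ?_
  · refine Eventually.of_forall fun v => Measurable.aestronglyMeasurable ?_
    have h1 := (continuous_varPdf (1 + v)).measurable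
    have h2 := (continuous_iteratedDeriv_stdPdf j).measurable
    fun_prop
  · filter_upwards [hmem] with v hv
    exact ae_of_all _ (hC v hv.1 hv.2)
  · exact (integrable_exp_neg_mul_sq (by norm_num)).const_mul _
  · refine ae_of_all _ fun y => ?_
    have hca : ContinuousAt (fun v : ℝ => (iteratedDeriv j stdPdf y / j.factorial * (-1) ^ j) ^ 2 /
        varPdf (1 + v) y) 0 := by
      have h0 := (varPdf_pos (s := 1 + 0) (by norm_num) y).ne'
      refine ContinuousAt.div continuousAt_const ?_ h0
      unfold varPdf
      refine ContinuousAt.mul (ContinuousAt.inv₀ (by fun_prop) (by positivity)) ?_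
      refine Real.continuous_exp.continuousAt.comp (ContinuousAt.neg
        (ContinuousAt.div continuousAt_const (by fun_prop) (by norm_num)))
    exact hca.tendsto.mono_left nhdsWithin_le_nhds

/-- The integrand is continuous, nonnegative, and nonzero wherever the `j`-th Hermite polynomial is
nonzero. Orthogonality would give the value `1 / j!`, but positivity suffices. -/
theorem gapCoeff_zero_pos (j : ℕ) : 0 < gapCoeff j 0 := by
  obtain ⟨C, hC⟩ := exists_gapCoeff_integrand_le j
  have hg : ∀ y, 0 < varPdf (1 + 0) y := varPdf_pos (by norm_num)
  have hF : Continuous fun y => (iteratedDeriv j stdPdf y / j.factorial * (-1) ^ j) ^ 2 /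
      varPdf (1 + 0) y := by
    have := continuous_iteratedDeriv_stdPdf j
    exact Continuous.div (by fun_prop) (continuous_varPdf _) fun y => (hg y).ne'
  have hI : Integrable fun y => (iteratedDeriv j stdPdf y / j.factorial * (-1) ^ j) ^ 2 /
      varPdf (1 + 0) y :=
    ((integrable_exp_neg_mul_sq (by norm_num)).const_mul C).mono' hF.aestronglyMeasurable
      (ae_of_all _ (hC 0 le_rfl zero_le_one))
  unfold gapCoeff
  rw [integral_pos_iff_support_of_nonneg (fun y => div_nonneg (sq_nonneg _) (hg y).le) hI]
  refine hF.isOpen_support.measure_pos _ ?_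
  have hne : (Polynomial.hermite j).map (Int.castRingHom ℝ) ≠ 0 :=
    ((Polynomial.hermite_monic j).map _).ne_zero
  obtain ⟨x, hx⟩ : ∃ x, ((Polynomial.hermite j).map (Int.castRingHom ℝ)).eval x ≠ 0 := by
    by_contra! h
    exact hne (Polynomial.funext fun r => by simpa using h r)
  refine ⟨x, (div_pos (pow_pos (abs_pos.2 ?_) 2 |>.trans_eq (sq_abs _)) (hg x)).ne'⟩
  rw [iteratedDeriv_stdPdf]
  have hx' : Polynomial.aeval x (Polynomial.hermite j) ≠ 0 := by
    rwa [← Polynomial.eval_map_algebraMap]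
  have := Real.exp_pos (-(x ^ 2 / 2))
  have h1 : (-1 : ℝ) ^ j ≠ 0 := by positivity
  positivity

/-! ### Mutual information of additive channels -/

/-- Some ball has positive mass, so the smoothed density decays no faster than a multiple of `exp
(-y²)`. A finite second moment then makes entropies finite. -/
theorem exists_abs_log_dens_le (μ : Measure ℝ) [IsProbabilityMeasure μ] :
    ∃ K : ℝ, ∀ y, |Real.log (dens μ y)| ≤ K + y ^ 2 := by
  obtain ⟨n, hn⟩ : ∃ n : ℕ, 0 < μ {z : ℝ | |z| ≤ n} := by
    refine exists_measure_pos_of_not_measure_iUnion_null ?_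
    have : (⋃ n : ℕ, {z : ℝ | |z| ≤ n}) = Set.univ :=
      Set.eq_univ_of_forall fun z => Set.mem_iUnion.2 (exists_nat_ge |z|)
    rw [this]; simp
  have hr : 0 < μ.real {z : ℝ | |z| ≤ n} := ENNReal.toReal_pos hn.ne' (measure_ne_top _ _)
  set k := μ.real {z : ℝ | |z| ≤ n} * (√(2 * Real.pi))⁻¹ with hk
  have hk0 : 0 < k := by positivity
  have hA : MeasurableSet {z : ℝ | |z| ≤ n} := measurableSet_le (by fun_prop) (by fun_prop)
  refine ⟨|Real.log k| + (n : ℝ) ^ 2, fun y => ?_⟩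
  have h1 : k * Real.exp (-((n : ℝ) ^ 2 + y ^ 2)) ≤ dens μ y := by
    rw [hk, mul_assoc]
    refine (measureReal_mul_le_dens_restrict μ y n).trans ?_
    rw [← dens_restrict_add_dens_restrict_compl μ hA y]
    linarith [dens_nonneg (μ.restrict {z : ℝ | |z| ≤ n}ᶜ) y]
  have h2 := Real.log_le_log (by positivity) h1
  rw [Real.log_mul hk0.ne' (Real.exp_pos _).ne', Real.log_exp] at h2
  have h3 : Real.log (dens μ y) ≤ 0 := Real.log_nonpos (dens_nonneg _ _) (dens_le_one μ y)
  rw [abs_of_nonpos h3]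
  linarith [neg_abs_le (Real.log k)]

theorem dens_pos (μ : Measure ℝ) [IsProbabilityMeasure μ] (y : ℝ) : 0 < dens μ y := by
  have : 0 < ∫ z, stdPdf (y - z) ∂μ := by
    rw [integral_pos_iff_support_of_nonneg (fun z => (stdPdf_pos _).le) (integrable_stdPdf_sub μ y)]
    have : Function.support (fun z => stdPdf (y - z)) = Set.univ :=
      Set.eq_univ_of_forall fun z => (stdPdf_pos _).ne'
    rw [this]; simp
  exact this

@[fun_prop]
theorem measurable_log_dens (μ : Measure ℝ) [IsFiniteMeasure μ] :
    Measurable fun y => Real.log (dens μ y) :=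
  Real.measurable_log.comp (measurable_dens μ)

theorem integrable_log_dens {μ ρ : Measure ℝ} [IsProbabilityMeasure μ] [IsFiniteMeasure ρ]
    (h : Integrable (fun z => z ^ 2) ρ) : Integrable (fun y => Real.log (dens μ y)) ρ := by
  obtain ⟨K, hK⟩ := exists_abs_log_dens_le μ
  exact ((integrable_const K).add h).mono'
    (measurable_log_dens μ).aestronglyMeasurable (ae_of_all _ hK)

/-- `∫ f log f` for the density `f` of `μ ∗ 𝒩(0, 1)`. -/
noncomputable def negEntropy (μ : Measure ℝ) : ℝ := ∫ y, dens μ y * Real.log (dens μ y)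

/-- `I(X ; X + N) = h(X + N) - h(N)`. The joint law has density `f (y - x) / g y` with respect to
the product of the marginals, and the Gaussian component of `N` makes both `f` and `g` positive with
integrable logarithms. -/
theorem mutualInfo_self_add {Ω : Type*} [MeasurableSpace Ω] {P : Measure Ω}
    [IsProbabilityMeasure P] {X N : Ω → ℝ} (hX : Measurable X) (hN : Measurable N)
    (hXN : IndepFun X N P) {τ : Measure ℝ} [IsProbabilityMeasure τ]
    (hNl : P.map N = τ.conv (gaussianReal 0 1)) (hτ2 : Integrable (fun z => z ^ 2) τ) (hc2 : Integrable (fun z => z ^ 2) ((P.map X).conv τ)) :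
    mutualInfo P X (fun ω => X ω + N ω) =
      ENNReal.ofReal (negEntropy τ - negEntropy ((P.map X).conv τ)) := by
  set ν := P.map X with hν
  have : IsProbabilityMeasure ν := Measure.isProbabilityMeasure_map hX.aemeasurable
  have hY : P.map (fun ω => X ω + N ω) = (ν.conv τ).conv (gaussianReal 0 1) := by
    rw [Measure.conv_assoc, ← hNl]
    exact hXN.map_add_eq_map_conv_map₀ hX.aemeasurable hN.aemeasurable
  set f := dens τ with hf
  set g := dens (ν.conv τ) with hg
  have hf0 : ∀ y, 0 < f y := dens_pos τ
  have hg0 : ∀ y, 0 < g y := dens_pos _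
  have hfm : Measurable f := measurable_dens _
  have hgm : Measurable g := measurable_dens _
  set PY := P.map (fun ω => X ω + N ω) with hPY
  have hPYd : PY = volume.withDensity fun y => ENNReal.ofReal (g y) := by rw [hY, conv_std]
  have hNd : P.map N = volume.withDensity fun y => ENNReal.ofReal (f y) := by rw [hNl, conv_std]
  have : IsProbabilityMeasure PY := Measure.isProbabilityMeasure_map (hX.add hN).aemeasurable
  set J := P.map fun ω => (X ω, X ω + N ω) with hJ
  set ρ : ℝ × ℝ → ℝ≥0∞ := fun p => ENNReal.ofReal (f (p.2 - p.1) / g p.2) with hρ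
  have hρm : Measurable ρ := by
    refine Measurable.ennreal_ofReal ?_
    exact (hfm.comp (measurable_snd.sub measurable_fst)).div (hgm.comp measurable_snd)
  have hJd : J = (ν.prod PY).withDensity ρ := by
    have h0 : J = (ν.prod (P.map N)).map fun p => (p.1, p.1 + p.2) := by
      rw [hν, ← (indepFun_iff_map_prod_eq_prod_map_map hX.aemeasurable hN.aemeasurable).1 hXN,
        Measure.map_map (by fun_prop) (by fun_prop)]
      rfl
    ext s hs
    have hs1 : Measurable (s.indicator (1 : ℝ × ℝ → ℝ≥0∞)) := measurable_one.indicator hs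
    rw [withDensity_apply _ hs, ← lintegral_indicator hs, ← lintegral_indicator_one hs, h0,
      lintegral_map hs1 (by fun_prop), lintegral_prod _ (by fun_prop),
      lintegral_prod _ (hρm.indicator hs).aemeasurable]
    refine lintegral_congr fun x => ?_
    have hsx : Measurable fun y => s.indicator (1 : ℝ × ℝ → ℝ≥0∞) (x, y) :=
      hs1.comp measurable_prodMk_left
    have hsx' : Measurable fun y => s.indicator (1 : ℝ × ℝ → ℝ≥0∞) (x, x + y) :=
      hsx.comp (measurable_const_add x)
    simp only
    rw [hNd, hPYd, lintegral_withDensity_eq_lintegral_mul _ hfm.ennreal_ofReal hsx',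
      lintegral_withDensity_eq_lintegral_mul _ hgm.ennreal_ofReal
      (g := fun y => s.indicator ρ (x, y)) ((hρm.indicator hs).comp measurable_prodMk_left)]
    rw [← lintegral_add_left_eq_self (fun y => ((fun y => ENNReal.ofReal (g y)) *
      fun y => s.indicator ρ (x, y)) y) x]
    refine lintegral_congr fun n => ?_
    simp only [Pi.mul_apply]
    by_cases hmem : (x, x + n) ∈ s
    · rw [Set.indicator_of_mem hmem, Set.indicator_of_mem hmem, hρ, ← ENNReal.ofReal_mul (hg0 _).le,
        Pi.one_apply, mul_one]
      simp only [add_sub_cancel_left]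
      rw [mul_div_cancel₀ _ (hg0 _).ne']
    · rw [Set.indicator_of_notMem hmem, Set.indicator_of_notMem hmem, mul_zero, mul_zero]
  have hac : J ≪ ν.prod PY := by rw [hJd]; exact withDensity_absolutelyContinuous _ _
  have hllr : llr J (ν.prod PY) =ᵐ[J] fun p => Real.log (f (p.2 - p.1)) - Real.log (g p.2) := by
    have h1 : J.rnDeriv (ν.prod PY) =ᵐ[ν.prod PY] ρ := by
      rw [hJd]; exact Measure.rnDeriv_withDensity _ hρm
    filter_upwards [hac.ae_le h1] with p hp
    rw [llr, hp, hρ, ENNReal.toReal_ofReal (div_pos (hf0 _) (hg0 _)).le,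
      Real.log_div (hf0 _).ne' (hg0 _).ne']
  have hXYm : Measurable fun ω => (X ω, X ω + N ω) := by fun_prop
  have hLm : Measurable fun p : ℝ × ℝ => Real.log (f (p.2 - p.1)) - Real.log (g p.2) := by
    fun_prop
  have hIf : Integrable (fun y => Real.log (f y)) (P.map N) := by
    rw [hNl]; exact integrable_log_dens (integrable_sq_conv hτ2)
  have hIg : Integrable (fun y => Real.log (g y)) PY := by
    rw [hY]; exact integrable_log_dens (integrable_sq_conv hc2)
  have hIf' : Integrable (fun ω => Real.log (f (N ω))) P := hIf.comp_measurable hN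
  have hIg' : Integrable (fun ω => Real.log (g (X ω + N ω))) P := hIg.comp_measurable (hX.add hN)
  have hIL : Integrable (llr J (ν.prod PY)) J := by
    rw [integrable_congr hllr, hJ, integrable_map_measure hLm.aestronglyMeasurable hXYm.aemeasurable]
    refine (hIf'.sub hIg').congr (ae_of_all _ fun ω => ?_)
    simp [Function.comp]
  have hval : ∫ p, llr J (ν.prod PY) p ∂J = negEntropy τ - negEntropy (ν.conv τ) := by
    rw [integral_congr_ae hllr, hJ, integral_map hXYm.aemeasurable hLm.aestronglyMeasurable]
    simp only [add_sub_cancel_left]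
    rw [integral_sub hIf' hIg', negEntropy, negEntropy, integral_mul_dens, integral_mul_dens,
      ← hNl, ← hY, hPY, integral_map hN.aemeasurable
        (measurable_log_dens _).aestronglyMeasurable,
      integral_map (φ := fun ω => X ω + N ω) (hX.add hN).aemeasurable
        (measurable_log_dens _).aestronglyMeasurable]
  have : IsProbabilityMeasure J := Measure.isProbabilityMeasure_map hXYm.aemeasurable
  rw [mutualInfo, InformationTheory.klDiv_of_ac_of_integrable hac hIL, hval]
  simp

/-- The logarithm of a centred Gaussian density is an affine function of `y²`, so its mean under the
smoothed law depends on the second moment only. -/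
theorem nonGaussianness_eq (μ : Measure ℝ) [IsProbabilityMeasure μ]
    (h : Integrable (fun z => z ^ 2) μ) :
    nonGaussianness μ = negEntropy μ + Real.log (2 * Real.pi * (1 + ∫ z, z ^ 2 ∂μ)) / 2 + 1 / 2 := by
  set v := ∫ z, z ^ 2 ∂μ with hv
  have hv0 : 0 ≤ v := integral_nonneg fun z => sq_nonneg z
  have hlog : ∀ y, Real.log (varPdf (1 + v) y) =
      -(Real.log (2 * Real.pi * (1 + v)) / 2) - y ^ 2 * (2 * (1 + v))⁻¹ := by
    intro y
    have hpos : 0 < 2 * Real.pi * (1 + v) := by have := Real.pi_pos; positivity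
    rw [varPdf, Real.log_mul (by positivity) (Real.exp_pos _).ne', Real.log_exp, Real.log_inv,
      Real.log_sqrt hpos.le]
    ring
  have hI1 : Integrable fun y => dens μ y * Real.log (dens μ y) :=
    integrable_mul_dens (integrable_log_dens (integrable_sq_conv h))
  have hI2 := (integrable_dens μ).mul_const (Real.log (2 * Real.pi * (1 + v)) / 2)
  have hI3 := (integrable_sq_mul_dens h).mul_const (2 * (1 + v))⁻¹
  have e : ∀ y, dens μ y * (Real.log (dens μ y) - Real.log (varPdf (1 + v) y)) =
      dens μ y * Real.log (dens μ y) + dens μ y * (Real.log (2 * Real.pi * (1 + v)) / 2) +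
      dens μ y * y ^ 2 * (2 * (1 + v))⁻¹ := by
    intro y; rw [hlog]; ring
  unfold nonGaussianness
  rw [← hv]
  simp_rw [e]
  have hs1 := integral_add (hI1.add hI2) hI3
  simp only [Pi.add_apply] at hs1
  rw [hs1, integral_add hI1 hI2, integral_mul_const, integral_mul_const,
    integral_dens, integral_sq_mul_dens h, ← hv, probReal_univ, negEntropy]
  field_simp
  ring

/-- The data processing inequality, applied to the scaling and to its inverse. -/
theorem mutualInfo_map_equiv {Ω : Type*} [MeasurableSpace Ω] {P : Measure Ω}
    [IsProbabilityMeasure P] {X Y : Ω → ℝ} (hX : Measurable X) (hY : Measurable Y) {c d : ℝ}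
    (hc : c ≠ 0) (hd : d ≠ 0) :
    mutualInfo P (fun ω => c * X ω) (fun ω => d * Y ω) = mutualInfo P X Y := by
  have key : ∀ {X Y : Ω → ℝ} (_ : Measurable X) (_ : Measurable Y) (c d : ℝ),
      mutualInfo P (fun ω => c * X ω) (fun ω => d * Y ω) ≤ mutualInfo P X Y := by
    intro X Y hX hY c d
    have : IsProbabilityMeasure (P.map X) := Measure.isProbabilityMeasure_map hX.aemeasurable
    have : IsProbabilityMeasure (P.map Y) := Measure.isProbabilityMeasure_map hY.aemeasurable
    have h := InformationTheory.klDiv_map_le (P.map fun ω => (X ω, Y ω)) ((P.map X).prod (P.map Y))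
      (g := Prod.map (fun x : ℝ => c * x) (fun y : ℝ => d * y)) (by fun_prop)
    rw [Measure.map_map (by fun_prop) (by fun_prop), ← Measure.map_prod_map _ _ (by fun_prop) (by fun_prop),
      Measure.map_map (by fun_prop) hX, Measure.map_map (by fun_prop) hY] at h
    exact h
  refine le_antisymm (key hX hY c d) ?_
  have h := key (hX.const_mul c) (hY.const_mul d) c⁻¹ d⁻¹
  simpa only [inv_mul_cancel_left₀ hc, inv_mul_cancel_left₀ hd] using h

/-! ### Moments of convolutions and of scaled laws -/

theorem integrable_abs_pow_conv {μ ρ : Measure ℝ} [IsFiniteMeasure μ] [IsFiniteMeasure ρ] {m : ℕ}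
    (hμ : Integrable (fun z : ℝ => |z| ^ m) μ) (hρ : Integrable (fun z : ℝ => |z| ^ m) ρ) :
    Integrable (fun z : ℝ => |z| ^ m) (μ.conv ρ) := by
  rw [Measure.conv, integrable_map_measure (by fun_prop) (by fun_prop)]
  refine (((hμ.comp_fst ρ).add (hρ.comp_snd μ)).const_mul (2 ^ (m - 1))).mono' (by fun_prop)
    (ae_of_all _ fun p => ?_)
  simp only [Function.comp, Real.norm_eq_abs, abs_pow, abs_abs, Pi.add_apply]
  exact (pow_le_pow_left₀ (abs_nonneg _) (abs_add_le _ _) m).trans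
    (add_pow_le (abs_nonneg _) (abs_nonneg _) m)

theorem integral_pow_conv {μ ρ : Measure ℝ} [IsFiniteMeasure μ] [IsFiniteMeasure ρ] {n : ℕ}
    (hμ : ∀ i ≤ n, Integrable (fun z : ℝ => z ^ i) μ)
    (hρ : ∀ i ≤ n, Integrable (fun z : ℝ => z ^ i) ρ) :
    ∫ z, z ^ n ∂(μ.conv ρ) = ∑ i ∈ Finset.range (n + 1),
      (∫ z, z ^ i ∂μ) * (∫ z, z ^ (n - i) ∂ρ) * n.choose i := by
  rw [Measure.conv, integral_map (by fun_prop) (by fun_prop)]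
  simp_rw [add_pow]
  rw [integral_finsetSum]
  · refine Finset.sum_congr rfl fun i _ => ?_
    rw [integral_mul_const, integral_prod_mul (fun x : ℝ => x ^ i) (fun x : ℝ => x ^ (n - i))]
  · intro i hi
    exact ((hμ i (Nat.lt_succ_iff.1 (Finset.mem_range.1 hi))).mul_prod
      (hρ (n - i) (Nat.sub_le _ _))).mul_const _

theorem gaussMoment_add {v w : ℝ} (hv : 0 ≤ v) (hw : 0 ≤ w) (n : ℕ) :
    gaussMoment (v + w) n = ∑ i ∈ Finset.range (n + 1),
      gaussMoment v i * gaussMoment w (n - i) * n.choose i := by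
  have h := integral_pow_conv (n := n) (fun i _ => integrable_gaussianReal_pow v.toNNReal i)
    (fun i _ => integrable_gaussianReal_pow w.toNNReal i)
  rw [gaussianReal_conv_gaussianReal, add_zero, ← Real.toNNReal_add hv hw] at h
  exact h

theorem gaussMoment_zero (v : ℝ) : gaussMoment v 0 = 1 := by simp [gaussMoment]

theorem gaussMoment_one (v : ℝ) : gaussMoment v 1 = 0 := by simp [gaussMoment]

theorem gaussMoment_two {v : ℝ} (hv : 0 ≤ v) : gaussMoment v 2 = v := by
  rw [gaussMoment, integral_gaussianReal_sq]; simp [hv]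

theorem gaussMoment_sq_mul (c : ℝ) {v : ℝ} (hv : 0 ≤ v) (n : ℕ) :
    gaussMoment (c ^ 2 * v) n = c ^ n * gaussMoment v n := by
  have h : gaussianReal 0 (c ^ 2 * v).toNNReal = (gaussianReal 0 v.toNNReal).map (c * ·) := by
    rw [gaussianReal_map_const_mul, mul_zero]
    congr 1
    ext
    simp [hv, mul_nonneg (sq_nonneg c) hv]
  unfold gaussMoment
  rw [h, integral_map (by fun_prop) (by fun_prop)]
  simp_rw [mul_pow]
  rw [integral_const_mul]

theorem integral_sq_nonneg (μ : Measure ℝ) : 0 ≤ ∫ z, z ^ 2 ∂μ :=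
  integral_nonneg fun z => sq_nonneg z

theorem MatchesGauss.integral_eq_zero {j : ℕ} (hj : 2 ≤ j) {μ : Measure ℝ} (h : MatchesGauss j μ) :
    ∫ z, z ∂μ = 0 := by
  have := h 1 (by omega)
  simpa [gaussMoment_one] using this

theorem integral_sq_conv_of_centered {μ ρ : Measure ℝ} [IsProbabilityMeasure μ]
    [IsProbabilityMeasure ρ] (hμ : Integrable (fun z => z ^ 2) μ)
    (hρ : Integrable (fun z => z ^ 2) ρ) (h0 : ∫ z, z ∂μ = 0) :
    ∫ z, z ^ 2 ∂(μ.conv ρ) = ∫ z, z ^ 2 ∂μ + ∫ z, z ^ 2 ∂ρ := by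
  have h : ∀ {σ : Measure ℝ} [IsProbabilityMeasure σ], Integrable (fun z => z ^ 2) σ →
      ∀ i ≤ 2, Integrable (fun z : ℝ => z ^ i) σ := fun hσ i hi =>
    integrable_pow_of_le hi (by simpa using hσ)
  rw [integral_pow_conv (h hμ) (h hρ)]
  simp [Finset.sum_range_succ, h0, add_comm]

/-- In the binomial expansion of the `j`-th moment of a sum, every mixed term involves only moments
of order below `j`, which are Gaussian. Only the two extreme terms contribute, one gap each. For `j
≥ 3` the gap is the `j`-th cumulant. -/
theorem MatchesGauss.conv {j : ℕ} (hj : 2 ≤ j) {μ ρ : Measure ℝ} [IsProbabilityMeasure μ]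
    [IsProbabilityMeasure ρ] (hμ : Integrable (fun z : ℝ => |z| ^ j) μ)
    (hρ : Integrable (fun z : ℝ => |z| ^ j) ρ) (h1 : MatchesGauss j μ) (h2 : MatchesGauss j ρ) :
    MatchesGauss j (μ.conv ρ) ∧ gaussGap j (μ.conv ρ) = gaussGap j μ + gaussGap j ρ := by
  have hi1 : ∀ i ≤ j, Integrable (fun z : ℝ => z ^ i) μ := fun i hi => integrable_pow_of_le hi hμ
  have hi2 : ∀ i ≤ j, Integrable (fun z : ℝ => z ^ i) ρ := fun i hi => integrable_pow_of_le hi hρ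
  have hv := integral_sq_conv_of_centered (hi1 2 hj) (hi2 2 hj) (h1.integral_eq_zero hj)
  refine ⟨fun n hn => ?_, ?_⟩
  · rw [integral_pow_conv (fun i hi => hi1 i (by omega)) (fun i hi => hi2 i (by omega)), hv,
      gaussMoment_add (integral_sq_nonneg _) (integral_sq_nonneg _)]
    refine Finset.sum_congr rfl fun i hi => ?_
    rw [Finset.mem_range] at hi
    rw [h1 i (by omega), h2 (n - i) (by omega)]
  · unfold gaussGap
    rw [integral_pow_conv hi1 hi2, hv, gaussMoment_add (integral_sq_nonneg _) (integral_sq_nonneg _)]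
    obtain ⟨k, rfl⟩ : ∃ k, j = k + 1 := ⟨j - 1, by omega⟩
    have split : ∀ F : ℕ → ℝ, ∑ i ∈ Finset.range (k + 1 + 1), F i =
        ∑ i ∈ Finset.range k, F (i + 1) + F 0 + F (k + 1) := fun F => by
      rw [Finset.sum_range_succ, Finset.sum_range_succ']
    have hs : ∑ i ∈ Finset.range k, (∫ z, z ^ (i + 1) ∂μ) * (∫ z, z ^ (k + 1 - (i + 1)) ∂ρ) *
          ((k + 1).choose (i + 1) : ℝ) =
        ∑ i ∈ Finset.range k, gaussMoment (∫ z, z ^ 2 ∂μ) (i + 1) *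
          gaussMoment (∫ z, z ^ 2 ∂ρ) (k + 1 - (i + 1)) * ((k + 1).choose (i + 1) : ℝ) := by
      refine Finset.sum_congr rfl fun i hi => ?_
      rw [Finset.mem_range] at hi
      rw [h1 (i + 1) (by omega), h2 (k + 1 - (i + 1)) (by omega)]
    rw [split, split, hs]
    simp only [pow_zero, tsub_zero, tsub_self, gaussMoment_zero, Nat.choose_zero_right,
      Nat.choose_self, integral_const, probReal_univ, smul_eq_mul]
    ring

theorem integral_pow_map_mul (μ : Measure ℝ) (c : ℝ) (n : ℕ) :
    ∫ z, z ^ n ∂(μ.map (c * ·)) = c ^ n * ∫ z, z ^ n ∂μ := by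
  rw [integral_map (by fun_prop) (by fun_prop)]
  simp_rw [mul_pow]
  rw [integral_const_mul]

theorem MatchesGauss.map_mul {j : ℕ} {μ : Measure ℝ} (h : MatchesGauss j μ) (c : ℝ) :
    MatchesGauss j (μ.map (c * ·)) := by
  intro i hi
  rw [integral_pow_map_mul, integral_pow_map_mul, gaussMoment_sq_mul _ (integral_sq_nonneg _),
    h i hi]

theorem gaussGap_map_mul (j : ℕ) (μ : Measure ℝ) (c : ℝ) :
    gaussGap j (μ.map (c * ·)) = c ^ j * gaussGap j μ := by
  unfold gaussGap
  rw [integral_pow_map_mul, integral_pow_map_mul, gaussMoment_sq_mul _ (integral_sq_nonneg _)]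
  ring

theorem matchesGauss_dirac_zero (j : ℕ) :
    MatchesGauss j (Measure.dirac 0) ∧ gaussGap j (Measure.dirac 0) = 0 := by
  have h : ∀ i : ℕ, ∫ z : ℝ, z ^ i ∂(Measure.dirac 0) =
      gaussMoment (∫ z : ℝ, z ^ 2 ∂(Measure.dirac 0)) i := by
    intro i
    simp [gaussMoment]
  exact ⟨fun i _ => h i, sub_eq_zero.2 (h j)⟩

theorem gaussMoment_three (v : ℝ) : gaussMoment v 3 = 0 := by
  have h : (gaussianReal 0 v.toNNReal).map (fun x => -x) = gaussianReal 0 v.toNNReal := by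
    rw [gaussianReal_map_neg, neg_zero]
  have h1 : gaussMoment v 3 = - gaussMoment v 3 := by
    conv_lhs => rw [gaussMoment, ← h, integral_map (by fun_prop) (by fun_prop)]
    rw [gaussMoment, ← integral_neg]
    congr 1; ext x; ring
  linarith

theorem gaussMoment_four {v : ℝ} (hv : 0 ≤ v) : gaussMoment v 4 = 3 * v ^ 2 := by
  -- `𝒩(0, 1) ∗ 𝒩(0, 1)` is `𝒩(0, 1)` scaled by `√2`
  have h1 := gaussMoment_add (v := 1) (w := 1) (by norm_num) (by norm_num) 4
  have h2 := gaussMoment_sq_mul (√2) (v := 1) (by norm_num) 4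
  have h3 : (√2 : ℝ) ^ 4 = 4 := by
    have : (√2 : ℝ) ^ 4 = (√2 ^ 2) ^ 2 := by ring
    rw [this, Real.sq_sqrt (by norm_num)]; norm_num
  rw [Real.sq_sqrt (by norm_num), h3] at h2
  have e : (2 : ℝ) * 1 = 1 + 1 := by norm_num
  rw [e, h1] at h2
  simp [Finset.sum_range_succ, gaussMoment_zero, gaussMoment_one, gaussMoment_three,
    gaussMoment_two, Nat.choose] at h2
  have h4 : gaussMoment 1 4 = 3 := by linarith
  rw [gaussMoment_eq hv, h4]
  have : √v ^ 4 = (√v ^ 2) ^ 2 := by ring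
  rw [this, Real.sq_sqrt hv]; ring

/-- Mutual information over an additive channel whose noise has a Gaussian component. -/
theorem mutualInfo_self_add_eq {Ω : Type*} [MeasurableSpace Ω] {P : Measure Ω}
    [IsProbabilityMeasure P] {X N : Ω → ℝ} (hX : Measurable X) (hN : Measurable N)
    (hXN : IndepFun X N P) {τ : Measure ℝ} [IsProbabilityMeasure τ]
    (hNl : P.map N = τ.conv (gaussianReal 0 1)) (hX2 : Integrable (fun z => z ^ 2) (P.map X))
    (hX0 : ∫ z, z ∂(P.map X) = 0) (hτ2 : Integrable (fun z => z ^ 2) τ) :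
    mutualInfo P X (fun ω => X ω + N ω) =
      ENNReal.ofReal (Real.log (1 + (∫ z, z ^ 2 ∂(P.map X)) / (1 + ∫ z, z ^ 2 ∂τ)) / 2 -
        (nonGaussianness ((P.map X).conv τ) - nonGaussianness τ)) := by
  have : IsProbabilityMeasure (P.map X) := Measure.isProbabilityMeasure_map hX.aemeasurable
  have hc2 : Integrable (fun z => z ^ 2) ((P.map X).conv τ) := by
    have := integrable_abs_pow_conv (m := 2) (by simpa using hX2) (by simpa using hτ2)
    simpa using this
  rw [mutualInfo_self_add hX hN hXN hNl hτ2 hc2, nonGaussianness_eq _ hτ2, nonGaussianness_eq _ hc2,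
    integral_sq_conv_of_centered hX2 hτ2 hX0]
  congr 1
  have h1 := integral_sq_nonneg τ
  have h2 := integral_sq_nonneg (P.map X)
  set a := ∫ z, z ^ 2 ∂τ
  set b := ∫ z, z ^ 2 ∂(P.map X)
  have e : 1 + b / (1 + a) = (1 + (b + a)) / (1 + a) := by field_simp; ring
  rw [e, Real.log_div (by positivity) (by positivity), Real.log_mul (x := 2 * Real.pi) (y := 1 + a) (by positivity) (by positivity),
    Real.log_mul (x := 2 * Real.pi) (by positivity) (by positivity)]
  ring

/-! ### Asymptotics of the relative entropy for scaled laws -/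

/-- Laws whose moments of order less than `j` are Gaussian, and whose `2j`-th moments and tails are
controlled by `K` and `τ`. -/
structure HasMomentBounds (j : ℕ) (K : ℝ) (τ : ℝ → ℝ) (μ : Measure ℝ) : Prop where
  isProbabilityMeasure : IsProbabilityMeasure μ
  integrable : Integrable (fun z : ℝ => |z| ^ (2 * j)) μ
  matches_gauss : MatchesGauss j μ
  integral_le : ∫ z, |z| ^ (2 * j) ∂μ ≤ K
  tail_le : ∀ R, ∫ z in {z | |z| ≤ R}ᶜ, |z| ^ (2 * j) ∂μ ≤ τ R

theorem tailMoment_map_mul (m : ℕ) (μ : Measure ℝ) {c : ℝ} (hc : 0 < c) :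
    tailMoment m (μ.map (c * ·)) = c ^ m * ∫ z in {z | |z| ≤ c⁻¹}ᶜ, |z| ^ m ∂μ := by
  have h : (fun z : ℝ => c * z) ⁻¹' {z | |z| ≤ 1}ᶜ = {z | |z| ≤ c⁻¹}ᶜ := by
    ext z
    simp only [Set.mem_preimage, Set.mem_compl_iff, Set.mem_ofPred_eq, abs_mul, abs_of_pos hc,
      inv_eq_one_div, le_div_iff₀ hc, mul_comm]
  rw [tailMoment, setIntegral_map measurableSet_abs_le_one.compl (by fun_prop) (by fun_prop), h,
    ← integral_const_mul]
  simp_rw [abs_mul, mul_pow, abs_of_pos hc]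

theorem HasMomentBounds.integral_abs_pow_le {j : ℕ} {K : ℝ} {τ : ℝ → ℝ} {μ : Measure ℝ}
    (h : HasMomentBounds j K τ μ) {i : ℕ} (hi : i ≤ 2 * j) :
    Integrable (fun z : ℝ => |z| ^ i) μ ∧ ∫ z, |z| ^ i ∂μ ≤ K + 1 := by
  have := h.isProbabilityMeasure
  have hI : Integrable (fun z : ℝ => |z| ^ i) μ := by
    simpa only [Real.norm_eq_abs, abs_pow] using (integrable_pow_of_le hi h.integrable).norm
  refine ⟨hI, ?_⟩
  have h1 := integral_mono hI (h.integrable.add (integrable_const (1 : ℝ))) fun z => by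
    simp only [Pi.add_apply]
    rcases le_total |z| 1 with h1 | h1
    · exact (pow_le_one₀ (abs_nonneg _) h1).trans (by linarith [pow_nonneg (abs_nonneg z) (2 * j)])
    · exact (pow_le_pow_right₀ h1 hi).trans (by linarith)
  simp only [Pi.add_apply] at h1
  rw [integral_add h.integrable (integrable_const _)] at h1
  simp only [integral_const, probReal_univ, smul_eq_mul, mul_one] at h1
  linarith [h.integral_le]

/-- After scaling, the gap is `O(c^j)` and the remainder `m` is `O(c^(j+1))`, so their product and
the cubic term are `o(c^(2j))`. The tail is `c^(2j)` times the part of the `2j`-th moment beyond `1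
/ c`, again `o(c^(2j))`; this is where `2j` moments are spent. The threshold on `c` depends on `K`
and `τ` only, so the interference law may vary with the filter. -/
theorem eventually_abs_nonGaussianness_map_mul_sub_le {j : ℕ} (hj : 1 ≤ j) {K : ℝ} (hK : 0 ≤ K)
    {τ : ℝ → ℝ} (hτ : Tendsto τ atTop (𝓝 0)) {ε : ℝ} (hε : 0 < ε) :
    ∀ᶠ c : ℝ in 𝓝[>] 0, ∀ μ : Measure ℝ, HasMomentBounds j K τ μ →
      |nonGaussianness (μ.map (c * ·)) - gapCoeff j 0 * (c ^ j * gaussGap j μ) ^ 2 / 2| ≤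
        ε * c ^ (2 * j) := by
  obtain ⟨C, hC, hmain⟩ := exists_abs_nonGaussianness_sub_gap_le j hj
  set K₀ := K + 1 with hK₀
  have hK₀0 : 0 < K₀ := by positivity
  set K₂ := K₀ + (1 + K₀) ^ j * |gaussMoment 1 j| with hK₂
  set B₁ := K₀ + (1 + K₀) ^ (j + 1) + 1 with hB₁
  set B₂ := K₂ + B₁ with hB₂
  have hK₂0 : 0 ≤ K₂ := by positivity
  have hB₁0 : 0 ≤ B₁ := by positivity
  have hB₂0 : 0 ≤ B₂ := by positivity
  obtain ⟨r, hr, ha⟩ := Metric.tendsto_nhdsWithin_nhds.1 (tendsto_gapCoeff j) (ε / (2 * (K₂ ^ 2 + 1)))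
    (by positivity)
  have hid : Tendsto (fun c : ℝ => c) (𝓝[>] 0) (𝓝 0) := tendsto_id.mono_left nhdsWithin_le_nhds
  have e1 : ∀ᶠ c : ℝ in 𝓝[>] 0, 0 < c := self_mem_nhdsWithin
  have e2 : ∀ᶠ c : ℝ in 𝓝[>] 0, c < 1 := hid.eventually_lt_const one_pos
  have e3 : ∀ᶠ c : ℝ in 𝓝[>] 0, C * (B₁ * B₂ + B₂ ^ 3) * c < ε / 4 :=
    (by simpa using hid.const_mul (C * (B₁ * B₂ + B₂ ^ 3)) :
      Tendsto (fun c => C * (B₁ * B₂ + B₂ ^ 3) * c) (𝓝[>] 0) (𝓝 0)).eventually_lt_const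
      (by positivity)
  -- The Taylor error, the variation of `gapCoeff` and the tail term `6 T` each receive `ε / 4`;
  -- hence `ε / 24`.
  have e4 : ∀ᶠ c : ℝ in 𝓝[>] 0, τ c⁻¹ < min (1 / 2) (ε / 24) :=
    (hτ.comp tendsto_inv_nhdsGT_zero).eventually_lt_const (by positivity)
  have e5 : ∀ᶠ c : ℝ in 𝓝[>] 0, c ^ 2 * K₀ < min r (1 / 48) :=
    (by simpa using (hid.pow 2).mul_const K₀ :
      Tendsto (fun c => c ^ 2 * K₀) (𝓝[>] 0) (𝓝 0)).eventually_lt_const (by positivity)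
  filter_upwards [e1, e2, e3, e4, e5] with c hc0 hc1 hc3 hc4 hc5 μ hμ
  have := hμ.isProbabilityMeasure
  have hP : IsProbabilityMeasure (μ.map (c * ·)) :=
    Measure.isProbabilityMeasure_map (by fun_prop)
  set v := ∫ z, z ^ 2 ∂μ with hv
  have hv0 : 0 ≤ v := integral_sq_nonneg μ
  have hvK : v ≤ K₀ := by
    have := (hμ.integral_abs_pow_le (i := 2) (by omega)).2
    simpa using this
  have hvc : ∫ z, z ^ 2 ∂(μ.map (c * ·)) = c ^ 2 * v := integral_pow_map_mul μ c 2
  have hsv : √v ≤ 1 + K₀ := by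
    rw [Real.sqrt_le_left (by positivity)]; nlinarith
  have hmapI : Integrable (fun z : ℝ => |z| ^ (2 * j)) (μ.map (c * ·)) := by
    rw [integrable_map_measure (by fun_prop) (by fun_prop)]
    refine (hμ.integrable.const_mul (|c| ^ (2 * j))).congr (ae_of_all _ fun z => ?_)
    simp [Function.comp, abs_mul, mul_pow]
  set T := tailMoment (2 * j) (μ.map (c * ·)) with hT
  have hT0 : 0 ≤ T := tailMoment_nonneg _ _
  have hcj : 0 < c ^ (2 * j) := by positivity
  have hTle : T ≤ c ^ (2 * j) * min (1 / 2) (ε / 24) := by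
    rw [hT, tailMoment_map_mul _ _ hc0]
    exact mul_le_mul_of_nonneg_left ((hμ.tail_le _).trans hc4.le) hcj.le
  have hc2j : c ^ (2 * j) ≤ 1 := pow_le_one₀ hc0.le hc1.le
  have hT1 : T ≤ 1 / 2 := hTle.trans ((mul_le_of_le_one_left (by positivity) hc2j).trans
    (min_le_left _ _))
  have hT2 : 6 * T ≤ ε / 4 * c ^ (2 * j) := by
    have := mul_le_mul_of_nonneg_left (min_le_right (1 / 2 : ℝ) (ε / 24)) hcj.le
    linarith
  have hT3 : T ≤ c ^ (j + 1) := by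
    have h1 : c ^ (2 * j) ≤ c ^ (j + 1) := pow_le_pow_of_le_one hc0.le hc1.le (by omega)
    have h2 := mul_le_mul_of_nonneg_left (min_le_left (1 / 2 : ℝ) (ε / 24)) hcj.le
    linarith
  set m := ∫ z, |z| ^ (j + 1) ∂(μ.map (c * ·)) + √(c ^ 2 * v) ^ (j + 1) + T with hm
  have hm0 : 0 ≤ m := by
    have : 0 ≤ ∫ z, |z| ^ (j + 1) ∂(μ.map (c * ·)) := integral_nonneg fun z => by positivity
    positivity
  have hmle : m ≤ c ^ (j + 1) * B₁ := by
    have h1 : ∫ z, |z| ^ (j + 1) ∂(μ.map (c * ·)) ≤ c ^ (j + 1) * K₀ := by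
      rw [integral_map (by fun_prop) (by fun_prop)]
      simp_rw [abs_mul, mul_pow, abs_of_pos hc0]
      rw [integral_const_mul]
      exact mul_le_mul_of_nonneg_left (hμ.integral_abs_pow_le (by omega)).2 (by positivity)
    have h2 : √(c ^ 2 * v) ^ (j + 1) ≤ c ^ (j + 1) * (1 + K₀) ^ (j + 1) := by
      rw [Real.sqrt_mul (sq_nonneg c), Real.sqrt_sq hc0.le, mul_pow]
      gcongr
    rw [hB₁, mul_add, mul_add, mul_one]
    linarith
  have hgap : |gaussGap j μ| ≤ K₂ := by
    rw [gaussGap, ← hv, gaussMoment_eq hv0]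
    refine (abs_sub _ _).trans (add_le_add ?_ ?_)
    · rw [← Real.norm_eq_abs]
      refine (norm_integral_le_integral_norm _).trans ?_
      simp_rw [Real.norm_eq_abs, abs_pow]
      exact (hμ.integral_abs_pow_le (by omega)).2
    · rw [abs_mul, abs_of_nonneg (by positivity)]
      gcongr
  have hgapc : |c ^ j * gaussGap j μ| ≤ c ^ j * K₂ := by
    rw [abs_mul, abs_of_nonneg (by positivity)]; gcongr
  have hq : |c ^ j * gaussGap j μ| + m ≤ c ^ j * B₂ := by
    have h1 : c ^ (j + 1) * B₁ ≤ c ^ j * B₁ :=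
      mul_le_mul_of_nonneg_right (pow_le_pow_of_le_one hc0.le hc1.le (by omega)) hB₁0
    rw [hB₂, mul_add]; linarith
  have h := hmain (μ.map (c * ·)) hP hmapI (hμ.matches_gauss.map_mul c)
    (by
      rw [hvc]
      exact (mul_le_mul_of_nonneg_left hvK (by positivity)).trans (hc5.le.trans (min_le_right _ _))) hT1 m (by rw [hvc])
  rw [hvc, gaussGap_map_mul] at h
  have hacv : |gapCoeff j (c ^ 2 * v) - gapCoeff j 0| ≤ ε / (2 * (K₂ ^ 2 + 1)) := by
    have h0 : 0 ≤ c ^ 2 * v := by positivity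
    have := ha (x := c ^ 2 * v) h0 (by
      rw [Real.dist_eq, sub_zero, abs_of_nonneg h0]
      exact (mul_le_mul_of_nonneg_left hvK (by positivity)).trans_lt (hc5.trans_le (min_le_left _ _)))
    rw [Real.dist_eq] at this
    exact this.le
  have herr : C * (m * (|c ^ j * gaussGap j μ| + m) + (|c ^ j * gaussGap j μ| + m) ^ 3) ≤
      ε / 4 * c ^ (2 * j) := by
    have hq0 : 0 ≤ |c ^ j * gaussGap j μ| + m := by positivity
    have h1 : m * (|c ^ j * gaussGap j μ| + m) ≤ (c ^ (j + 1) * B₁) * (c ^ j * B₂) := by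
      gcongr
    have h2 : (|c ^ j * gaussGap j μ| + m) ^ 3 ≤ (c ^ j * B₂) ^ 3 := by gcongr
    have h3 : (c ^ j) ^ 3 ≤ c ^ (2 * j) * c := by
      rw [← pow_mul, ← pow_succ]; exact pow_le_pow_of_le_one hc0.le hc1.le (by omega)
    calc _ ≤ C * ((c ^ (j + 1) * B₁) * (c ^ j * B₂) + (c ^ j * B₂) ^ 3) := by gcongr
      _ = C * (c ^ (2 * j) * c * (B₁ * B₂) + (c ^ j) ^ 3 * B₂ ^ 3) := by
        rw [two_mul, pow_add, pow_succ]; ring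
      _ ≤ C * (c ^ (2 * j) * c * (B₁ * B₂) + (c ^ (2 * j) * c) * B₂ ^ 3) := by gcongr
      _ = (C * (B₁ * B₂ + B₂ ^ 3) * c) * c ^ (2 * j) := by ring
      _ ≤ _ := by gcongr
  have hlast : |gapCoeff j (c ^ 2 * v) * (c ^ j * gaussGap j μ) ^ 2 / 2 -
      gapCoeff j 0 * (c ^ j * gaussGap j μ) ^ 2 / 2| ≤ ε / 4 * c ^ (2 * j) := by
    have e : gapCoeff j (c ^ 2 * v) * (c ^ j * gaussGap j μ) ^ 2 / 2 -
      gapCoeff j 0 * (c ^ j * gaussGap j μ) ^ 2 / 2 =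
      (gapCoeff j (c ^ 2 * v) - gapCoeff j 0) * (gaussGap j μ ^ 2 * c ^ (2 * j) / 2) := by
      rw [two_mul, pow_add]; ring
    have h4 : gaussGap j μ ^ 2 ≤ K₂ ^ 2 := by
      rw [← sq_abs]; gcongr
    rw [e, abs_mul, abs_of_nonneg (a := gaussGap j μ ^ 2 * c ^ (2 * j) / 2) (by positivity)]
    calc _ ≤ ε / (2 * (K₂ ^ 2 + 1)) * ((K₂ ^ 2 + 1) * c ^ (2 * j) / 2) := by
          gcongr
          linarith
      _ = _ := by field_simp; ring
  rw [abs_le] at h hlast ⊢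
  constructor <;> linarith

/-! ### Random series of independent inputs -/

/-- The law of an i.i.d. sequence of law `ν`. -/
noncomputable abbrev iidLaw (ν : Measure ℝ) : Measure (ℕ → ℝ) := Measure.infinitePi fun _ : ℕ => ν

/-- The series `∑ β_k |x_k|`, which dominates the interference. -/
noncomputable def envelope (β : ℕ → ℝ) (x : ℕ → ℝ) : ℝ := ∑' k, β k * |x k|

theorem eLpNorm_eval_iidLaw (ν : Measure ℝ) [IsProbabilityMeasure ν] (p : ℝ≥0∞) (k : ℕ) :
    eLpNorm (fun x : ℕ → ℝ => x k) p (iidLaw ν) = eLpNorm (fun z : ℝ => z) p ν :=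
  eLpNorm_comp_measurePreserving (f := fun x : ℕ → ℝ => x k) (g := fun z : ℝ => z)
    (by fun_prop) (measurePreserving_eval_infinitePi (fun _ : ℕ => ν) k)

theorem measurable_mul_abs_eval (r : ℝ) (k : ℕ) : Measurable fun x : ℕ → ℝ => r * |x k| := by
  fun_prop

theorem ae_summable_envelope {ν : Measure ℝ} [IsProbabilityMeasure ν]
    (hν : Integrable (fun z : ℝ => z) ν) {β : ℕ → ℝ} (hβ0 : ∀ k, 0 ≤ β k) (hβ : Summable β) :
    ∀ᵐ x ∂(iidLaw ν), Summable fun k => β k * |x k| := by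
  have h1 : ∀ k, ∫⁻ x : ℕ → ℝ, ENNReal.ofReal (β k * |x k|) ∂(iidLaw ν) =
      ENNReal.ofReal (β k) * ∫⁻ z, ENNReal.ofReal |z| ∂ν := by
    intro k
    simp_rw [ENNReal.ofReal_mul (hβ0 k)]
    rw [lintegral_const_mul _ (by fun_prop)]
    congr 1
    exact (measurePreserving_eval_infinitePi (fun _ : ℕ => ν) k).lintegral_comp
      (f := fun z => ENNReal.ofReal |z|) (by fun_prop)
  have h2 : ∫⁻ z, ENNReal.ofReal |z| ∂ν ≠ ∞ := by
    have := hν.norm.lintegral_lt_top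
    simpa using this.ne
  have h3 : ∫⁻ x : ℕ → ℝ, ∑' k, ENNReal.ofReal (β k * |x k|) ∂(iidLaw ν) ≠ ∞ := by
    rw [lintegral_tsum fun k => (measurable_mul_abs_eval (β k) k).ennreal_ofReal.aemeasurable]
    simp_rw [h1]
    rw [ENNReal.tsum_mul_right]
    refine ENNReal.mul_ne_top ?_ h2
    rw [← ENNReal.ofReal_tsum_of_nonneg hβ0 hβ]
    exact ENNReal.ofReal_ne_top
  filter_upwards [ae_lt_top (Measurable.tsum fun k =>
    (measurable_mul_abs_eval (β k) k).ennreal_ofReal) h3] with x hx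
  have := ENNReal.summable_toReal hx.ne
  refine this.congr fun k => ?_
  rw [ENNReal.toReal_ofReal (mul_nonneg (hβ0 k) (abs_nonneg _))]

theorem measurable_envelope (β : ℕ → ℝ) : Measurable (envelope β) := by
  unfold envelope
  exact Measurable.tsum fun k => by fun_prop

/-- Minkowski's inequality bounds the partial sums in `L^m` uniformly, and Fatou's lemma passes to
the limit. -/
theorem integrable_envelope_pow {ν : Measure ℝ} [IsProbabilityMeasure ν] {m : ℕ} (hm : 1 ≤ m)
    (hν : MemLp (fun z : ℝ => z) m ν) {β : ℕ → ℝ} (hβ0 : ∀ k, 0 ≤ β k) (hβ : Summable β) :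
    Integrable (fun x => |envelope β x| ^ m) (iidLaw ν) := by
  have hm1 : (1 : ℝ≥0∞) ≤ m := by exact_mod_cast hm
  have hlim : ∀ᵐ x ∂(iidLaw ν), Tendsto (fun n => ∑ k ∈ Finset.range n, β k * |x k|) atTop
      (𝓝 (envelope β x)) := by
    filter_upwards [ae_summable_envelope (hν.integrable hm1) hβ0 hβ] with x hx
    exact hx.hasSum.tendsto_sum_nat
  have hbound : ∀ n, eLpNorm (fun x : ℕ → ℝ => ∑ k ∈ Finset.range n, β k * |x k|) m (iidLaw ν) ≤
      ENNReal.ofReal (∑' k, β k) * eLpNorm (fun z : ℝ => z) m ν := by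
    intro n
    have e : (fun x : ℕ → ℝ => ∑ k ∈ Finset.range n, β k * |x k|) =
        ∑ k ∈ Finset.range n, fun x : ℕ → ℝ => β k * |x k| := by ext x; simp
    rw [e]
    refine (eLpNorm_sum_le (fun k _ => (measurable_mul_abs_eval (β k) k).aestronglyMeasurable) hm1).trans ?_
    have h1 : ∀ k, eLpNorm (fun x : ℕ → ℝ => β k * |x k|) m (iidLaw ν) =
        ENNReal.ofReal (β k) * eLpNorm (fun z : ℝ => z) m ν := by
      intro k
      have h2 := eLpNorm_const_smul (β k) (fun x : ℕ → ℝ => |x k|) m (iidLaw ν)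
      have h3 : eLpNorm (fun x : ℕ → ℝ => |x k|) m (iidLaw ν) = eLpNorm (fun z : ℝ => z) m ν := by
        rw [← eLpNorm_eval_iidLaw ν m k]
        exact eLpNorm_norm (fun x : ℕ → ℝ => x k)
      rw [h3, Real.enorm_of_nonneg (hβ0 k)] at h2
      exact h2
    simp_rw [h1]
    rw [← Finset.sum_mul, ← ENNReal.ofReal_sum_of_nonneg fun k _ => hβ0 k]
    gcongr
    exact hβ.sum_le_tsum _ fun k _ => hβ0 k
  have hmem : MemLp (envelope β) m (iidLaw ν) := by
    refine ⟨(measurable_envelope β).aestronglyMeasurable, ?_⟩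
    refine (Lp.eLpNorm_lim_le_liminf_eLpNorm (fun n => (Finset.measurable_sum _ fun k _ =>
      measurable_mul_abs_eval (β k) k).aestronglyMeasurable) _ hlim).trans_lt ?_
    refine lt_of_le_of_lt (liminf_le_of_le (by isBoundedDefault) fun b hb => ?_)
      (ENNReal.mul_lt_top (ENNReal.ofReal_lt_top (r := ∑' k, β k)) hν.eLpNorm_lt_top)
    obtain ⟨n, hn⟩ := hb.exists
    exact hn.trans (hbound n)
  simpa using hmem.integrable_norm_pow'

/-! ### Uniform moment bounds by domination. -/

section dominated

variable {Ω : Type*} [MeasurableSpace Ω] {P : Measure Ω} {D : Ω → ℝ}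

theorem integrable_abs_pow_map_of_dominated {Y : Ω → ℝ} (hY : Measurable Y) {m : ℕ}
    (hD : Integrable (fun ω => |D ω| ^ m) P) (hYD : ∀ᵐ ω ∂P, |Y ω| ≤ |D ω|) :
    Integrable (fun z : ℝ => |z| ^ m) (P.map Y) := by
  rw [integrable_map_measure (by fun_prop) hY.aemeasurable]
  refine hD.mono' (by fun_prop) ?_
  filter_upwards [hYD] with ω hω
  simp only [Function.comp, Real.norm_eq_abs, abs_pow, abs_abs]
  exact pow_le_pow_left₀ (abs_nonneg _) hω m

/-- The moment bound and the tail function come from `D` alone, so they serve every `Y` that `D`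
dominates. -/
theorem HasMomentBounds.of_dominated [IsProbabilityMeasure P] (hDm : Measurable D) {Y : Ω → ℝ} (hY : Measurable Y) {j : ℕ}
    (hD : Integrable (fun ω => |D ω| ^ (2 * j)) P) (hYD : ∀ᵐ ω ∂P, |Y ω| ≤ |D ω|)
    (hM : MatchesGauss j (P.map Y)) :
    HasMomentBounds j (∫ ω, |D ω| ^ (2 * j) ∂P) (fun R => ∫ ω in {ω | |D ω| ≤ R}ᶜ, |D ω| ^ (2 * j) ∂P)
      (P.map Y) := by
  have hI := integrable_abs_pow_map_of_dominated hY hD hYD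
  have hI' : Integrable (fun ω => |Y ω| ^ (2 * j)) P := by
    rwa [integrable_map_measure (by fun_prop) hY.aemeasurable] at hI
  have hle : ∀ᵐ ω ∂P, |Y ω| ^ (2 * j) ≤ |D ω| ^ (2 * j) := by
    filter_upwards [hYD] with ω hω using pow_le_pow_left₀ (abs_nonneg _) hω _
  refine ⟨Measure.isProbabilityMeasure_map hY.aemeasurable, hI, hM, ?_, fun R => ?_⟩
  · rw [integral_map hY.aemeasurable (by fun_prop)]
    exact integral_mono_ae hI' hD hle
  · have hR : MeasurableSet {z : ℝ | |z| ≤ R}ᶜ :=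
      (measurableSet_le (by fun_prop) (by fun_prop)).compl
    have hR' : MeasurableSet {ω | |D ω| ≤ R}ᶜ :=
      (measurableSet_le (by fun_prop) (by fun_prop)).compl
    rw [setIntegral_map hR (by fun_prop) hY.aemeasurable, ← integral_indicator (hY hR),
      ← integral_indicator hR']
    refine integral_mono_ae (hI'.indicator (hY hR)) (hD.indicator hR') ?_
    filter_upwards [hYD, hle] with ω h1 h2
    by_cases h : ω ∈ Y ⁻¹' {z | |z| ≤ R}ᶜ
    · have h' : ω ∈ {ω | |D ω| ≤ R}ᶜ := by
        simp only [Set.mem_preimage, Set.mem_compl_iff, Set.mem_ofPred_eq, not_le] at h ⊢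
        linarith
      rwa [Set.indicator_of_mem h, Set.indicator_of_mem h']
    · rw [Set.indicator_of_notMem h]
      exact Set.indicator_nonneg (fun ω _ => by positivity) ω

theorem tendsto_setIntegral_compl_le {m : ℕ} (hDm : Measurable D)
    (hD : Integrable (fun ω => |D ω| ^ m) P) :
    Tendsto (fun R : ℝ => ∫ ω in {ω | |D ω| ≤ R}ᶜ, |D ω| ^ m ∂P) atTop (𝓝 0) := by
  have hR' : ∀ R : ℝ, MeasurableSet {ω | |D ω| ≤ R}ᶜ := fun R =>
    (measurableSet_le (by fun_prop) (by fun_prop)).compl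
  simp_rw [← fun R : ℝ => integral_indicator (μ := P) (f := fun ω => |D ω| ^ m) (hR' R)]
  rw [← integral_zero Ω ℝ (μ := P)]
  refine tendsto_integral_filter_of_dominated_convergence (fun ω => |D ω| ^ m)
    (Eventually.of_forall fun R => (hD.indicator (hR' R)).aestronglyMeasurable)
    (Eventually.of_forall fun R => ae_of_all _ fun ω => ?_) hD (ae_of_all _ fun ω => ?_)
  · refine (norm_indicator_le_norm_self _ _).trans (le_of_eq ?_)
    simp
  · refine tendsto_const_nhds.congr' ?_
    filter_upwards [eventually_ge_atTop |D ω|] with R hR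
    rw [Set.indicator_of_notMem]
    simpa using hR

/-- The moment conditions pass to dominated limits. -/
theorem MatchesGauss.of_tendsto [IsProbabilityMeasure P] {Y : ℕ → Ω → ℝ} {Z : Ω → ℝ} (hY : ∀ n, Measurable (Y n))
    (hZ : Measurable Z) {j : ℕ} (hj : 2 ≤ j) (hD : Integrable (fun ω => |D ω| ^ j) P)
    (hYD : ∀ᵐ ω ∂P, ∀ n, |Y n ω| ≤ |D ω|)
    (hlim : ∀ᵐ ω ∂P, Tendsto (fun n => Y n ω) atTop (𝓝 (Z ω)))
    (hM : ∀ n, MatchesGauss j (P.map (Y n))) {g : ℝ}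
    (hg : Tendsto (fun n => gaussGap j (P.map (Y n))) atTop (𝓝 g)) :
    MatchesGauss j (P.map Z) ∧ gaussGap j (P.map Z) = g ∧
      Tendsto (fun n => ∫ z, z ^ 2 ∂(P.map (Y n))) atTop (𝓝 (∫ z, z ^ 2 ∂(P.map Z))) := by
  have hmom : ∀ i ≤ j, Tendsto (fun n => ∫ z, z ^ i ∂(P.map (Y n))) atTop
      (𝓝 (∫ z, z ^ i ∂(P.map Z))) := by
    intro i hi
    rw [integral_map hZ.aemeasurable (by fun_prop)]
    simp_rw [fun n => integral_map (μ := P) (hY n).aemeasurable (f := fun z : ℝ => z ^ i) (by fun_prop)]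
    refine tendsto_integral_of_dominated_convergence (fun ω => |D ω| ^ j + 1) (fun n => by fun_prop)
      (hD.add (integrable_const _)) (fun n => ?_) ?_
    · filter_upwards [hYD] with ω hω
      rw [Real.norm_eq_abs, abs_pow]
      refine (pow_le_pow_left₀ (abs_nonneg _) (hω n) i).trans ?_
      rcases le_total |D ω| 1 with h1 | h1
      · exact (pow_le_one₀ (abs_nonneg _) h1).trans (by linarith [pow_nonneg (abs_nonneg (D ω)) j])
      · exact (pow_le_pow_right₀ h1 hi).trans (by linarith)
    · filter_upwards [hlim] with ω hω using hω.pow i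
  have hG : ∀ i, Tendsto (fun n => gaussMoment (∫ z, z ^ 2 ∂(P.map (Y n))) i) atTop
      (𝓝 (gaussMoment (∫ z, z ^ 2 ∂(P.map Z)) i)) := by
    intro i
    simp_rw [gaussMoment_eq (integral_sq_nonneg _)]
    exact (((Real.continuous_sqrt.tendsto _).comp (hmom 2 hj)).pow i).mul_const _
  refine ⟨fun i hi => ?_, ?_, hmom 2 hj⟩
  · refine tendsto_nhds_unique (hmom i hi.le) ?_
    simp_rw [hM _ i hi]
    exact hG i
  · exact tendsto_nhds_unique ((hmom j le_rfl).sub (hG j)) hg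

end dominated

/-! ### Convergence, moments and independence of the interference series. -/

theorem measurable_interference (α : ℕ → ℝ) : Measurable (interference α) := by
  unfold interference
  exact (StronglyMeasurable.limUnder fun n => Measurable.stronglyMeasurable (by fun_prop)).measurable

/-- Almost sure absolute convergence makes `limUnder` a genuine limit. The series starts at `k = 1`,
so the zeroth term of the envelope stays free and can dominate `x₀` at the same time. -/
theorem ae_interference {ν : Measure ℝ} [IsProbabilityMeasure ν]
    (hν : Integrable (fun z : ℝ => z) ν) {α β : ℕ → ℝ} (hβ : Summable β)
    (hα : ∀ k, |α k| ≤ β k) :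
    ∀ᵐ x ∂(iidLaw ν), Tendsto (fun n => ∑ k ∈ Finset.range n, α (k + 1) * x (k + 1)) atTop
        (𝓝 (interference α x)) ∧
      (∀ n, |∑ k ∈ Finset.range n, α (k + 1) * x (k + 1)| ≤ |envelope β x|) ∧
      β 0 * |x 0| + |interference α x| ≤ |envelope β x| := by
  have hβ0 : ∀ k, 0 ≤ β k := fun k => (abs_nonneg _).trans (hα k)
  filter_upwards [ae_summable_envelope hν hβ0 hβ] with x hx
  have hx0 : ∀ k, 0 ≤ β k * |x k| := fun k => mul_nonneg (hβ0 k) (abs_nonneg _)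
  have hD : envelope β x ≤ |envelope β x| := le_abs_self _
  have hle : ∀ k, ‖α (k + 1) * x (k + 1)‖ ≤ β (k + 1) * |x (k + 1)| := fun k => by
    rw [Real.norm_eq_abs, abs_mul]
    exact mul_le_mul_of_nonneg_right (hα _) (abs_nonneg _)
  have hs1 : Summable fun k => β (k + 1) * |x (k + 1)| := (summable_nat_add_iff 1).2 hx
  have hs : Summable fun k => α (k + 1) * x (k + 1) := hs1.of_norm_bounded hle
  have hlim := hs.hasSum.tendsto_sum_nat
  have hpart : ∀ n, |∑ k ∈ Finset.range n, α (k + 1) * x (k + 1)| ≤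
      |envelope β x| - β 0 * |x 0| := by
    intro n
    refine (Finset.abs_sum_le_sum_abs _ _).trans (le_trans ?_ (sub_le_sub_right hD _))
    refine (Finset.sum_le_sum fun k _ => hle k).trans ?_
    refine (hs1.sum_le_tsum _ fun k _ => hx0 _).trans ?_
    have := hx.tsum_eq_zero_add
    unfold envelope
    rw [this]
    linarith [hx0 0]
  have hint : interference α x = ∑' k, α (k + 1) * x (k + 1) := hlim.limUnder_eq
  rw [hint]
  refine ⟨hlim, fun n => by linarith [hpart n, hx0 0], ?_⟩
  linarith [le_of_tendsto hlim.abs (Eventually.of_forall hpart)]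

theorem iIndepFun_eval_iidLaw (ν : Measure ℝ) [IsProbabilityMeasure ν] :
    iIndepFun (fun (k : ℕ) (x : ℕ → ℝ) => x k) (iidLaw ν) :=
  iIndepFun_infinitePi (X := fun _ z => z) fun _ => measurable_id

theorem map_partialSum_iidLaw {ν : Measure ℝ} [IsProbabilityMeasure ν] {j : ℕ} (hj : 2 ≤ j)
    (hν : Integrable (fun z : ℝ => |z| ^ j) ν) (hM : MatchesGauss j ν) (α : ℕ → ℝ) (n : ℕ) :
    Integrable (fun z : ℝ => |z| ^ j)
      ((iidLaw ν).map fun x => ∑ k ∈ Finset.range n, α (k + 1) * x (k + 1)) ∧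
    MatchesGauss j ((iidLaw ν).map fun x => ∑ k ∈ Finset.range n, α (k + 1) * x (k + 1)) ∧
    gaussGap j ((iidLaw ν).map fun x => ∑ k ∈ Finset.range n, α (k + 1) * x (k + 1)) =
      gaussGap j ν * ∑ k ∈ Finset.range n, α (k + 1) ^ j ∧
    ∫ z, z ^ 2 ∂((iidLaw ν).map fun x => ∑ k ∈ Finset.range n, α (k + 1) * x (k + 1)) =
      (∫ z, z ^ 2 ∂ν) * ∑ k ∈ Finset.range n, α (k + 1) ^ 2 := by
  induction n with
  | zero =>
    simp only [Finset.range_zero, Finset.sum_empty, Measure.map_const, measure_univ, one_smul,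
      mul_zero]
    exact ⟨integrable_dirac (by simp), (matchesGauss_dirac_zero j).1, (matchesGauss_dirac_zero j).2,
      by simp⟩
  | succ n ih =>
    set S : (ℕ → ℝ) → ℝ := fun x => ∑ k ∈ Finset.range n, α (k + 1) * x (k + 1) with hS
    have hSm : Measurable S := by fun_prop
    have hterm : (iidLaw ν).map (fun x => α (n + 1) * x (n + 1)) = ν.map (α (n + 1) * ·) := by
      have h0 := Measure.infinitePi_map_eval (fun _ : ℕ => ν) (n + 1)
      conv_rhs => rw [← h0, Measure.map_map (by fun_prop) (by fun_prop)]
      rfl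
    have hind : IndepFun S (fun x : ℕ → ℝ => α (n + 1) * x (n + 1)) (iidLaw ν) := by
      have h1 : iIndepFun (fun (k : ℕ) (x : ℕ → ℝ) => α (k + 1) * x (k + 1)) (iidLaw ν) :=
        ((iIndepFun_eval_iidLaw ν).precomp (g := fun k => k + 1) (add_left_injective 1)).comp
          (fun k z => α (k + 1) * z) fun k => by fun_prop
      have h2 := h1.indepFun_sum_range_succ (fun k => by fun_prop) n
      have e : (∑ k ∈ Finset.range n, fun x : ℕ → ℝ => α (k + 1) * x (k + 1)) = S := by
        ext x; simp [hS]
      rwa [e] at h2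
    have hlaw : (iidLaw ν).map (fun x => ∑ k ∈ Finset.range (n + 1), α (k + 1) * x (k + 1)) =
        ((iidLaw ν).map S).conv (ν.map (α (n + 1) * ·)) := by
      rw [← hterm, ← hind.map_add_eq_map_conv_map hSm (by fun_prop)]
      congr 1
      ext x
      simp [hS, Finset.sum_range_succ]
    have hP1 : IsProbabilityMeasure ((iidLaw ν).map S) :=
      Measure.isProbabilityMeasure_map hSm.aemeasurable
    have hP2 : IsProbabilityMeasure (ν.map (α (n + 1) * ·)) :=
      Measure.isProbabilityMeasure_map (by fun_prop)
    have hI2 : Integrable (fun z : ℝ => |z| ^ j) (ν.map (α (n + 1) * ·)) := by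
      rw [integrable_map_measure (by fun_prop) (by fun_prop)]
      refine (hν.const_mul (|α (n + 1)| ^ j)).congr (ae_of_all _ fun z => ?_)
      simp [Function.comp, abs_mul, mul_pow]
    obtain ⟨h1, h2⟩ := MatchesGauss.conv hj ih.1 hI2 ih.2.1 (hM.map_mul _)
    rw [hlaw]
    refine ⟨integrable_abs_pow_conv ih.1 hI2, h1, ?_, ?_⟩
    · rw [h2, ih.2.2.1, gaussGap_map_mul, Finset.sum_range_succ]
      ring
    · rw [integral_sq_conv_of_centered (integrable_pow_of_le hj ih.1) (integrable_pow_of_le hj hI2)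
        (ih.2.1.integral_eq_zero hj), ih.2.2.2, integral_pow_map_mul, Finset.sum_range_succ]
      ring

theorem indepFun_eval_zero_shift (ν : Measure ℝ) [IsProbabilityMeasure ν] :
    IndepFun (fun x : ℕ → ℝ => x 0) (fun x k => x (k + 1)) (iidLaw ν) := by
  refine IndepFun.indepFun_process (by fun_prop) (fun k => by fun_prop) fun I => ?_
  have h := (iIndepFun_eval_iidLaw ν).indepFun_finset {0} (I.image (· + 1)) (by simp)
    fun k => by fun_prop
  exact h.comp (φ := fun z : ({0} : Finset ℕ) → ℝ => z ⟨0, by simp⟩)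
    (ψ := fun (z : I.image (· + 1) → ℝ) (i : I) => z ⟨(i : ℕ) + 1, Finset.mem_image.2 ⟨i, i.2, rfl⟩⟩)
    (measurable_pi_apply _) (measurable_pi_lambda _ fun i => measurable_pi_apply _)

/-- The interference is a measurable function of the shifted sequence, which does not contain `x₀`.
-/
theorem indepFun_eval_zero_interference (ν : Measure ℝ) [IsProbabilityMeasure ν] (α : ℕ → ℝ) :
    IndepFun (fun x : ℕ → ℝ => x 0) (interference α) (iidLaw ν) := by
  have hm : Measurable fun x : ℕ → ℝ => limUnder atTop fun n : ℕ =>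
      ∑ k ∈ Finset.range n, α (k + 1) * x k :=
    (StronglyMeasurable.limUnder fun n => Measurable.stronglyMeasurable (by fun_prop)).measurable
  exact (indepFun_eval_zero_shift ν).comp measurable_id hm

/-! ### The interference law and the comparison of relative entropies -/

theorem summable_pow_of_abs_le {α β : ℕ → ℝ} (hβ : Summable β) (hα : ∀ k, |α k| ≤ β k) {j : ℕ}
    (hj : 1 ≤ j) : Summable fun k => α k ^ j := by
  refine hβ.of_norm_bounded_eventually_nat ?_
  filter_upwards [hβ.tendsto_atTop_zero.eventually (eventually_le_nhds zero_lt_one)] with k hk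
  rw [Real.norm_eq_abs, abs_pow]
  exact (pow_le_of_le_one (abs_nonneg _) ((hα k).trans hk) (by omega)).trans (hα k)

theorem integrable_abs_pow_interference {ν : Measure ℝ} [IsProbabilityMeasure ν] {j : ℕ}
    (hj : 1 ≤ j) (hν : MemLp (fun z : ℝ => z) j ν) {α β : ℕ → ℝ} (hβ : Summable β)
    (hα : ∀ k, |α k| ≤ β k) :
    Integrable (fun z : ℝ => |z| ^ j) ((iidLaw ν).map (interference α)) := by
  have hβ0 : ∀ k, 0 ≤ β k := fun k => (abs_nonneg _).trans (hα k)
  refine integrable_abs_pow_map_of_dominated (D := envelope β) (measurable_interference α)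
    (integrable_envelope_pow hj hν hβ0 hβ) ?_
  filter_upwards [ae_interference (hν.integrable (by exact_mod_cast hj)) hβ hα] with x hx
  linarith [hx.2.2, mul_nonneg (hβ0 0) (abs_nonneg (x 0))]

theorem matchesGauss_interference {ν : Measure ℝ} [IsProbabilityMeasure ν] {j : ℕ} (hj : 2 ≤ j)
    (hν : MemLp (fun z : ℝ => z) j ν) (hM : MatchesGauss j ν) {α β : ℕ → ℝ} (hβ : Summable β)
    (hα : ∀ k, |α k| ≤ β k) :
    MatchesGauss j ((iidLaw ν).map (interference α)) ∧
    gaussGap j ((iidLaw ν).map (interference α)) = gaussGap j ν * ∑' k, α (k + 1) ^ j ∧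
    ∫ z, z ^ 2 ∂((iidLaw ν).map (interference α)) =
      (∫ z, z ^ 2 ∂ν) * ∑' k, α (k + 1) ^ 2 := by
  have hβ0 : ∀ k, 0 ≤ β k := fun k => (abs_nonneg _).trans (hα k)
  have hνj : Integrable (fun z : ℝ => |z| ^ j) ν := by simpa using hν.integrable_norm_pow'
  have hae := ae_interference (hν.integrable (by exact_mod_cast (by omega : 1 ≤ j))) hβ hα
  have hpart := map_partialSum_iidLaw hj hνj hM α
  have hsum : ∀ i, 1 ≤ i → Tendsto (fun n => ∑ k ∈ Finset.range n, α (k + 1) ^ i) atTop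
      (𝓝 (∑' k, α (k + 1) ^ i)) := fun i hi =>
    ((summable_nat_add_iff 1).2 (summable_pow_of_abs_le hβ hα hi)).hasSum.tendsto_sum_nat
  have h := MatchesGauss.of_tendsto (D := envelope β) (fun n => by fun_prop)
    (measurable_interference α) hj (integrable_envelope_pow (by omega) hν hβ0 hβ)
    (hae.mono fun x hx => hx.2.1) (hae.mono fun x hx => hx.1) (fun n => (hpart n).2.1)
    (((hsum j (by omega)).const_mul (gaussGap j ν)).congr fun n => (hpart n).2.2.1.symm)
  exact ⟨h.1, h.2.1, tendsto_nhds_unique h.2.2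
    (((hsum 2 (by omega)).const_mul _).congr fun n => (hpart n).2.2.2.symm)⟩

theorem matchesGauss_conv_interference {ν : Measure ℝ} [IsProbabilityMeasure ν] {j : ℕ} (hj : 2 ≤ j)
    (hν : MemLp (fun z : ℝ => z) j ν) (hM : MatchesGauss j ν) {α β : ℕ → ℝ} (hβ : Summable β)
    (hα : ∀ k, |α k| ≤ β k) :
    MatchesGauss j (ν.conv ((iidLaw ν).map (interference α))) ∧
    gaussGap j (ν.conv ((iidLaw ν).map (interference α))) =
      gaussGap j ν * (1 + ∑' k, α (k + 1) ^ j) := by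
  have hβ0 : ∀ k, 0 ≤ β k := fun k => (abs_nonneg _).trans (hα k)
  have hPW : IsProbabilityMeasure ((iidLaw ν).map (interference α)) :=
    Measure.isProbabilityMeasure_map (measurable_interference α).aemeasurable
  have hWj := integrable_abs_pow_interference (by omega) hν hβ hα
  have hW := matchesGauss_interference hj hν hM hβ hα
  have hZ := MatchesGauss.conv hj (by simpa using hν.integrable_norm_pow') hWj hM hW.1
  refine ⟨hZ.1, ?_⟩
  rw [hZ.2, hW.2.1]
  ring

/-- One envelope dominates `x₀`, the interference and their sum, for all coefficient sequences below
`β`; the condition `1 ≤ β 0` takes care of `x₀`. -/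
theorem hasMomentBounds_interference {ν : Measure ℝ} [IsProbabilityMeasure ν] {j : ℕ} (hj : 2 ≤ j)
    (hν : MemLp (fun z : ℝ => z) ((2 * j : ℕ) : ℝ≥0∞) ν) (hM : MatchesGauss j ν) {β : ℕ → ℝ}
    (hβ : Summable β) (hβ0 : ∀ k, 0 ≤ β k) (hβ1 : 1 ≤ β 0) :
    ∃ K : ℝ, ∃ τ : ℝ → ℝ, 0 ≤ K ∧ Tendsto τ atTop (𝓝 0) ∧ HasMomentBounds j K τ ν ∧
      ∀ α : ℕ → ℝ, (∀ k, |α k| ≤ β k) →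
        HasMomentBounds j K τ ((iidLaw ν).map (interference α)) ∧
        HasMomentBounds j K τ (ν.conv ((iidLaw ν).map (interference α))) := by
  have hD := integrable_envelope_pow (by omega) hν hβ0 hβ
  have hDm := measurable_envelope β
  have hν1 : Integrable (fun z : ℝ => z) ν :=
    hν.integrable (by exact_mod_cast (by omega : 1 ≤ 2 * j))
  have h0 : (iidLaw ν).map (fun x => x 0) = ν := Measure.infinitePi_map_eval (fun _ : ℕ => ν) 0
  have hxle : ∀ x : ℕ → ℝ, |x 0| ≤ β 0 * |x 0| := fun x =>
    le_mul_of_one_le_left (abs_nonneg _) hβ1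
  have hνj : MemLp (fun z : ℝ => z) (j : ℝ≥0∞) ν :=
    hν.mono_exponent (by exact_mod_cast (by omega : j ≤ 2 * j))
  refine ⟨∫ x, |envelope β x| ^ (2 * j) ∂(iidLaw ν), _, integral_nonneg fun x => by positivity, tendsto_setIntegral_compl_le hDm hD, ?_,
    fun α hα => ⟨?_, ?_⟩⟩
  · have h1 := HasMomentBounds.of_dominated (P := iidLaw ν) hDm (Y := fun x => x 0)
      (measurable_pi_apply 0) hD ?_ (by rwa [h0])
    · rwa [h0] at h1
    · filter_upwards [ae_interference hν1 hβ (α := β) fun k => (abs_of_nonneg (hβ0 k)).le] with x hx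
      linarith [hx.2.2, hxle x, abs_nonneg (interference β x)]
  · refine HasMomentBounds.of_dominated hDm (measurable_interference α) hD ?_
      (matchesGauss_interference hj hνj hM hβ hα).1
    filter_upwards [ae_interference hν1 hβ hα] with x hx
    linarith [hx.2.2, hxle x, abs_nonneg (x 0)]
  · have hlaw : ν.conv ((iidLaw ν).map (interference α)) =
        (iidLaw ν).map (fun x => x 0 + interference α x) := by
      have := (indepFun_eval_zero_interference ν α).map_add_eq_map_conv_map
        (measurable_pi_apply 0) (measurable_interference α)
      rw [h0] at this
      exact this.symm
    have hZ := matchesGauss_conv_interference hj hνj hM hβ hα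
    rw [hlaw] at hZ ⊢
    refine HasMomentBounds.of_dominated hDm
      ((measurable_pi_apply 0).add (measurable_interference α)) hD ?_ hZ.1
    filter_upwards [ae_interference hν1 hβ hα] with x hx
    change |x 0 + interference α x| ≤ _
    linarith [hx.2.2, hxle x, abs_add_le (x 0) (interference α x)]

/-- The logarithm is of order `s²` and so beats every power from `s³` on. This will make the
Shamai–Laroia information strictly positive. -/
theorem exists_mul_pow_lt_log {C p : ℝ} (hC : 0 < C) (hp : 0 < p) : ∃ δ > 0, ∀ s, 0 < s → s < δ →
    ∀ n, 3 ≤ n → C * s ^ n < Real.log (1 + s ^ 2 * p) / 2 := by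
  refine ⟨min 1 (p / (2 * C * (1 + p))), by positivity, fun s hs hs1 n hn => ?_⟩
  have hs2 : s < 1 := hs1.trans_le (min_le_left _ _)
  have hs3 : s < p / (2 * C * (1 + p)) := hs1.trans_le (min_le_right _ _)
  have h1 : C * s ^ n ≤ C * s ^ 3 :=
    mul_le_mul_of_nonneg_left (pow_le_pow_of_le_one hs.le hs2.le hn) hC.le
  have h2 := Real.one_sub_inv_le_log_of_pos (by positivity : 0 < 1 + s ^ 2 * p)
  have h3 : 1 - (1 + s ^ 2 * p)⁻¹ = s ^ 2 * p / (1 + s ^ 2 * p) := by field_simp; ring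
  have h4 : s ^ 2 * p / (1 + p) ≤ s ^ 2 * p / (1 + s ^ 2 * p) := by
    refine div_le_div_of_nonneg_left (by positivity) (by positivity) ?_
    linarith [mul_le_of_le_one_left hp.le (pow_le_one₀ hs.le hs2.le : s ^ 2 ≤ 1)]
  have h5 : C * s ^ 3 < s ^ 2 * p / (1 + p) / 2 := by
    have e : s ^ 2 * p / (1 + p) / 2 = C * s ^ 2 * (p / (2 * C * (1 + p))) := by field_simp
    have e' : C * s ^ 3 = C * s ^ 2 * s := by ring
    rw [e, e']
    exact mul_lt_mul_of_pos_left hs3 (by positivity)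
  linarith

/-- At small scales the interference increases the relative entropy of the input by more than the
relative entropy of the input alone. -/
theorem exists_nonGaussianness_lt {ν : Measure ℝ} [IsProbabilityMeasure ν] {j : ℕ} (hj : 2 ≤ j)
    (hν : MemLp (fun z : ℝ => z) ((2 * j : ℕ) : ℝ≥0∞) ν) (hM : MatchesGauss j ν)
    (hgap : gaussGap j ν ≠ 0) (hp : 0 < ∫ z, z ^ 2 ∂ν) {β : ℕ → ℝ} (hβ : Summable β)
    (hβ0 : ∀ k, 0 ≤ β k) {η : ℝ} (hη : 0 < η) :
    ∃ δ > 0, ∀ c, 0 < c → c < δ → ∀ α : ℕ → ℝ, (∀ k, |α k| ≤ β k) →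
      η ≤ ∑' k, α (k + 1) ^ j → ∀ s, 0 < s → s ≤ c →
      nonGaussianness (ν.map (s * ·)) <
          nonGaussianness ((ν.conv ((iidLaw ν).map (interference α))).map (c * ·)) -
            nonGaussianness (((iidLaw ν).map (interference α)).map (c * ·)) ∧
        nonGaussianness (ν.map (s * ·)) < Real.log (1 + s ^ 2 * ∫ z, z ^ 2 ∂ν) / 2 := by
  -- Raising the zeroth entry gives `1 ≤ β' 0`, needed to dominate `x₀`, and leaves the majorant of
  -- the interference unchanged.
  set β' : ℕ → ℝ := Function.update β 0 (β 0 + 1) with hβ'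
  have hββ' : ∀ k, β k ≤ β' k := by
    intro k
    rcases eq_or_ne k 0 with rfl | hk
    · simp [hβ']
    · simp [hβ', Function.update_of_ne hk]
  have hβ's : Summable β' := by
    refine (summable_nat_add_iff 1).1 (((summable_nat_add_iff 1).2 hβ).congr fun k => ?_)
    simp [hβ']
  obtain ⟨K, τ, hK, hτ, hbν, hb⟩ := hasMomentBounds_interference hj hν hM hβ's
    (fun k => (hβ0 k).trans (hββ' k)) (by simp [hβ', hβ0 0])
  have ha := gapCoeff_zero_pos j
  set a := gapCoeff j 0
  set κ := gaussGap j ν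
  set p := ∫ z, z ^ 2 ∂ν
  have hκ2 : 0 < κ ^ 2 := by positivity
  -- Three expansions, each with error `ε c^(2j)`, compete with the surplus `a κ² A c^(2j)`, which
  -- is at least `6 ε c^(2j)`.
  set ε := a * κ ^ 2 * η / 6 with hε
  have hε0 : 0 < ε := by positivity
  have hev := eventually_abs_nonGaussianness_map_mul_sub_le (by omega : 1 ≤ j) hK hτ hε0
  obtain ⟨δ₁, hδ₁, hδ⟩ := mem_nhdsGT_iff_exists_Ioo_subset.1 hev
  set C := a * κ ^ 2 / 2 + ε with hC
  have hC0 : 0 < C := by positivity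
  obtain ⟨δ₂, hδ₂0, hδ₂⟩ := exists_mul_pow_lt_log hC0 hp
  refine ⟨min δ₁ δ₂, lt_min hδ₁ hδ₂0, fun c hc hcδ α hα hA s hs hsc => ?_⟩
  set A := ∑' k, α (k + 1) ^ j
  have hcδ₁ : c < δ₁ := hcδ.trans_le (min_le_left _ _)
  have hα' : ∀ k, |α k| ≤ β' k := fun k => (hα k).trans (hββ' k)
  have hνj : MemLp (fun z : ℝ => z) (j : ℝ≥0∞) ν :=
    hν.mono_exponent (by exact_mod_cast (by omega : j ≤ 2 * j))
  have hS := abs_le.1 (hδ ⟨hs, hsc.trans_lt hcδ₁⟩ _ hbν)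
  have hW := abs_le.1 (hδ ⟨hc, hcδ₁⟩ _ (hb α hα').1)
  have hZ := abs_le.1 (hδ ⟨hc, hcδ₁⟩ _ (hb α hα').2)
  rw [(matchesGauss_interference hj hνj hM hβ's hα').2.1] at hW
  rw [(matchesGauss_conv_interference hj hνj hM hβ's hα').2] at hZ
  have hS2 : nonGaussianness (ν.map (s * ·)) ≤ C * s ^ (2 * j) := by
    have : a * (s ^ j * κ) ^ 2 / 2 = a * κ ^ 2 / 2 * s ^ (2 * j) := by ring
    rw [this] at hS
    rw [hC, add_mul]
    linarith [hS.2]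
  constructor
  · have h1 : s ^ (2 * j) ≤ c ^ (2 * j) := pow_le_pow_left₀ hs.le hsc _
    have h2 : a * (c ^ j * (κ * A)) ^ 2 / 2 = a * κ ^ 2 / 2 * A ^ 2 * c ^ (2 * j) := by ring
    have h3 : a * (c ^ j * (κ * (1 + A))) ^ 2 / 2 =
      a * κ ^ 2 / 2 * (1 + A) ^ 2 * c ^ (2 * j) := by ring
    rw [h2] at hW
    rw [h3] at hZ
    have h4 : 0 < c ^ (2 * j) := by positivity
    have h5 : C * s ^ (2 * j) ≤ C * c ^ (2 * j) := by gcongr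
    have h6 : a * κ ^ 2 * η * c ^ (2 * j) ≤ a * κ ^ 2 * A * c ^ (2 * j) := by gcongr
    have h7 : 0 < ε * c ^ (2 * j) := by positivity
    have h8 : a * κ ^ 2 * η = 6 * ε := by rw [hε]; ring
    rw [h8] at h6
    nlinarith [hZ.1, hW.2]
  · exact hS2.trans_lt (hδ₂ s hs (hsc.trans_lt (hcδ.trans_le (min_le_right _ _))) _ (by omega))

/-! ### Mutual information over the interference channel -/

theorem map_conv_mul (μ ρ : Measure ℝ) [SFinite μ] [SFinite ρ] (c : ℝ) :
    (μ.conv ρ).map (c * ·) = (μ.map (c * ·)).conv (ρ.map (c * ·)) :=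
  Measure.map_conv_addMonoidHom (AddMonoidHom.mulLeft c) (measurable_const_mul c)

theorem integrable_sq_map_mul {μ : Measure ℝ} (h : Integrable (fun z => z ^ 2) μ) (c : ℝ) :
    Integrable (fun z => z ^ 2) (μ.map (c * ·)) := by
  rw [integrable_map_measure (by fun_prop) (by fun_prop)]
  refine (h.const_mul (c ^ 2)).congr (ae_of_all _ fun z => ?_)
  simp only [Function.comp, mul_pow]

theorem gaussianReal_map_inv_sqrt {v : ℝ} (hv : 0 < v) :
    (gaussianReal 0 v.toNNReal).map ((√v)⁻¹ * ·) = gaussianReal 0 1 := by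
  rw [gaussianReal_map_const_mul, mul_zero]
  congr 1
  ext
  simp [Real.sq_sqrt hv.le, hv.le, hv.ne']

theorem nonGaussianness_dirac_zero : nonGaussianness (Measure.dirac 0) = 0 := by
  have h : dens (Measure.dirac 0) = varPdf 1 := by
    have := dens_gaussianReal le_rfl
    simpa using this
  simp [nonGaussianness, h]

/-- Dividing the input and the output by `√v` leaves the information unchanged and makes the
Gaussian noise standard. -/
theorem mutualInfo_prod_gaussianReal {Ω : Type*} [MeasurableSpace Ω] {P : Measure Ω}
    [IsProbabilityMeasure P] {X U : Ω → ℝ} (hX : Measurable X) (hU : Measurable U)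
    (hXU : IndepFun X U P) (hX2 : Integrable (fun z => z ^ 2) (P.map X))
    (hX0 : ∫ z, z ∂(P.map X) = 0) (hU2 : Integrable (fun z => z ^ 2) (P.map U)) {v : ℝ}
    (hv : 0 < v) :
    mutualInfo (P.prod (gaussianReal 0 v.toNNReal)) (fun ω => X ω.1)
        (fun ω => X ω.1 + U ω.1 + ω.2) =
      ENNReal.ofReal (Real.log (1 + (∫ z, z ^ 2 ∂(P.map X)) / (v + ∫ z, z ^ 2 ∂(P.map U))) / 2 -
        (nonGaussianness (((P.map X).conv (P.map U)).map ((√v)⁻¹ * ·)) -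
          nonGaussianness ((P.map U).map ((√v)⁻¹ * ·)))) := by
  set G := gaussianReal 0 v.toNNReal with hG
  set r := (√v)⁻¹ with hr
  have hr0 : r ≠ 0 := by positivity
  have hr2 : r ^ 2 = v⁻¹ := by rw [hr, inv_pow, Real.sq_sqrt hv.le]
  have hPX : IsProbabilityMeasure (P.map X) := Measure.isProbabilityMeasure_map hX.aemeasurable
  have hPU : IsProbabilityMeasure (P.map U) := Measure.isProbabilityMeasure_map hU.aemeasurable
  have hPU' : IsProbabilityMeasure ((P.map U).map (r * ·)) :=
    Measure.isProbabilityMeasure_map (by fun_prop)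
  -- joint law of the input, the interference and the noise
  have hjoint : (P.prod G).map (fun ω => (X ω.1, (U ω.1, ω.2))) =
      (P.map X).prod ((P.map U).prod G) := by
    have h1 := (indepFun_iff_map_prod_eq_prod_map_map hX.aemeasurable hU.aemeasurable).1 hXU
    have h2 := Measure.map_prod_map P G (f := fun ω => (X ω, U ω)) (g := id) (by fun_prop)
      measurable_id
    rw [h1, Measure.map_id] at h2
    rw [← Measure.prodAssoc_prod, h2, Measure.map_map (by fun_prop) (by fun_prop)]
    rfl
  have hlX : (P.prod G).map (fun ω => r * X ω.1) = (P.map X).map (r * ·) := by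
    have : (P.prod G).map Prod.fst = P := by simp
    rw [Measure.map_map (by fun_prop) hX]
    nth_rw 2 [← this]
    rw [Measure.map_map (by fun_prop) (by fun_prop)]
    rfl
  have hlUN : (P.prod G).map (fun ω => (U ω.1, ω.2)) = (P.map U).prod G := by
    have h2 := Measure.map_prod_map P G (f := U) (g := id) hU measurable_id
    rw [Measure.map_id] at h2
    exact h2.symm
  have hlN : (P.prod G).map (fun ω => r * (U ω.1 + ω.2)) =
      ((P.map U).map (r * ·)).conv (gaussianReal 0 1) := by
    rw [← gaussianReal_map_inv_sqrt hv, ← map_conv_mul, Measure.conv, ← hG, ← hlUN,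
      Measure.map_map (by fun_prop) (by fun_prop), Measure.map_map (by fun_prop) (by fun_prop)]
    rfl
  have hind : IndepFun (fun ω : Ω × ℝ => X ω.1) (fun ω => (U ω.1, ω.2)) (P.prod G) := by
    rw [indepFun_iff_map_prod_eq_prod_map_map (by fun_prop) (by fun_prop), hjoint, hlUN]
    congr 1
    have : (P.prod G).map Prod.fst = P := by simp
    nth_rw 1 [← this]
    rw [Measure.map_map hX (by fun_prop)]
    rfl
  have hind' : IndepFun (fun ω : Ω × ℝ => r * X ω.1) (fun ω => r * (U ω.1 + ω.2)) (P.prod G) :=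
    hind.comp (φ := fun x => r * x) (ψ := fun y : ℝ × ℝ => r * (y.1 + y.2)) (by fun_prop)
      (by fun_prop)
  have h0 : ∫ z, z ∂((P.map X).map (r * ·)) = 0 := by
    have := integral_pow_map_mul (P.map X) r 1
    simpa [hX0] using this
  have hmain := mutualInfo_self_add_eq (P := P.prod G) (X := fun ω => r * X ω.1)
    (N := fun ω => r * (U ω.1 + ω.2)) (by fun_prop) (by fun_prop) hind' hlN
    (by rw [hlX]; exact integrable_sq_map_mul hX2 r) (by rw [hlX]; exact h0) (integrable_sq_map_mul hU2 r)
  rw [hlX, ← map_conv_mul, integral_pow_map_mul, integral_pow_map_mul, hr2] at hmain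
  rw [← mutualInfo_map_equiv (P := P.prod G) (X := fun ω => X ω.1)
    (Y := fun ω => X ω.1 + U ω.1 + ω.2) (by fun_prop) (by fun_prop) hr0 hr0]
  have e1 : (fun ω : Ω × ℝ => r * (X ω.1 + U ω.1 + ω.2)) =
      fun ω => r * X ω.1 + r * (U ω.1 + ω.2) := by ext ω; ring
  rw [e1, hmain]
  have h2 := integral_sq_nonneg (P.map U)
  congr 5
  field_simp

/-- The law of the interference scales with the input. -/
theorem map_interference_scaledLaw {ν : Measure ℝ} [IsProbabilityMeasure ν]
    (hν : Integrable (fun z : ℝ => z) ν) {α β : ℕ → ℝ} (hβ : Summable β)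
    (hα : ∀ k, |α k| ≤ β k) (c : ℝ) :
    (iidLaw (scaledLaw ν c)).map (interference α) =
      ((iidLaw ν).map (interference α)).map (c * ·) := by
  have h := Measure.infinitePi_map_pi (fun _ : ℕ => ν) (f := fun _ z => c * z) (by fun_prop)
  unfold iidLaw scaledLaw
  rw [← h, Measure.map_map (measurable_interference α) (by fun_prop),
    Measure.map_map (by fun_prop) (measurable_interference α)]
  refine Measure.map_congr ?_
  filter_upwards [ae_interference hν hβ hα] with x hx
  refine Tendsto.limUnder_eq ((hx.1.const_mul c).congr fun n => ?_)
  rw [Finset.mul_sum]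
  exact Finset.sum_congr rfl fun k _ => by ring

theorem inputPower_scaledLaw (ν : Measure ℝ) (c : ℝ) :
    inputPower (scaledLaw ν c) = c ^ 2 * inputPower ν :=
  integral_pow_map_mul ν c 2

theorem mutualInfo_inputNoiseLaw {ν : Measure ℝ} [IsProbabilityMeasure ν]
    (hν : MemLp (fun z : ℝ => z) 2 ν) (hν0 : ∫ z, z ∂ν = 0) {α β : ℕ → ℝ} (hβ : Summable β)
    (hα : ∀ k, |α k| ≤ β k) (c : ℝ) {v : ℝ} (hv : 0 < v) :
    mutualInfo (inputNoiseLaw (scaledLaw ν c) v) (fun ω => ω.1 0)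
        (fun ω => ω.1 0 + interference α ω.1 + ω.2) =
      ENNReal.ofReal (Real.log (1 + c ^ 2 * inputPower ν /
          (v + c ^ 2 * inputPower ν * ∑' k, α (k + 1) ^ 2)) / 2 -
        (nonGaussianness ((ν.conv ((iidLaw ν).map (interference α))).map (c / √v * ·)) -
          nonGaussianness (((iidLaw ν).map (interference α)).map (c / √v * ·)))) := by
  have hP : IsProbabilityMeasure (scaledLaw ν c) := Measure.isProbabilityMeasure_map (by fun_prop)
  have hPW : IsProbabilityMeasure ((iidLaw ν).map (interference α)) :=
    Measure.isProbabilityMeasure_map (measurable_interference α).aemeasurable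
  have hM : MatchesGauss 2 ν := by
    intro i hi
    interval_cases i
    · simp [gaussMoment_zero]
    · simp [gaussMoment_one, hν0]
  have hν2 : Integrable (fun z : ℝ => z ^ 2) ν := by simpa using hν.integrable_norm_pow'
  have hν1 : Integrable (fun z : ℝ => z) ν := hν.integrable (by norm_num)
  have hlX : (iidLaw (scaledLaw ν c)).map (fun x => x 0) = ν.map (c * ·) :=
    Measure.infinitePi_map_eval (fun _ : ℕ => scaledLaw ν c) 0
  have hlU := map_interference_scaledLaw hν1 hβ hα c
  have hW2 : Integrable (fun z : ℝ => z ^ 2) ((iidLaw ν).map (interference α)) := by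
    simpa using integrable_abs_pow_interference (j := 2) (by norm_num) (by exact_mod_cast hν) hβ hα
  have h0 : ∫ z, z ∂(ν.map (c * ·)) = 0 := by
    have := integral_pow_map_mul ν c 1
    simpa [hν0] using this
  have h := mutualInfo_prod_gaussianReal (P := iidLaw (scaledLaw ν c)) (X := fun x => x 0)
    (measurable_pi_apply 0) (measurable_interference α)
    (indepFun_eval_zero_interference (scaledLaw ν c) α) (by rw [hlX]; exact integrable_sq_map_mul hν2 c)
    (by rw [hlX]; exact h0) (by rw [hlU]; exact integrable_sq_map_mul hW2 c) hv
  have hmm : ∀ μ : Measure ℝ, (μ.map (c * ·)).map ((√v)⁻¹ * ·) = μ.map (c / √v * ·) := fun μ => by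
    rw [Measure.map_map (by fun_prop) (by fun_prop)]
    congr 1; ext z; simp only [Function.comp]; ring
  have hWsq := (matchesGauss_interference le_rfl (by exact_mod_cast hν) hM hβ hα).2.2
  rw [hlX, hlU, ← map_conv_mul, hmm, hmm, integral_pow_map_mul, integral_pow_map_mul, hWsq] at h
  unfold inputNoiseLaw
  rw [h, inputPower]
  simp only [mul_assoc]

/-- The case without interference: `U = 0`, whose smoothed law is exactly Gaussian. The gain `√(N₀ /
d)` amounts to Gaussian noise of variance `d`. -/
theorem scalarInfo_scaledLaw {ν : Measure ℝ} [IsProbabilityMeasure ν]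
    (hν : MemLp (fun z : ℝ => z) 2 ν) (hν0 : ∫ z, z ∂ν = 0) (hp : 0 < inputPower ν) {c : ℝ}
    (hc : 0 < c) {N₀ d : ℝ} (hN₀ : 0 < N₀) (hd : 0 < d) :
    scalarInfo (scaledLaw ν c) N₀ (inputPower (scaledLaw ν c) / d) =
      ENNReal.ofReal (Real.log (1 + c ^ 2 * inputPower ν / d) / 2 -
        nonGaussianness (ν.map (c / √d * ·))) := by
  have hP : IsProbabilityMeasure (scaledLaw ν c) := Measure.isProbabilityMeasure_map (by fun_prop)
  have hν2 : Integrable (fun z : ℝ => z ^ 2) ν := by simpa using hν.integrable_norm_pow'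
  have hpc : inputPower (scaledLaw ν c) ≠ 0 := by rw [inputPower_scaledLaw]; positivity
  set g := √(N₀ / d) with hg
  have hg0 : 0 < g := by positivity
  have eg : inputPower (scaledLaw ν c) / d * N₀ / inputPower (scaledLaw ν c) = N₀ / d := by
    field_simp
  unfold scalarInfo
  rw [eg, ← mutualInfo_map_equiv (c := g) (d := 1) (by fun_prop) (by fun_prop) hg0.ne' one_ne_zero]
  have hlX : (scaledLaw ν c).map (fun x => g * x) = ν.map (g * c * ·) := by
    rw [scaledLaw, Measure.map_map (by fun_prop) (by fun_prop)]
    congr 1; ext z; simp only [Function.comp]; ring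
  have hlU : (scaledLaw ν c).map (fun _ => (0 : ℝ)) = Measure.dirac 0 := by
    simp [Measure.map_const]
  have h0 : ∫ z, z ∂(ν.map (g * c * ·)) = 0 := by
    have := integral_pow_map_mul ν (g * c) 1
    simpa [hν0] using this
  have h := mutualInfo_prod_gaussianReal (P := scaledLaw ν c) (X := fun x => g * x)
    (U := fun _ => 0) (by fun_prop) (by fun_prop) (indepFun_const_right _ 0) (by rw [hlX]; exact integrable_sq_map_mul hν2 _)
    (by rw [hlX]; exact h0) (by rw [hlU]; exact integrable_dirac (by simp)) hN₀
  have hmm : (ν.map (g * c * ·)).map ((√N₀)⁻¹ * ·) = ν.map (c / √d * ·) := by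
    rw [Measure.map_map (by fun_prop) (by fun_prop)]
    congr 1; ext z; simp only [Function.comp]
    rw [hg, Real.sqrt_div hN₀.le]
    field_simp
  have hd0 : (Measure.dirac (0 : ℝ)).map ((√N₀)⁻¹ * ·) = Measure.dirac 0 := by
    rw [Measure.map_dirac' (measurable_const_mul _), mul_zero]
  rw [hlX, hlU, Measure.conv_dirac_zero, hmm, hd0, nonGaussianness_dirac_zero,
    integral_pow_map_mul] at h
  simp only [add_zero, integral_dirac, sub_zero, ne_eq, OfNat.ofNat_ne_zero, not_false_eq_true,
    zero_pow] at h
  simp only [one_mul]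
  rw [h, mul_pow, hg, Real.sq_sqrt (by positivity), inputPower]
  congr 5
  field_simp

/-! ### Comparison of the two information expressions at small scales -/

/-- The total disturbance `d` is the same in both expressions, so the logarithms coincide. The
corrections live at scale `c / √v` with only the Gaussian part as noise, and at scale `c / √d ≤ c /
√v` with the whole disturbance as noise. -/
theorem exists_infoMMSE_lt_infoSL {ν : Measure ℝ} [IsProbabilityMeasure ν] {j : ℕ} (hj : 2 ≤ j)
    (hν : MemLp (fun z : ℝ => z) ((2 * j : ℕ) : ℝ≥0∞) ν) (hM : MatchesGauss j ν)
    (hgap : gaussGap j ν ≠ 0) (hp : 0 < inputPower ν) {β : ℕ → ℝ} (hβ : Summable β)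
    (hβ0 : ∀ k, 0 ≤ β k) {η : ℝ} (hη : 0 < η) :
    ∃ δ > 0, ∀ (L : ℕ) (h : Fin L → ℝ) (a : ℤ → ℝ) (c N₀ : ℝ), 0 < c → 0 < N₀ →
      0 < filteredNoiseVar h N₀ a → c ^ 2 < δ * filteredNoiseVar h N₀ a →
      (∀ k, |residualCoeff h a k| ≤ β k) → η ≤ ∑' k, residualCoeff h a (k + 1) ^ j →
      infoMMSE (scaledLaw ν c) h N₀ a < infoSL (scaledLaw ν c) h N₀ a := by
  obtain ⟨δ, hδ, H⟩ := exists_nonGaussianness_lt hj hν hM hgap hp hβ hβ0 hη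
  refine ⟨δ ^ 2, by positivity, fun L h a c N₀ hc hN₀ hv hcv hα hA => ?_⟩
  have hν2 : MemLp (fun z : ℝ => z) 2 ν :=
    hν.mono_exponent (by exact_mod_cast (by omega : 2 ≤ 2 * j))
  have hν0 := hM.integral_eq_zero hj
  set v := filteredNoiseVar h N₀ a with hvdef
  set α := residualCoeff h a with hαdef
  set S := ∑' k, α (k + 1) ^ 2 with hS
  have hS0 : 0 ≤ S := tsum_nonneg fun k => sq_nonneg _
  set d := v + c ^ 2 * inputPower ν * S with hd
  have hvd : v ≤ d := by
    have : 0 ≤ c ^ 2 * inputPower ν * S := by positivity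
    linarith
  have hd0 : 0 < d := hv.trans_le hvd
  have hdist : disturbanceVar h (inputPower (scaledLaw ν c)) N₀ a = d := by
    rw [disturbanceVar, inputPower_scaledLaw, hd, add_comm]
  have hsv := Real.sqrt_pos.2 hv
  have hr : c / √v < δ := by
    rw [div_lt_iff₀ hsv]
    refine lt_of_pow_lt_pow_left₀ 2 (by positivity) ?_
    rwa [mul_pow, Real.sq_sqrt hv.le]
  obtain ⟨h1, h2⟩ := H (c / √v) (by positivity) hr α hα hA (c / √d) (by positivity)
    (div_le_div_of_nonneg_left hc.le hsv (Real.sqrt_le_sqrt hvd))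
  have e : (c / √d) ^ 2 * ∫ z, z ^ 2 ∂ν = c ^ 2 * inputPower ν / d := by
    rw [div_pow, Real.sq_sqrt hd0.le, inputPower]; ring
  rw [e] at h2
  rw [infoMMSE, mutualInfo_inputNoiseLaw hν2 hν0 hβ hα c hv, infoSL, snrDFEU, hdist,
    scalarInfo_scaledLaw hν2 hν0 hp hc hN₀ hd0]
  -- `ENNReal.ofReal` truncates at zero, so strictness requires the right side to be positive; this
  -- is `h2`.
  refine (ENNReal.ofReal_lt_ofReal_iff (by linarith)).2 ?_
  linarith

/-! ### Minimization of a quadratic form subject to a linear constraint -/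

section quadratic

variable {E K : Type*} [NormedAddCommGroup E] [InnerProductSpace ℝ E] [NormedAddCommGroup K]
  [InnerProductSpace ℝ K] (U : E →L[ℝ] K)

/-- The quadratic form `P ‖U f‖² + N ‖f‖²`. -/
noncomputable def regularizedSq (P N : ℝ) (f : E) : ℝ := P * ‖U f‖ ^ 2 + N * ‖f‖ ^ 2

theorem regularizedSq_add_smul (P N : ℝ) (f e : E) (s : ℝ) :
    regularizedSq U P N (f + s • e) = regularizedSq U P N f +
      2 * s * (P * inner ℝ (U f) (U e) + N * inner ℝ f e) + s ^ 2 * regularizedSq U P N e := by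
  unfold regularizedSq
  rw [map_add, map_smul, norm_add_sq_real, norm_add_sq_real, norm_smul, norm_smul, inner_smul_right,
    inner_smul_right, mul_pow, mul_pow, Real.norm_eq_abs, sq_abs]
  ring

theorem regularizedSq_smul (P N : ℝ) (f : E) (s : ℝ) :
    regularizedSq U P N (s • f) = s ^ 2 * regularizedSq U P N f := by
  unfold regularizedSq
  rw [map_smul, norm_smul, norm_smul, mul_pow, mul_pow, Real.norm_eq_abs, sq_abs]
  ring

/-- By Lax–Milgram, `⟨g, b⟩ = B(f, b)` for some `f`, where `B` is the bilinear form of the quadratic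
form. Cauchy–Schwarz for `B` gives `⟨g, b⟩² ≤ B(f, f) B(b, b)`, with equality at `b = f`. -/
theorem exists_forall_regularizedSq_div_le [CompleteSpace E] {P N : ℝ} (hP : 0 ≤ P) (hN : 0 < N)
    {g : E} (hg : g ≠ 0) :
    ∃ f : E, inner ℝ g f ≠ 0 ∧ ∀ b : E, inner ℝ g b ≠ 0 →
      regularizedSq U P N f / inner ℝ g f ^ 2 ≤ regularizedSq U P N b / inner ℝ g b ^ 2 := by
  set B : E →L[ℝ] E →L[ℝ] ℝ :=
    N • innerSL ℝ + P • (innerSL ℝ : K →L[ℝ] K →L[ℝ] ℝ).bilinearComp U U with hB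
  have hBapp : ∀ a b, B a b = P * inner ℝ (U a) (U b) + N * inner ℝ a b := fun a b => by
    rw [add_comm]; rfl
  have hBself : ∀ a, B a a = regularizedSq U P N a := fun a => by
    rw [hBapp, regularizedSq, real_inner_self_eq_norm_sq, real_inner_self_eq_norm_sq]
  have hcoer : IsCoercive B := by
    refine ⟨N, hN, fun u => ?_⟩
    rw [hBself, regularizedSq]
    nlinarith [mul_nonneg hP (sq_nonneg ‖U u‖)]
  set T := hcoer.continuousLinearEquivOfBilin
  -- `T` represents the form, so it represents the constraint functional at `f`
  set f := (ContinuousLinearEquiv.symm T) g with hf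
  have hTf : T f = g := T.apply_symm_apply g
  have hrep : ∀ b, B f b = inner ℝ g b := fun b => by
    rw [← hcoer.continuousLinearEquivOfBilin_apply f b]
    exact congrArg (fun z => inner ℝ z b) hTf
  have hf0 : f ≠ 0 := fun h => hg (by rw [← hTf, h, map_zero])
  set q := regularizedSq U P N f with hq
  have hq0 : 0 < q := by
    have : 0 < ‖f‖ := norm_pos_iff.2 hf0
    rw [hq, regularizedSq]
    positivity
  have hgf : inner ℝ g f = q := by rw [← hrep, hBself]
  refine ⟨f, by rw [hgf]; exact hq0.ne', fun b hb => ?_⟩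
  have hcs : inner ℝ g b ^ 2 ≤ q * regularizedSq U P N b := by
    -- Cauchy–Schwarz: the form is nonnegative at `⟨g, b⟩ f - q b`.
    have h1 := regularizedSq_add_smul U P N (inner ℝ g b • f) b (-q)
    have h2 : 0 ≤ regularizedSq U P N (inner ℝ g b • f + -q • b) := by
      unfold regularizedSq; positivity
    rw [h1, regularizedSq_smul, map_smul, real_inner_smul_left, real_inner_smul_left] at h2
    have h3 := hrep b
    rw [hBapp] at h3
    have h4 : P * (inner ℝ g b * inner ℝ (U f) (U b)) + N * (inner ℝ g b * inner ℝ f b) =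
      inner ℝ g b ^ 2 := by rw [sq]; nth_rw 3 [← h3]; ring
    rw [h4, ← hq] at h2
    have h5 : 0 ≤ q * (q * regularizedSq U P N b - inner ℝ g b ^ 2) := by linarith
    linarith [nonneg_of_mul_nonneg_right h5 hq0]
  rw [hgf, div_le_div_iff₀ (by positivity) (by positivity)]
  nlinarith

section minimizer

variable {U} {P N : ℝ} {f g : E}

/-- Euler–Lagrange equation: `f + s e` stays feasible, and a quadratic in `s` without constant term
is nonnegative everywhere only if its linear coefficient vanishes. -/
theorem inner_add_inner_eq_zero_of_minimizer (hg : inner ℝ g f = 1)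
    (hmin : ∀ b : E, inner ℝ g b = 1 → regularizedSq U P N f ≤ regularizedSq U P N b) {e : E}
    (he : inner ℝ g e = 0) : P * inner ℝ (U f) (U e) + N * inner ℝ f e = 0 := by
  set B := P * inner ℝ (U f) (U e) + N * inner ℝ f e with hB
  have h : ∀ s : ℝ, 0 ≤ regularizedSq U P N e * (s * s) + 2 * B * s + 0 := fun s => by
    have := hmin (f + s • e) (by rw [inner_add_right, inner_smul_right, hg, he]; ring)
    rw [regularizedSq_add_smul] at this
    nlinarith
  have hd := discrim_le_zero h
  rw [discrim] at hd
  nlinarith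

/-- The vector `b = g / ‖g‖²` has the least norm under the constraint, so `‖f - b‖² = ‖f‖² - ‖b‖²`;
comparing the forms at `f` and `b` bounds this difference. -/
theorem norm_sub_sq_le_of_minimizer (hN : 0 < N) (hP : 0 ≤ P) (hg : inner ℝ g f = 1)
    (hmin : ∀ b : E, inner ℝ g b = 1 → regularizedSq U P N f ≤ regularizedSq U P N b) :
    ‖f - (‖g‖ ^ 2)⁻¹ • g‖ ^ 2 ≤ P / N * ‖U ((‖g‖ ^ 2)⁻¹ • g)‖ ^ 2 := by
  have hg0 : 0 < ‖g‖ := norm_pos_iff.2 fun h => by simp [h] at hg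
  set b := (‖g‖ ^ 2)⁻¹ • g with hb
  have hgb : inner ℝ g b = 1 := by
    rw [hb, inner_smul_right, real_inner_self_eq_norm_sq]; field_simp
  have hbb : ‖b‖ ^ 2 = (‖g‖ ^ 2)⁻¹ := by
    rw [← real_inner_self_eq_norm_sq]
    nth_rw 1 [hb]
    rw [real_inner_smul_left, hgb, mul_one]
  have hfb : inner ℝ f b = (‖g‖ ^ 2)⁻¹ := by
    rw [hb, inner_smul_right, real_inner_comm, hg, mul_one]
  have h := hmin b hgb
  unfold regularizedSq at h
  rw [norm_sub_sq_real, hfb, hbb, div_mul_eq_mul_div, le_div_iff₀ hN]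
  rw [hbb] at h
  nlinarith [mul_nonneg hP (sq_nonneg ‖U f‖)]

end minimizer

end quadratic

/-! ### The quadratic form of the channel -/

/-- Reindexing of a square-summable sequence along an injective map. -/
noncomputable def lpComap {ι κ : Type*} (φ : κ → ι) (hφ : Function.Injective φ) :
    lp (fun _ : ι => ℝ) 2 →L[ℝ] lp (fun _ : κ => ℝ) 2 :=
  have hs : ∀ f : lp (fun _ : ι => ℝ) 2, Summable fun i => f i ^ 2 := fun f => by
    simpa using (lp.memℓp f).summable (by norm_num)
  LinearMap.mkContinuous
    { toFun := fun f => ⟨fun k => f (φ k), memℓp_gen (by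
        simpa [Function.comp_def] using (hs f).comp_injective hφ)⟩
      map_add' := fun f g => rfl
      map_smul' := fun r f => rfl } 1 fun f => by
    rw [one_mul]
    refine lp.norm_le_of_tsum_le (by norm_num) (norm_nonneg f) ?_
    rw [lp.norm_rpow_eq_tsum (by norm_num)]
    simp only [ENNReal.toReal_ofNat, Real.rpow_ofNat, Real.norm_eq_abs, sq_abs]
    exact ((hs f).comp_injective hφ).tsum_le_tsum_of_inj φ hφ (fun i _ => sq_nonneg (f i))
      (fun k => le_rfl) (hs f)

theorem lpComap_apply {ι κ : Type*} (φ : κ → ι) (hφ : Function.Injective φ)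
    (f : lp (fun _ : ι => ℝ) 2) (k : κ) : lpComap φ hφ f k = f (φ k) := rfl

theorem lp_sum_smul_apply {ι κ : Type*} (s : Finset κ) (r : κ → ℝ) (F : κ → lp (fun _ : ι => ℝ) 2)
    (i : ι) : (∑ k ∈ s, r k • F k) i = ∑ k ∈ s, r k * F k i := by
  rw [lp.coeFn_sum]
  exact Finset.sum_apply i s _

theorem norm_sq_eq_tsum_sq {ι : Type*} (f : lp (fun _ : ι => ℝ) 2) : ‖f‖ ^ 2 = ∑' i, f i ^ 2 := by
  rw [← real_inner_self_eq_norm_sq, lp.inner_eq_tsum]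
  simp [sq]

section filter

variable {L : ℕ} (h : Fin L → ℝ)

/-- The map from a filter to the residual interference coefficients before normalization. -/
noncomputable def residualMap : lp (fun _ : ℤ => ℝ) 2 →L[ℝ] lp (fun _ : ℕ => ℝ) 2 :=
  ∑ i : Fin L, h i • lpComap (fun k : ℕ => -(i : ℤ) - ((k + 1 : ℕ) : ℤ)) (fun k l hkl => by
    simp only at hkl; omega)

/-- The matched filter. -/
noncomputable def matchedFilter : lp (fun _ : ℤ => ℝ) 2 :=
  ∑ i : Fin L, h i • lp.single 2 (-(i : ℤ)) (1 : ℝ)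

theorem residualMap_apply (f : lp (fun _ : ℤ => ℝ) 2) (k : ℕ) :
    residualMap h f k = inputCoeff h f (k + 1) := by
  have : residualMap h f = ∑ i : Fin L, h i • lpComap (fun k : ℕ => -(i : ℤ) - ((k + 1 : ℕ) : ℤ))
      (fun k l hkl => by simp only at hkl; omega) f := by simp [residualMap]
  rw [this, lp_sum_smul_apply]
  rfl

theorem inner_matchedFilter (f : lp (fun _ : ℤ => ℝ) 2) :
    inner ℝ (matchedFilter h) f = inputCoeff h f 0 := by
  simp [matchedFilter, inputCoeff, sum_inner, real_inner_smul_left, lp.inner_single_left]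

theorem matchedFilter_apply_neg (i : Fin L) : matchedFilter h (-(i : ℤ)) = h i := by
  rw [matchedFilter, lp_sum_smul_apply]
  simp [Pi.single_apply, Fin.val_inj]

theorem matchedFilter_apply_of_notMem {l : ℤ} (hl : ∀ i : Fin L, l ≠ -(i : ℤ)) :
    matchedFilter h l = 0 := by
  rw [matchedFilter, lp_sum_smul_apply]
  simp [hl]

theorem disturbanceVar_eq (P N₀ : ℝ) (f : lp (fun _ : ℤ => ℝ) 2) :
    disturbanceVar h P N₀ f =
      regularizedSq (residualMap h) P N₀ f / inner ℝ (matchedFilter h) f ^ 2 := by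
  rw [disturbanceVar, filteredNoiseVar, regularizedSq, norm_sq_eq_tsum_sq, norm_sq_eq_tsum_sq,
    inner_matchedFilter]
  simp_rw [residualMap_apply, residualCoeff, div_pow]
  rw [tsum_div_const]
  ring

end filter

/-! ### Minimizing filters at low signal-to-noise ratio -/

section filter

variable {L : ℕ} {h : Fin L → ℝ}

theorem inputCoeff_smul (r : ℝ) (f : lp (fun _ : ℤ => ℝ) 2) (k : ℕ) :
    inputCoeff h (r • f : lp (fun _ : ℤ => ℝ) 2) k = r * inputCoeff h f k := by
  simp only [inputCoeff, lp.coeFn_smul, Pi.smul_apply, smul_eq_mul, Finset.mul_sum]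
  exact Finset.sum_congr rfl fun i _ => by ring

theorem abs_inputCoeff_le {f : ℤ → ℝ} {k : ℕ} {M : ℝ}
    (hf : ∀ i : Fin L, |f (-(i : ℤ) - (k : ℤ))| ≤ M) :
    |inputCoeff h f k| ≤ (∑ i, |h i|) * M := by
  rw [inputCoeff, Finset.sum_mul]
  refine (Finset.abs_sum_le_sum_abs _ _).trans (Finset.sum_le_sum fun i _ => ?_)
  rw [abs_mul]
  exact mul_le_mul_of_nonneg_left (hf i) (abs_nonneg _)

theorem AdmissibleFilter.exists_lp {a : ℤ → ℝ} (ha : AdmissibleFilter h a) :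
    ∃ f : lp (fun _ : ℤ => ℝ) 2, (f : ℤ → ℝ) = a :=
  ⟨⟨a, memℓp_gen (by simpa using ha.1)⟩, rfl⟩

theorem admissibleFilter_lp {f : lp (fun _ : ℤ => ℝ) 2} :
    AdmissibleFilter h f ↔ inner ℝ (matchedFilter h) f ≠ 0 := by
  rw [AdmissibleFilter, inner_matchedFilter, and_iff_right]
  simpa using (lp.memℓp f).summable (by norm_num)

theorem matchedFilter_ne_zero (hh : ∃ i, h i ≠ 0) : matchedFilter h ≠ 0 := by
  obtain ⟨i, hi⟩ := hh
  intro h0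
  apply hi
  rw [← matchedFilter_apply_neg h i, h0]
  rfl

theorem exists_isMMSEFilter (hh : ∃ i, h i ≠ 0) {P N₀ : ℝ} (hP : 0 ≤ P) (hN₀ : 0 < N₀) :
    ∃ a, IsMMSEFilter h P N₀ a := by
  obtain ⟨f, hf, hmin⟩ := exists_forall_regularizedSq_div_le (residualMap h) hP hN₀
    (matchedFilter_ne_zero hh)
  refine ⟨f, admissibleFilter_lp.2 hf, fun b hb => ?_⟩
  obtain ⟨b, rfl⟩ := hb.exists_lp
  rw [disturbanceVar_eq, disturbanceVar_eq]
  exact hmin b (admissibleFilter_lp.1 hb)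

/-- A minimizing filter can be normalized without changing the quantities of interest. -/
theorem IsMMSEFilter.exists_normalized {P N₀ : ℝ} {a : ℤ → ℝ} (ha : IsMMSEFilter h P N₀ a) :
    ∃ f : lp (fun _ : ℤ => ℝ) 2, inner ℝ (matchedFilter h) f = 1 ∧
      (∀ b : lp (fun _ : ℤ => ℝ) 2, inner ℝ (matchedFilter h) b = 1 →
        regularizedSq (residualMap h) P N₀ f ≤ regularizedSq (residualMap h) P N₀ b) ∧
      (∀ k, residualCoeff h a k = inputCoeff h f k) ∧
      filteredNoiseVar h N₀ a = N₀ * ‖f‖ ^ 2 := by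
  obtain ⟨F, rfl⟩ := ha.1.exists_lp
  have hF := admissibleFilter_lp.1 ha.1
  set c := inner ℝ (matchedFilter h) F with hc
  have hc' : inputCoeff h F 0 = c := (inner_matchedFilter h F).symm
  refine ⟨c⁻¹ • F, by rw [inner_smul_right, ← hc, inv_mul_cancel₀ hF], fun b hb => ?_,
    fun k => ?_, ?_⟩
  · have h1 := ha.2 b (admissibleFilter_lp.2 (by rw [hb]; exact one_ne_zero))
    rw [disturbanceVar_eq, disturbanceVar_eq, hb, one_pow, div_one, ← hc] at h1
    rw [regularizedSq_smul, inv_pow]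
    rwa [div_eq_inv_mul] at h1
  · rw [residualCoeff, inputCoeff_smul, hc', div_eq_inv_mul]
  · rw [filteredNoiseVar, norm_smul, mul_pow, norm_sq_eq_tsum_sq, hc', norm_inv, inv_pow,
      Real.norm_eq_abs, sq_abs]
    ring

/-! ### Decay of the minimizing filters. -/

theorem abs_inner_lpComap_single_le {ι κ : Type*} [DecidableEq ι] {φ : κ → ι}
    (hφ : Function.Injective φ) {y : lp (fun _ : κ => ℝ) 2} {l : ι} {M : ℝ} (hM : 0 ≤ M)
    (hy : ∀ k, φ k = l → |y k| ≤ M) :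
    |inner ℝ y (lpComap φ hφ (lp.single 2 l (1 : ℝ)))| ≤ M := by
  classical
  by_cases hl : ∃ k, φ k = l
  · obtain ⟨k, rfl⟩ := hl
    have e : lpComap φ hφ (lp.single 2 (φ k) (1 : ℝ)) = lp.single 2 k (1 : ℝ) := by
      ext m
      rw [lpComap_apply, lp.single_apply, lp.single_apply, Pi.single_apply, Pi.single_apply]
      simp [hφ.eq_iff]
    rw [e, lp.inner_single_right]
    simpa using hy k rfl
  · have e : lpComap φ hφ (lp.single 2 l (1 : ℝ)) = 0 := by
      ext m
      rw [lpComap_apply, lp.single_apply, Pi.single_apply, if_neg fun h => hl ⟨m, h⟩]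
      rfl
    rw [e, inner_zero_right, abs_zero]
    exact hM

/-- The Euler–Lagrange equation in the direction of the unit vector at `l`, admissible since the
matched filter vanishes there. It expresses `f l` as `-(P / N₀)` times a combination of entries of
`f` at distance less than `L`. -/
theorem abs_apply_le_of_minimizer {P N₀ : ℝ} (hP : 0 ≤ P) (hN₀ : 0 < N₀)
    {f : lp (fun _ : ℤ => ℝ) 2} (hf : inner ℝ (matchedFilter h) f = 1)
    (hmin : ∀ b : lp (fun _ : ℤ => ℝ) 2, inner ℝ (matchedFilter h) b = 1 →
      regularizedSq (residualMap h) P N₀ f ≤ regularizedSq (residualMap h) P N₀ b)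
    {l : ℤ} (hl : ∀ i : Fin L, l ≠ -(i : ℤ)) {M : ℝ} (hM : 0 ≤ M)
    (hfl : ∀ d : ℤ, |d| < L → |f (l + d)| ≤ M) :
    |f l| ≤ P / N₀ * (∑ i, |h i|) ^ 2 * M := by
  set e : lp (fun _ : ℤ => ℝ) 2 := lp.single 2 l (1 : ℝ) with he
  set S := ∑ i, |h i| with hS
  have hS0 : 0 ≤ S := Finset.sum_nonneg fun i _ => abs_nonneg _
  have h1 := inner_add_inner_eq_zero_of_minimizer hf hmin (e := e) (by
    rw [he, lp.inner_single_right, matchedFilter_apply_of_notMem h hl]; simp)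
  have h2 : inner ℝ f e = f l := by rw [he, lp.inner_single_right]; simp
  have h3 : |inner ℝ (residualMap h f) (residualMap h e)| ≤ S * (S * M) := by
    have e1 : residualMap h e = ∑ i : Fin L, h i • lpComap
        (fun k : ℕ => -(i : ℤ) - ((k + 1 : ℕ) : ℤ)) (fun k l hkl => by simp only at hkl; omega) e := by
      simp [residualMap]
    rw [e1, inner_sum]
    nth_rw 2 [hS]
    rw [Finset.sum_mul]
    refine (Finset.abs_sum_le_sum_abs _ _).trans (Finset.sum_le_sum fun i _ => ?_)
    rw [inner_smul_right, abs_mul]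
    refine mul_le_mul_of_nonneg_left (abs_inner_lpComap_single_le _ (by positivity)
      fun k hk => ?_) (abs_nonneg _)
    rw [residualMap_apply]
    refine abs_inputCoeff_le fun i' => ?_
    have := hfl ((i : ℤ) - i') (by rw [abs_lt]; omega)
    rwa [← hk, show -(i : ℤ) - ((k + 1 : ℕ) : ℤ) + ((i : ℤ) - i') = -(i' : ℤ) - ((k + 1 : ℕ) : ℤ) by
      ring] at this
  rw [h2] at h1
  have h4 : f l = -(P / N₀) * inner ℝ (residualMap h f) (residualMap h e) := by
    field_simp
    linarith
  rw [h4, abs_mul, abs_neg, abs_of_nonneg (by positivity : 0 ≤ P / N₀)]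
  calc P / N₀ * |inner ℝ (residualMap h f) (residualMap h e)| ≤ P / N₀ * (S * (S * M)) := by gcongr
    _ = P / N₀ * S ^ 2 * M := by ring

/-- A bounded sequence that is locally contracted off a window of length `L` decays geometrically. -/
theorem abs_apply_le_geometric {f : ℤ → ℝ} {M κ : ℝ} (hL : 0 < L) (hf : ∀ l, |f l| ≤ M)
    (hκ : κ * 2 ^ L ≤ 1)
    (hstep : ∀ l : ℤ, (L : ℤ) ≤ |l| → ∀ M', 0 ≤ M' → (∀ d : ℤ, |d| < L → |f (l + d)| ≤ M') →
      |f l| ≤ κ * M') (n : ℕ) : ∀ l : ℤ, (n : ℤ) ≤ |l| → |f l| ≤ M * 2 ^ L * (1 / 2) ^ n := by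
  have hM : 0 ≤ M := (abs_nonneg _).trans (hf 0)
  induction n using Nat.strong_induction_on with
  | _ n ih =>
    intro l hl
    rcases lt_or_ge n L with hn | hn
    · refine (hf l).trans ?_
      rw [mul_assoc]
      refine le_mul_of_one_le_right hM ?_
      rw [one_div, inv_pow, ← div_eq_mul_inv, one_le_div (by positivity)]
      exact pow_le_pow_right₀ (by norm_num) hn.le
    -- Moving out by `L` positions costs one contraction by `κ ≤ 2^(-L)`, that is, a factor `1/2`
    -- per position.
    · obtain ⟨m, rfl⟩ := Nat.exists_eq_add_of_le hn
      have h1 := hstep l (by push_cast at hl; omega) (M * 2 ^ L * (1 / 2) ^ m) (by positivity)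
        fun d hd => ih m (by omega) (l + d) (by
          have := abs_sub_abs_le_abs_sub l (-d)
          rw [sub_neg_eq_add, abs_neg] at this
          push_cast at hl
          omega)
      refine h1.trans ?_
      have e : M * 2 ^ L * (1 / 2) ^ (L + m) = 1 * (M * (1 / 2) ^ m) := by
        rw [pow_add, mul_assoc, ← mul_assoc (2 ^ L : ℝ), ← mul_pow]; norm_num
      have e' : κ * (M * 2 ^ L * (1 / 2) ^ m) = κ * 2 ^ L * (M * (1 / 2) ^ m) := by ring
      rw [e, e']
      exact mul_le_mul_of_nonneg_right hκ (by positivity)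

theorem abs_inputCoeff_le_geometric {f : ℤ → ℝ} {M κ : ℝ} (hL : 0 < L) (hf : ∀ l, |f l| ≤ M)
    (hκ : κ * 2 ^ L ≤ 1)
    (hstep : ∀ l : ℤ, (L : ℤ) ≤ |l| → ∀ M', 0 ≤ M' → (∀ d : ℤ, |d| < L → |f (l + d)| ≤ M') →
      |f l| ≤ κ * M') (k : ℕ) :
    |inputCoeff h f k| ≤ (∑ i, |h i|) * (M * 2 ^ L * (1 / 2) ^ k) := by
  refine abs_inputCoeff_le fun i => abs_apply_le_geometric hL hf hκ hstep k _ ?_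
  rw [abs_of_nonpos (by omega)]
  omega

/-- At low signal-to-noise ratio the minimizing filters approach the matched filter, with uniformly
summable residual interference. -/
theorem exists_residualCoeff_bounds (hh : ∃ i, h i ≠ 0) :
    ∃ β : ℕ → ℝ, Summable β ∧ (∀ k, 0 ≤ β k) ∧
      (∀ k, |residualCoeff h (matchedFilter h) k| ≤ β k) ∧
      ∃ C > 0, ∃ ε > 0, ∀ P N₀ : ℝ, 0 < P → 0 < N₀ → P / N₀ < ε →
        ∀ a, IsMMSEFilter h P N₀ a → (∀ k, |residualCoeff h a k| ≤ β k) ∧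
          (∀ k, |residualCoeff h a k - residualCoeff h (matchedFilter h) k| ≤ C * √(P / N₀)) ∧
          N₀ ≤ C * filteredNoiseVar h N₀ a := by
  have hL : 0 < L := by obtain ⟨i, -⟩ := hh; exact i.pos
  have hg := matchedFilter_ne_zero hh
  set g := matchedFilter h with hgdef
  have hg0 : 0 < ‖g‖ := norm_pos_iff.2 hg
  set b := (‖g‖ ^ 2)⁻¹ • g with hb
  set R := ‖residualMap h b‖ with hR
  set S := ∑ i, |h i| with hS
  have hS0 : 0 ≤ S := Finset.sum_nonneg fun i _ => abs_nonneg _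
  set M := ‖b‖ + R with hM
  set κ : ℝ := (2 ^ L)⁻¹ with hκ
  have hκ1 : κ * 2 ^ L ≤ 1 := by rw [hκ, inv_mul_cancel₀ (by positivity)]
  have hρ : ∀ k, residualCoeff h g k = inputCoeff h b k := fun k => by
    rw [residualCoeff, hb, inputCoeff_smul, ← inner_matchedFilter, ← hgdef,
      real_inner_self_eq_norm_sq, div_eq_inv_mul]
  have hR0 : 0 ≤ R := norm_nonneg _
  refine ⟨fun k => S * (M * 2 ^ L * (1 / 2) ^ k), ?_, fun k => by positivity, fun k => ?_,
    ‖g‖ ^ 2 + S * R, by positivity, min 1 (κ / (S ^ 2 + 1)), by positivity,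
    fun P N₀ hP hN₀ hε a ha => ?_⟩
  · exact ((summable_geometric_of_lt_one (by norm_num) (by norm_num)).mul_left _).mul_left _
  · rw [hρ]
    -- The matched filter vanishes off the window, so the contraction hypothesis is trivial for it
    -- and the same majorant applies.
    refine abs_inputCoeff_le_geometric hL (κ := κ) (fun l => ?_) hκ1
      (fun l hl M' hM' _ => ?_) k
    · have := lp.norm_apply_le_norm (by norm_num) b l
      rw [Real.norm_eq_abs] at this
      linarith
    · have h0 : b l = 0 := by
        rw [hb, lp.coeFn_smul, Pi.smul_apply, hgdef,
          matchedFilter_apply_of_notMem h fun i hi => ?_, smul_zero]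
        rw [hi, abs_neg, Nat.abs_cast] at hl
        omega
      rw [h0, abs_zero]
      positivity
  · obtain ⟨f, hf, hmin, hcoef, hnoise⟩ := ha.exists_normalized
    have hr1 : P / N₀ ≤ 1 := (hε.trans_le (min_le_left _ _)).le
    have hr2 : P / N₀ * S ^ 2 ≤ κ := by
      have h1 : P / N₀ ≤ κ / (S ^ 2 + 1) := (hε.trans_le (min_le_right _ _)).le
      rw [le_div_iff₀ (by positivity)] at h1
      nlinarith [div_pos hP hN₀]
    have hfb : ‖f - b‖ ≤ √(P / N₀) * R := by
      refine le_of_sq_le_sq ?_ (by positivity)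
      rw [mul_pow, Real.sq_sqrt (by positivity)]
      exact norm_sub_sq_le_of_minimizer hN₀ hP.le hf hmin
    have hfM : ‖f‖ ≤ M := by
      have h1 : √(P / N₀) * R ≤ 1 * R :=
        mul_le_mul_of_nonneg_right (Real.sqrt_le_one.2 hr1) hR0
      have h2 := norm_add_le (f - b) b
      rw [sub_add_cancel] at h2
      linarith
    refine ⟨fun k => ?_, fun k => ?_, ?_⟩
    · rw [hcoef]
      refine abs_inputCoeff_le_geometric hL (κ := κ) (fun l => ?_) hκ1
        (fun l hl M' hM' hd => ?_) k
      · have := lp.norm_apply_le_norm (by norm_num) f l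
        rw [Real.norm_eq_abs] at this
        linarith
      · refine (abs_apply_le_of_minimizer hP.le hN₀ hf hmin (fun i hi => ?_) hM' hd).trans
          (mul_le_mul_of_nonneg_right hr2 hM')
        rw [hi, abs_neg, Nat.abs_cast] at hl
        omega
    · rw [hcoef, hρ]
      have e : inputCoeff h f k - inputCoeff h b k = inputCoeff h (f - b : lp (fun _ : ℤ => ℝ) 2) k := by
        simp only [inputCoeff, ← Finset.sum_sub_distrib, lp.coeFn_sub, Pi.sub_apply, mul_sub]
      rw [e]
      refine (abs_inputCoeff_le (M := √(P / N₀) * R) fun i => ?_).trans ?_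
      · exact (lp.norm_apply_le_norm (by norm_num) (f - b) _).trans hfb
      · nlinarith [mul_nonneg (sq_nonneg ‖g‖) (Real.sqrt_nonneg (P / N₀))]
    · rw [hnoise]
      -- The constraint `⟨g, f⟩ = 1` forces `‖f‖ ≥ 1 / ‖g‖`, so the noise after the filter cannot be
      -- small compared with `N₀`.
      have h1 := abs_real_inner_le_norm g f
      rw [hf, abs_one] at h1
      have h2 : 1 ≤ ‖g‖ ^ 2 * ‖f‖ ^ 2 := by
        rw [← mul_pow]; exact one_le_pow₀ h1
      have h3 : 0 ≤ S * R * (N₀ * ‖f‖ ^ 2) := by positivity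
      nlinarith

end filter

/-! ### The information inequality at low signal-to-noise ratio -/

/-- Termwise, `|x^j - y^j| ≤ j |x - y| max(|x|, |y|)^(j-1)`. Since `j ≥ 2`, a power of the majorant
remains and keeps the sum finite. -/
theorem abs_tsum_pow_sub_le {α ρ β : ℕ → ℝ} (hβ : Summable β) (hα : ∀ k, |α k| ≤ β k)
    (hρ : ∀ k, |ρ k| ≤ β k) {δ : ℝ} (hαρ : ∀ k, |α k - ρ k| ≤ δ) {j : ℕ} (hj : 2 ≤ j) :
    |∑' k, α (k + 1) ^ j - ∑' k, ρ (k + 1) ^ j| ≤ δ * (j * ∑' k, β (k + 1) ^ (j - 1)) := by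
  have hβ0 : ∀ k, 0 ≤ β k := fun k => (abs_nonneg _).trans (hα k)
  have hsα := (summable_nat_add_iff 1).2 (summable_pow_of_abs_le hβ hα (by omega : 1 ≤ j))
  have hsρ := (summable_nat_add_iff 1).2 (summable_pow_of_abs_le hβ hρ (by omega : 1 ≤ j))
  have hsβ := (summable_nat_add_iff 1).2 (summable_pow_of_abs_le hβ
    (fun k => (abs_of_nonneg (hβ0 k)).le) (by omega : 1 ≤ j - 1))
  rw [← hsα.tsum_sub hsρ, ← mul_assoc, ← tsum_mul_left, ← Real.norm_eq_abs]
  refine tsum_of_norm_bounded (hsβ.mul_left (δ * j)).hasSum fun k => ?_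
  refine (abs_pow_sub_pow_le (α (k + 1)) (ρ (k + 1)) j).trans ?_
  have h0 : 0 ≤ δ := (abs_nonneg _).trans (hαρ 0)
  have h1 := hαρ (k + 1)
  have h2 : max |α (k + 1)| |ρ (k + 1)| ≤ β (k + 1) := max_le (hα _) (hρ _)
  gcongr

/-- Reduces both claims to the sign of one power sum for the matched filter: by continuity, the MMSE
filters keep at least half of it at low SNR. -/
theorem infoMMSEltSLAtLowSNR_of_gaussGap {ν : Measure ℝ} [IsProbabilityMeasure ν] {j : ℕ}
    (hj : 2 ≤ j) (hν : MemLp (fun z : ℝ => z) ((2 * j : ℕ) : ℝ≥0∞) ν) (hM : MatchesGauss j ν)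
    (hgap : gaussGap j ν ≠ 0) (hp : 0 < inputPower ν) {L : ℕ} {h : Fin L → ℝ}
    (hh : ∃ i, h i ≠ 0) (hρ : 0 < ∑' k, residualCoeff h (matchedFilter h) (k + 1) ^ j) :
    InfoMMSEltSLAtLowSNR ν h := by
  obtain ⟨β, hβ, hβ0, hρβ, C, hC, ε, hε, H⟩ := exists_residualCoeff_bounds hh
  set r := ∑' k, residualCoeff h (matchedFilter h) (k + 1) ^ j with hr
  obtain ⟨δ, hδ, hlt⟩ := exists_infoMMSE_lt_infoSL hj hν hM hgap hp hβ hβ0 (half_pos hρ)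
  set B := ∑' k, β (k + 1) ^ (j - 1) with hB
  have hB0 : 0 ≤ B := tsum_nonneg fun k => pow_nonneg (hβ0 _) _
  set D := C * (j * B) + 1 with hD
  have hD0 : 0 < D := by positivity
  -- The thresholds serve, in order, the filter bounds, the smallness of `c²` relative to the
  -- filtered noise, and the power sum staying above `r / 2`.
  refine ⟨min ε (min (δ * inputPower ν / C) ((r / 2 / D) ^ 2)), by positivity,
    fun c N₀ hc hN₀ hlow => ?_⟩
  set P := inputPower (scaledLaw ν c) with hPdef
  have hPc : P = c ^ 2 * inputPower ν := inputPower_scaledLaw ν c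
  have hP : 0 < P := by rw [hPc]; positivity
  refine ⟨exists_isMMSEFilter hh hP.le hN₀, fun a ha => ?_⟩
  have h1 : P / N₀ < ε := hlow.trans_le (min_le_left _ _)
  have h2 : P / N₀ < δ * inputPower ν / C :=
    hlow.trans_le ((min_le_right _ _).trans (min_le_left _ _))
  have h3 : P / N₀ < (r / 2 / D) ^ 2 := hlow.trans_le ((min_le_right _ _).trans (min_le_right _ _))
  obtain ⟨hαβ, hαρ, hv⟩ := H P N₀ hP hN₀ h1 a ha
  have hv0 : 0 < filteredNoiseVar h N₀ a := pos_of_mul_pos_right (hN₀.trans_le hv) hC.le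
  refine hlt L h a c N₀ hc hN₀ hv0 ?_ hαβ ?_
  · rw [div_lt_div_iff₀ hN₀ hC, hPc] at h2
    have h4 : inputPower ν * (c ^ 2 * C) < inputPower ν * (δ * filteredNoiseVar h N₀ a * C) := by
      have : δ * inputPower ν * N₀ ≤ δ * inputPower ν * (C * filteredNoiseVar h N₀ a) := by gcongr
      linarith
    exact lt_of_mul_lt_mul_right (lt_of_mul_lt_mul_left h4 hp.le) hC.le
  · have h4 := (abs_le.1 (abs_tsum_pow_sub_le hβ hαβ hρβ hαρ hj)).1
    have h5 : √(P / N₀) ≤ r / 2 / D := (Real.sqrt_le_left (by positivity)).2 h3.le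
    rw [le_div_iff₀ hD0] at h5
    have h6 : √(P / N₀) * (C * (j * B)) ≤ √(P / N₀) * D :=
      mul_le_mul_of_nonneg_left (by linarith) (Real.sqrt_nonneg _)
    rw [← hB, ← hr] at h4
    linarith

/-! ### Residual interference of the matched filter -/

theorem inputCoeff_matchedFilter_zero_pos {L : ℕ} {h : Fin L → ℝ} (hh : ∃ i, h i ≠ 0) :
    0 < inputCoeff h (matchedFilter h) 0 := by
  rw [← inner_matchedFilter, real_inner_self_eq_norm_sq]
  exact pow_pos (norm_pos_iff.2 (matchedFilter_ne_zero hh)) 2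

/-- With two nonzero taps, the matched filter leaves interference at the largest lag. -/
theorem exists_residualCoeff_matchedFilter_ne_zero {L : ℕ} {h : Fin L → ℝ}
    (hh : ∃ i j : Fin L, i ≠ j ∧ h i ≠ 0 ∧ h j ≠ 0) :
    ∃ k, residualCoeff h (matchedFilter h) (k + 1) ≠ 0 := by
  obtain ⟨i, j, hij, hi, hj⟩ := hh
  set s : Finset (Fin L) := Finset.univ.filter fun i => h i ≠ 0 with hs
  have hsi : i ∈ s := by simp [hs, hi]
  have hsj : j ∈ s := by simp [hs, hj]
  have hne : s.Nonempty := ⟨i, hsi⟩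
  set m := s.min' hne with hm
  set n := s.max' hne with hn
  have hmn : m < n := Finset.min'_lt_max' s hsi hsj hij
  have hhm : h m ≠ 0 := (Finset.mem_filter.1 (s.min'_mem hne)).2
  have hhn : h n ≠ 0 := (Finset.mem_filter.1 (s.max'_mem hne)).2
  have hmn' : (m : ℕ) < n := hmn
  -- At lag `n - m`, the distance between the extreme nonzero taps, the autocorrelation has the
  -- single term `h m * h n`; the lag is `k + 1`, hence the shift by one.
  refine ⟨n - m - 1, div_ne_zero ?_ (inputCoeff_matchedFilter_zero_pos ⟨i, hi⟩).ne'⟩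
  have hk : ((n - m - 1 + 1 : ℕ) : ℤ) = (n : ℤ) - m := by omega
  rw [inputCoeff, Finset.sum_eq_single m]
  · rw [hk, show -(m : ℤ) - ((n : ℤ) - m) = -(n : ℤ) by ring, matchedFilter_apply_neg]
    exact mul_ne_zero hhm hhn
  · intro l _ hl
    by_cases hl0 : h l = 0
    · rw [hl0, zero_mul]
    have hml : m ≤ l := s.min'_le l (by simp [hs, hl0])
    have hml' : (m : ℕ) < l := lt_of_le_of_ne hml fun h => hl (Fin.ext h.symm)
    rw [hk]
    refine mul_eq_zero_of_right _ ?_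
    by_cases hin : ∃ t : Fin L, -(l : ℤ) - ((n : ℤ) - m) = -(t : ℤ)
    · obtain ⟨t, ht⟩ := hin
      rw [ht, matchedFilter_apply_neg]
      by_contra ht0
      have htn : t ≤ n := s.le_max' t (by simp [hs, ht0])
      have htn' : (t : ℕ) ≤ n := htn
      omega
    · exact matchedFilter_apply_of_notMem h fun t ht => hin ⟨t, ht⟩
  · simp

/-- Only lag one survives, with coefficient `a b / (a² + b²) > 0`. -/
theorem tsum_residualCoeff_matchedFilter_two_pos {a b : ℝ} (ha : 0 < a) (hb : 0 < b) (j : ℕ)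
    (hj : 1 ≤ j) : 0 < ∑' k, residualCoeff ![a, b] (matchedFilter ![a, b]) (k + 1) ^ j := by
  have h0 := inputCoeff_matchedFilter_zero_pos (h := ![a, b]) ⟨0, by simpa using ha.ne'⟩
  rw [tsum_eq_single 0]
  · refine pow_pos (div_pos ?_ h0) _
    have e0 := matchedFilter_apply_neg ![a, b] 1
    have e1 : matchedFilter ![a, b] (-2) = 0 := matchedFilter_apply_of_notMem _ fun i => by
      fin_cases i <;> simp
    simp [inputCoeff] at e0 ⊢
    norm_num [e0, e1]
    positivity
  · intro k hk
    have e : inputCoeff ![a, b] (matchedFilter ![a, b]) (k + 1) = 0 := by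
      refine Finset.sum_eq_zero fun i _ => mul_eq_zero_of_right _ ?_
      refine matchedFilter_apply_of_notMem _ fun t => ?_
      omega
    rw [residualCoeff, e, zero_div, zero_pow (by omega)]

theorem theorem1 (ν : Measure ℝ) [IsProbabilityMeasure ν] (hmean : ∫ x, x ∂ν = 0) :
    (MemLp (fun x : ℝ => x) 8 ν → 0 < inputPower ν → skewness ν = 0 → excessKurtosis ν ≠ 0 →
      ∀ (L : ℕ) (h : Fin L → ℝ), (∃ i j : Fin L, i ≠ j ∧ h i ≠ 0 ∧ h j ≠ 0) →
        InfoMMSEltSLAtLowSNR ν h) ∧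
    (MemLp (fun x : ℝ => x) 6 ν → skewness ν ≠ 0 →
      ∀ q : ℝ, 0 < q → q < 1 → InfoMMSEltSLAtLowSNR ν ![√(1 - q ^ 2), q]) := by
  have hM3 : MatchesGauss 3 ν := by
    intro i hi
    interval_cases i
    · simp [gaussMoment_zero]
    · simp [gaussMoment_one, hmean]
    · rw [gaussMoment_two (integral_sq_nonneg ν)]
  refine ⟨fun hν hp hs hκ L h hh => ?_, fun hν hs q hq hq1 => ?_⟩
  · have h3 : ∫ x, x ^ 3 ∂ν = 0 := by
      have hpow : inputPower ν ^ (3 / 2 : ℝ) ≠ 0 := (Real.rpow_pos_of_pos hp _).ne'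
      simpa [skewness, hpow] using hs
    have hM4 : MatchesGauss 4 ν := by
      intro i hi
      rcases (by omega : i < 3 ∨ i = 3) with hi | rfl
      · exact hM3 i hi
      · rw [h3, gaussMoment_three]
    have hgap : gaussGap 4 ν ≠ 0 := by
      rw [gaussGap, gaussMoment_four (integral_sq_nonneg ν)]
      intro h0
      apply hκ
      rw [excessKurtosis, sub_eq_zero, div_eq_iff (by positivity)]
      exact sub_eq_zero.1 h0
    have hh1 : ∃ i, h i ≠ 0 := by obtain ⟨i, _, _, hi, _⟩ := hh; exact ⟨i, hi⟩
    refine infoMMSEltSLAtLowSNR_of_gaussGap (j := 4) (by norm_num) (by exact_mod_cast hν) hM4 hgap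
      hp hh1 ?_
    obtain ⟨k, hk⟩ := exists_residualCoeff_matchedFilter_ne_zero hh
    obtain ⟨β, hβ, -, hρβ, -⟩ := exists_residualCoeff_bounds hh1
    -- Fourth powers are nonnegative, so one nonzero lag suffices.
    refine ((summable_nat_add_iff 1).2 (summable_pow_of_abs_le hβ hρβ (by norm_num))).tsum_pos
      (fun k => Even.pow_nonneg (by decide) _) k ?_
    positivity
  · have hp : 0 < inputPower ν := by
      -- With zero power, `skewness` is a quotient by zero and takes the default value `0`, so
      -- nonzero skewness already forces positive power.
      refine lt_of_le_of_ne (integral_sq_nonneg ν) fun h0 => hs ?_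
      rw [skewness, ← h0, Real.zero_rpow (by norm_num), div_zero]
    have hgap : gaussGap 3 ν ≠ 0 := by
      rw [gaussGap, gaussMoment_three, sub_zero]
      intro h0
      exact hs (by rw [skewness, h0, zero_div])
    have hq2 : 0 < √(1 - q ^ 2) := Real.sqrt_pos.2 (by nlinarith)
    exact infoMMSEltSLAtLowSNR_of_gaussGap (j := 3) (by norm_num) (by exact_mod_cast hν) hM3 hgap hp
      ⟨0, by simpa using hq2.ne'⟩ (tsum_residualCoeff_matchedFilter_two_pos hq2 hq 3 (by norm_num))
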